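/- Let $p:\mathcal E\to\mathcal B$ be a (Grothendieck) fibration with finite products: $\mathcal B$ and every fibre $\mathcal E_X$ have finite products ($\top_X$, $\wedge$), and every reindexing functor $f^*$ preserves them. "Cartesian" and "cocartesian" refer to $p$ and mean the universal property with respect to all factorisations in the base. Products in $\mathcal B$ and in the fibres may be any product diagrams; $\langle i_1,\dots,i_k\rangle$ denotes a list of projections, so that $\langle 1,1\rangle:X\to X\times X$ is the diagonal and an object $X$ is also a product $1\times X$. Let $\Delta$ be the class of parametrised diagonals $\langle1,2,2\rangle:Y\times X\to Y\times X\times X$, for all $Y,X$ in $\mathcal B$. Definitions. * $p$ is *elementary* if for all $Y,X$ the functor $\langle1,2,2\rangle^*:\mathcal E_{Y\times X\times X}\to\mathcal E_{Y\times X}$ has a left adjoint $\Sigma_{Y,X}$ such that the canonical arrows $\Sigma_{Y,X}(\langle1,2,2\rangle^*D\wedge A)\to D\wedge \Sigma_{Y,X}A$ (Frobenius reciprocity) and, for every $f:Y\to Z$ and $A$ over $Z\times X$, $\Sigma_{Y,X}(f\times X)^*A\to(f\times X\times X)^*\Sigma_{Z,X}A$ (Beck–Chevalley) are isomorphisms.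 * Let $\varphi:A\to D$ be over $V\times f:V\times Y\to V\times X$. A *parametrised reindexing* of $\varphi$ along $g:U\to V$ is an arrow $\varphi':A'\to D'$ over $U\times f$ that fits in a commutative square $\varphi\alpha=\beta\varphi'$ with $\alpha:A'\to A$ cartesian over $g\times Y$ and $\beta:D'\to D$ cartesian over $g\times X$. The class $\Phi$ of cocartesian arrows over $\Delta$ is *product-stable* if for all $V,U,g$, every $f\in\Delta$ and every $\varphi\in\Phi$ over $V\times f$, every parametrised reindexing of $\varphi$ along $g$ is in $\Phi$. * $\Phi$ is *pairable* if for every $\varphi:A\to D$ in $\Phi$ and every cartesian $\psi:C'\to C$ over $p(\varphi)$, the arrow $\varphi\wedge\psi=\langle\varphi\pi_1,\psi\pi_2\rangle:A\wedge C'\to D\wedge C$ over $p(\varphi)$ is in $\Phi$. * A *loop* on $X$ is an object $\mathrm{Eq}_X$ over $X\times X$ with an arrow $\delta_X:\top_X\to\mathrm{Eq}_X$ over $\langle1,1\rangle$. For $A$ over $X$ let $\delta_A=\langle\iota,\delta_X{!}\rangle:A\to\langle1\rangle^*A\wedge\mathrm{Eq}_X$ over $\langle1,1\rangle$, where $\iota:A\to\langle1\rangle^*A$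 over $\langle1,1\rangle$ is the section of the cartesian lift $\langle1\rangle^*A\to A$. A *strict transporter* on $X$ is a loop on $X$ together with, for every $A$ over $X$, an arrow $t_A:\langle1\rangle^*A\wedge\mathrm{Eq}_X\to A$ over $\langle2\rangle:X\times X\to X$ with $t_A\delta_A=\mathrm{id}_A$. *Strict productive transporters* consist of a strict transporter on every $X$ such that for all $X,Y$ there is a vertical arrow $\chi:\mathrm{Eq}_X\boxtimes\mathrm{Eq}_Y:=\langle1,3\rangle^*\mathrm{Eq}_X\wedge\langle2,4\rangle^*\mathrm{Eq}_Y\to\mathrm{Eq}_{X\times Y}$ over $X\times Y\times X\times Y$ with $\chi\circ(\delta_X\boxtimes\delta_Y)=\delta_{X\times Y}$, where $\delta_X\boxtimes\delta_Y:\top_{X\times Y}\to\mathrm{Eq}_X\boxtimes\mathrm{Eq}_Y$ is the arrow over the diagonal of $X\times Y$ induced by $\top_{X\times Y}\to\top_X\to\mathrm{Eq}_X$ and $\top_{X\times Y}\to\top_Y\to\mathrm{Eq}_Y$. * For a loop $\delta_X$, the class $\mathrm{BCFR}(\delta_X)$ consists of the arrows $\sigma\wedge\delta':C\wedge A'\to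 C'\wedge D'$ over $U\times\langle1,1\rangle:U\times X\to U\times(X\times X)$, for any object $U$, where $\delta':A'\to D'$ is a parametrised reindexing of $\delta_X$ (viewed as an arrow over $1\times\langle1,1\rangle$) along $U\to1$, and where $\sigma:C\to C'$ and $\rho:C'\to C$ are cartesian over $U\times\langle1,1\rangle$ and $U\times\langle1\rangle$ respectively, with $\rho\sigma=\mathrm{id}_C$. * An arrow $\varphi$ of $\mathcal E$ is *fibred-epic* if $\psi\varphi=\psi'\varphi$ and $p(\psi)=p(\psi')$ imply $\psi=\psi'$. Theorem. The following are equivalent. (i) $p$ is elementary. (ii) Every arrow in $\Delta$ has cocartesian lifts from every object over its domain, and the class of cocartesian arrows over $\Delta$ is product-stable and pairable. (iii) For every $X$ there are an object $\mathrm{Eq}_X$ over $X\times X$ and a cocartesian arrow $\delta_X:\top_X\to\mathrm{Eq}_X$ over $\langle1,1\rangle:X\to X\times X$, and the class of cocartesian arrows over $\Delta$ is product-stable and pairable. (iv) $p$ has strict productive transporters such that, for their loops $\delta_X$, every arrow in $\mathrm{BCFR}(\delta_X)$ is fibred-epic and lies over $\Delta$, for every $X$. (v) There is a loop $\delta_X:\top_X\to\mathrm{Eq}_X$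 on every $X$ such that, for every $X$, every arrow in $\mathrm{BCFR}(\delta_X)$ is cocartesian and lies over $\Delta$. (vi) For every $X$ there is an object $\mathrm{Eq}_X$ over $X\times X$ such that, for all $Y,X$, the functor $A\mapsto(\langle1,2\rangle^*A)\wedge(\langle2,3\rangle^*\mathrm{Eq}_X)$ from $\mathcal E_{Y\times X}$ to $\mathcal E_{Y\times X\times X}$ is left adjoint to $\langle1,2,2\rangle^*:\mathcal E_{Y\times X\times X}\to\mathcal E_{Y\times X}$. -/

import Mathlib

open CategoryTheory CategoryTheory.Limits CategoryTheory.Functor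

namespace ElemFib

universe v₁ v₂ u₁ u₂

section Products

variable {C : Type u₁} [Category.{v₁} C]

/-- `a : P ⟶ A` and `b : P ⟶ A'` exhibit `P` as a (not necessarily chosen) binary product
of `A` and `A'`. -/
def IsBinProd {P A A' : C} (a : P ⟶ A) (b : P ⟶ A') : Prop :=
  Nonempty (IsLimit (BinaryFan.mk a b))

/-- If `(a₁, a₂)` and `(b₁, b₂)` are the projections of two binary products, this says that `k` is
the arrow `f₁ × f₂` between them. -/
def IsProdMap {P P' A₁ A₂ A₁' A₂' : C} (a₁ : P ⟶ A₁) (a₂ : P ⟶ A₂) (b₁ : P' ⟶ A₁') (b₂ : P' ⟶ A₂')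
    (f₁ : A₁ ⟶ A₁') (f₂ : A₂ ⟶ A₂') (k : P ⟶ P') : Prop :=
  k ≫ b₁ = a₁ ≫ f₁ ∧ k ≫ b₂ = a₂ ≫ f₂

/-- The class of parametrised diagonals `⟨1,2,2⟩ : Y × X ⟶ Y × X × X`, for all objects `Y`, `X`
and all product diagrams: the domain `W` is a product of `Y` and `X` with projections `w₁`, `w₂`,
the codomain `Z` is a product of `W` and `X` with projections `z₁₂`, `z₃`, and the arrow is
`⟨𝟙, w₂⟩`. -/
def ParamDiag : MorphismProperty C := fun W Z d =>
  ∃ (Y X : C) (w₁ : W ⟶ Y) (w₂ : W ⟶ X) (z₁₂ : Z ⟶ W) (z₃ : Z ⟶ X),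
    IsBinProd w₁ w₂ ∧ IsBinProd z₁₂ z₃ ∧ d ≫ z₁₂ = 𝟙 W ∧ d ≫ z₃ = w₂

variable [HasFiniteProducts C]

/-- `⟨1,1⟩ : X ⟶ X × X`. -/
noncomputable def dia (X : C) : X ⟶ X ⨯ X := prod.lift (𝟙 X) (𝟙 X)

/-- `⟨1,2,2⟩ : Y × X ⟶ Y × X × X`, for the chosen products. -/
noncomputable def pdia (Y X : C) : Y ⨯ X ⟶ (Y ⨯ X) ⨯ X := prod.lift (𝟙 (Y ⨯ X)) prod.snd

/-- `⟨1,2⟩ : Y × X × X ⟶ Y × X`. -/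
noncomputable def pr12 (Y X : C) : (Y ⨯ X) ⨯ X ⟶ Y ⨯ X := prod.fst

/-- `⟨2,3⟩ : Y × X × X ⟶ X × X`. -/
noncomputable def pr23 (Y X : C) : (Y ⨯ X) ⨯ X ⟶ X ⨯ X := prod.lift (prod.fst ≫ prod.snd) prod.snd

/-- `⟨1,3⟩ : X × Y × X × Y ⟶ X × X`. -/
noncomputable def pr13 (X Y : C) : (X ⨯ Y) ⨯ (X ⨯ Y) ⟶ X ⨯ X := prod.map prod.fst prod.fst

/-- `⟨2,4⟩ : X × Y × X × Y ⟶ Y × Y`. -/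
noncomputable def pr24 (X Y : C) : (X ⨯ Y) ⨯ (X ⨯ Y) ⟶ Y ⨯ Y := prod.map prod.snd prod.snd

end Products

variable {B : Type u₁} [Category.{v₁} B] {E : Type u₂} [Category.{v₂} E] (p : E ⥤ B)

section Fibres

variable {p}

/-- The object of the total category underlying an object of a fibre. -/
abbrev tot {X : B} (A : p.Fiber X) : E := Fiber.fiberInclusion.obj A

/-- The arrow of the total category underlying an arrow of a fibre. -/
abbrev und {X : B} {A A' : p.Fiber X} (φ : A ⟶ A') : tot A ⟶ tot A' := Fiber.fiberInclusion.map φ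

lemma und_ext {X : B} {A A' : p.Fiber X} {φ ψ : A ⟶ A'} (h : und φ = und ψ) : φ = ψ :=
  Fiber.hom_ext h

variable (p)

/-- A vertical arrow of the total category, as an arrow of the fibre. -/
def vert {X : B} {A A' : p.Fiber X} (φ : tot A ⟶ tot A') [h : p.IsHomLift (𝟙 X) φ] : A ⟶ A' :=
  ⟨φ, h⟩

@[simp]
lemma und_vert {X : B} {A A' : p.Fiber X} (φ : tot A ⟶ tot A') [p.IsHomLift (𝟙 X) φ] :
    und (vert p φ) = φ := rfl

instance id_isHomLift {X : B} (A : p.Fiber X) : p.IsHomLift (𝟙 X) (𝟙 (tot A)) := IsHomLift.id A.2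

end Fibres

section Reindexing

variable [p.IsFibered]

/-- The domain of a chosen cartesian lift of `f` into `A`. -/
noncomputable def reindexObj {X Y : B} (f : X ⟶ Y) (A : p.Fiber Y) : p.Fiber X :=
  ⟨IsPreFibered.pullbackObj A.2 f, IsPreFibered.pullbackObj_proj A.2 f⟩

/-- The chosen cartesian lift of `f` into `A`. -/
noncomputable def reindexArr {X Y : B} (f : X ⟶ Y) (A : p.Fiber Y) :
    tot (reindexObj p f A) ⟶ tot A :=
  IsPreFibered.pullbackMap A.2 f

instance reindexArr_isStronglyCartesian {X Y : B} (f : X ⟶ Y) (A : p.Fiber Y) :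
    p.IsStronglyCartesian f (reindexArr p f A) := by
  have : p.IsCartesian f (reindexArr p f A) := IsPreFibered.pullbackMap.IsCartesian A.2 f
  infer_instance

/-- The reindexing functor `f^*` between the fibres. -/
noncomputable def reindex {X Y : B} (f : X ⟶ Y) : p.Fiber Y ⥤ p.Fiber X where
  obj A := reindexObj p f A
  map {A A'} φ := vert p (IsStronglyCartesian.map p f (reindexArr p f A') (g := 𝟙 X)
    (f' := f ≫ 𝟙 Y) (by simp) (reindexArr p f A ≫ und φ))
  map_id A := by
    apply und_ext
    apply IsStronglyCartesian.ext p f (reindexArr p f A) (𝟙 X)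
    simp
  map_comp {A A' A''} φ ψ := by
    apply und_ext
    apply IsStronglyCartesian.ext p f (reindexArr p f A'') (𝟙 X)
    simp only [und_vert, Functor.map_comp, IsStronglyCartesian.fac, Category.assoc]
    rw [← Category.assoc, ← Category.assoc, IsStronglyCartesian.fac]

/-- The chosen cartesian lift of `f` into `A`, as an arrow from `f^* A`. -/
noncomputable def cart {X Y : B} (f : X ⟶ Y) (A : p.Fiber Y) : tot ((reindex p f).obj A) ⟶ tot A :=
  reindexArr p f A

instance cart_isStronglyCartesian {X Y : B} (f : X ⟶ Y) (A : p.Fiber Y) :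
    p.IsStronglyCartesian f (cart p f A) :=
  reindexArr_isStronglyCartesian p f A

/-- The arrow over `g` into `f^* A` induced by an arrow `φ` over `h = g ≫ f` into `A`. -/
noncomputable def cartLift {W X Y : B} {g : W ⟶ X} {f : X ⟶ Y} {h : W ⟶ Y} (w : h = g ≫ f)
    {c : E} (A : p.Fiber Y) (φ : c ⟶ tot A) [p.IsHomLift h φ] : c ⟶ tot ((reindex p f).obj A) :=
  IsStronglyCartesian.map p f (cart p f A) w φ

instance cartLift_isHomLift {W X Y : B} {g : W ⟶ X} {f : X ⟶ Y} {h : W ⟶ Y} (w : h = g ≫ f)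
    {c : E} (A : p.Fiber Y) (φ : c ⟶ tot A) [p.IsHomLift h φ] :
    p.IsHomLift g (cartLift p w A φ) :=
  IsStronglyCartesian.map_isHomLift p f (cart p f A) w φ

@[simp]
lemma cartLift_cart {W X Y : B} {g : W ⟶ X} {f : X ⟶ Y} {h : W ⟶ Y} (w : h = g ≫ f)
    {c : E} (A : p.Fiber Y) (φ : c ⟶ tot A) [p.IsHomLift h φ] :
    cartLift p w A φ ≫ cart p f A = φ :=
  IsStronglyCartesian.fac p f (cart p f A) w φ

lemma cart_hom_ext {W X Y : B} (g : W ⟶ X) (f : X ⟶ Y) {c : E} (A : p.Fiber Y)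
    (ψ ψ' : c ⟶ tot ((reindex p f).obj A)) [p.IsHomLift g ψ] [p.IsHomLift g ψ']
    (h : ψ ≫ cart p f A = ψ' ≫ cart p f A) : ψ = ψ' :=
  IsStronglyCartesian.ext p f (cart p f A) g h

/-- The vertical arrow `C ⟶ f^* A` induced by an arrow `φ : C ⟶ A` over `f`. -/
noncomputable def cartVert {X Y : B} (f : X ⟶ Y) {C : p.Fiber X} (A : p.Fiber Y) (φ : tot C ⟶ tot A)
    [p.IsHomLift f φ] : C ⟶ (reindex p f).obj A :=
  vert p (cartLift p (g := 𝟙 X) (f := f) (h := f) (by simp) A φ)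

@[simp]
lemma und_cartVert_cart {X Y : B} (f : X ⟶ Y) {C : p.Fiber X} (A : p.Fiber Y) (φ : tot C ⟶ tot A)
    [p.IsHomLift f φ] : und (cartVert p f A φ) ≫ cart p f A = φ := by
  simp [cartVert]

lemma cart_und {X Y : B} (f : X ⟶ Y) {A A' : p.Fiber Y} (φ : A ⟶ A') :
    cart p f A ≫ und φ = und ((reindex p f).map φ) ≫ cart p f A' := by
  exact (IsStronglyCartesian.fac p f (reindexArr p f A') (g := 𝟙 X) (f' := f ≫ 𝟙 Y) (by simp)
    (reindexArr p f A ≫ und φ)).symm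

/-- The vertical arrow `c^* d^* D ⟶ a^* b^* D` compatible with the cartesian lifts, for a
commutative square `a ≫ b = c ≫ d` in the base. -/
noncomputable def reindexSq {W X Y Z : B} {a : W ⟶ X} {b : X ⟶ Z} {c : W ⟶ Y} {d : Y ⟶ Z}
    (w : a ≫ b = c ≫ d) (D : p.Fiber Z) :
    (reindex p c).obj ((reindex p d).obj D) ⟶ (reindex p a).obj ((reindex p b).obj D) :=
  vert p (cartLift p (g := 𝟙 W) (f := a) (h := a) (by simp) _
      (cartLift p (g := a) (f := b) (h := c ≫ d) w.symm D
        (cart p c ((reindex p d).obj D) ≫ cart p d D)))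

end Reindexing

/-- The fibres of the fibration have finite products and reindexing preserves them; a fibration
over a base with finite products which satisfies this is a fibration with finite products. -/
class HasFibredProducts [p.IsFibered] : Prop where
  fibre : ∀ X : B, HasFiniteProducts (p.Fiber X)
  preserves : ∀ {X Y : B} (f : X ⟶ Y), PreservesFiniteProducts (reindex p f)

attribute [instance] HasFibredProducts.fibre HasFibredProducts.preserves

section Pairing

variable [p.IsFibered] [HasFibredProducts p]

/-- The arrow `⟨φ, φ'⟩ : C ⟶ A ∧ A'` over `f` induced by two arrows over `f`. -/
noncomputable def pair {X Y : B} (f : X ⟶ Y) {C : p.Fiber X} {A A' : p.Fiber Y} (φ : tot C ⟶ tot A)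
    (φ' : tot C ⟶ tot A') [p.IsHomLift f φ] [p.IsHomLift f φ'] : tot C ⟶ tot (A ⨯ A') :=
  und (prod.lift (cartVert p f A φ) (cartVert p f A' φ') ≫
    (PreservesLimitPair.iso (reindex p f) A A').inv) ≫ cart p f (A ⨯ A')

/-- The arrow `A ⟶ ⊤` over `f` into the terminal object of the fibre over the codomain of `f`. -/
noncomputable def toTop {X Y : B} (f : X ⟶ Y) (A : p.Fiber X) : tot A ⟶ tot (⊤_ (p.Fiber Y)) :=
  und (terminal.from A ≫ (PreservesTerminal.iso (reindex p f)).inv) ≫ cart p f (⊤_ (p.Fiber Y))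

instance pair_isHomLift {X Y : B} (f : X ⟶ Y) {C : p.Fiber X} {A A' : p.Fiber Y} (φ : tot C ⟶ tot A)
    (φ' : tot C ⟶ tot A') [p.IsHomLift f φ] [p.IsHomLift f φ'] : p.IsHomLift f (pair p f φ φ') := by
  have h : p.IsHomLift (𝟙 X ≫ f) (pair p f φ φ') := by unfold pair; infer_instance
  rwa [Category.id_comp] at h

instance toTop_isHomLift {X Y : B} (f : X ⟶ Y) (A : p.Fiber X) :
    p.IsHomLift f (toTop p f A) := by
  have h : p.IsHomLift (𝟙 X ≫ f) (toTop p f A) := by unfold toTop; infer_instance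
  rwa [Category.id_comp] at h

lemma pair_fst {X Y : B} (f : X ⟶ Y) {C : p.Fiber X} {A A' : p.Fiber Y} (φ : tot C ⟶ tot A)
    (φ' : tot C ⟶ tot A') [p.IsHomLift f φ] [p.IsHomLift f φ'] :
    pair p f φ φ' ≫ und prod.fst = φ := by
  have h : (PreservesLimitPair.iso (reindex p f) A A').inv ≫ (reindex p f).map prod.fst
      = prod.fst := by
    rw [Iso.inv_comp_eq, PreservesLimitPair.iso_hom, prodComparison_fst]
  rw [pair, Category.assoc, cart_und, ← Category.assoc, ← Functor.map_comp, Category.assoc, h,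
    prod.lift_fst]
  exact und_cartVert_cart p f A φ

lemma pair_snd {X Y : B} (f : X ⟶ Y) {C : p.Fiber X} {A A' : p.Fiber Y} (φ : tot C ⟶ tot A)
    (φ' : tot C ⟶ tot A') [p.IsHomLift f φ] [p.IsHomLift f φ'] :
    pair p f φ φ' ≫ und prod.snd = φ' := by
  have h : (PreservesLimitPair.iso (reindex p f) A A').inv ≫ (reindex p f).map prod.snd
      = prod.snd := by
    rw [Iso.inv_comp_eq, PreservesLimitPair.iso_hom, prodComparison_snd]
  rw [pair, Category.assoc, cart_und, ← Category.assoc, ← Functor.map_comp, Category.assoc, h,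
    prod.lift_snd]
  exact und_cartVert_cart p f A' φ'

end Pairing

section Classes

/-- The class of cocartesian arrows lying over arrows of the class `Θ`. -/
def cocartOver (Θ : MorphismProperty B) : MorphismProperty E := fun _ _ φ =>
  p.IsStronglyCocartesian (p.map φ) φ ∧ Θ (p.map φ)

/-- Arrows that are epic with respect to parallel pairs with the same image in the base. -/
def fibEpic : MorphismProperty E := fun _ b φ =>
  ∀ {b' : E} (ψ ψ' : b ⟶ b'), p.map ψ = p.map ψ' → φ ≫ ψ = φ ≫ ψ' → ψ = ψ'

/-- Every arrow of `Θ` has cocartesian lifts from every object over its domain. -/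
def HasCocartLifts (Θ : MorphismProperty B) : Prop :=
  ∀ {X Y : B} (f : X ⟶ Y), Θ f → ∀ A : p.Fiber X,
    ∃ (D : p.Fiber Y) (φ : tot A ⟶ tot D), p.IsStronglyCocartesian f φ

/-- The class `Φ` is stable under parametrised reindexing of arrows over `V × f` with `f` in `Θ`:
for every commutative square `α ≫ φ = φ' ≫ β` in the total category, with `α` and `β` cartesian,
over the square formed by `V × f`, `U × f`, `g × Y` and `g × X`, if `φ` is in `Φ` then so
is `φ'`. -/
def ProductStable (Θ : MorphismProperty B) (Φ : MorphismProperty E) : Prop :=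
  ∀ {U V Y X : B} (g : U ⟶ V) (f : Y ⟶ X), Θ f →
  ∀ {UY VY UX VX : B}
    (a₁ : UY ⟶ U) (a₂ : UY ⟶ Y) (b₁ : VY ⟶ V) (b₂ : VY ⟶ Y)
    (c₁ : UX ⟶ U) (c₂ : UX ⟶ X) (d₁ : VX ⟶ V) (d₂ : VX ⟶ X),
    IsBinProd a₁ a₂ → IsBinProd b₁ b₂ → IsBinProd c₁ c₂ → IsBinProd d₁ d₂ →
  ∀ (gY : UY ⟶ VY) (gX : UX ⟶ VX) (Uf : UY ⟶ UX) (Vf : VY ⟶ VX),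
    IsProdMap a₁ a₂ b₁ b₂ g (𝟙 Y) gY → IsProdMap c₁ c₂ d₁ d₂ g (𝟙 X) gX →
    IsProdMap a₁ a₂ c₁ c₂ (𝟙 U) f Uf → IsProdMap b₁ b₂ d₁ d₂ (𝟙 V) f Vf →
  ∀ {A' A D' D : E} (φ' : A' ⟶ D') (φ : A ⟶ D) (α : A' ⟶ A) (β : D' ⟶ D),
    p.IsHomLift Uf φ' → p.IsHomLift Vf φ →
    p.IsStronglyCartesian gY α → p.IsStronglyCartesian gX β →
    α ≫ φ = φ' ≫ β → Φ φ → Φ φ'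

/-- The class `Φ` is closed under `φ ↦ φ ∧ ψ` for `ψ` cartesian over the same arrow `f` as `φ`;
the products are taken in the fibres. -/
def Pairable (Φ : MorphismProperty E) : Prop :=
  ∀ {X Y : B} (f : X ⟶ Y) {A C' P : p.Fiber X} {D C Q : p.Fiber Y}
    (φ : tot A ⟶ tot D) (ψ : tot C' ⟶ tot C) (π₁ : P ⟶ A) (π₂ : P ⟶ C') (π₁' : Q ⟶ D) (π₂' : Q ⟶ C)
    (χ : tot P ⟶ tot Q),
    p.IsHomLift f φ → p.IsStronglyCartesian f ψ → IsBinProd π₁ π₂ → IsBinProd π₁' π₂' →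
    p.IsHomLift f χ → χ ≫ und π₁' = und π₁ ≫ φ → χ ≫ und π₂' = und π₂ ≫ ψ →
    Φ φ → Φ χ

/-- Let `s ≫ r = 𝟙` be a retraction pair in the base, let `W` and `Z` be products `V × X` and
`V × Y` with projections `w₁, w₂` and `z₁, z₂`, and let `φ : A ⟶ D` be an arrow over `V × s`.
This is the class of the arrows `ψ` obtained from `φ` by a parametrised reindexing `φ'` along some
`g : U ⟶ V` followed by a split pairing `ψ = σ ∧ φ' : C ∧ A' ⟶ C' ∧ D'`. -/
inductive BCFR {V X Y W Z : B} (s : X ⟶ Y) (r : Y ⟶ X) (w₁ : W ⟶ V) (w₂ : W ⟶ X)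
    (z₁ : Z ⟶ V) (z₂ : Z ⟶ Y) {A : p.Fiber W} {D : p.Fiber Z} (φ : tot A ⟶ tot D) :
    ∀ {a b : E}, (a ⟶ b) → Prop
  | mk {U UX UY : B} (g : U ⟶ V)
      (x₁ : UX ⟶ U) (x₂ : UX ⟶ X) (y₁ : UY ⟶ U) (y₂ : UY ⟶ Y)
      (hx : IsBinProd x₁ x₂) (hy : IsBinProd y₁ y₂)
      (gX : UX ⟶ W) (gY : UY ⟶ Z) (Us : UX ⟶ UY) (Ur : UY ⟶ UX)
      (hgX : IsProdMap x₁ x₂ w₁ w₂ g (𝟙 X) gX) (hgY : IsProdMap y₁ y₂ z₁ z₂ g (𝟙 Y) gY)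
      (hUs : IsProdMap x₁ x₂ y₁ y₂ (𝟙 U) s Us) (hUr : IsProdMap y₁ y₂ x₁ x₂ (𝟙 U) r Ur)
      {A' C P : p.Fiber UX} {D' C' Q : p.Fiber UY}
      (α : tot A' ⟶ tot A) (β : tot D' ⟶ tot D) (φ' : tot A' ⟶ tot D')
      (hα : p.IsStronglyCartesian gX α) (hβ : p.IsStronglyCartesian gY β)
      (hφ' : p.IsHomLift Us φ') (comm : α ≫ φ = φ' ≫ β)
      (σ : tot C ⟶ tot C') (ρ : tot C' ⟶ tot C)
      (hσ : p.IsStronglyCartesian Us σ) (hρ : p.IsStronglyCartesian Ur ρ) (split : σ ≫ ρ = 𝟙 (tot C))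
      (π₁ : P ⟶ C) (π₂ : P ⟶ A') (π₁' : Q ⟶ C') (π₂' : Q ⟶ D')
      (hP : IsBinProd π₁ π₂) (hQ : IsBinProd π₁' π₂')
      (ψ : tot P ⟶ tot Q) (hψ : p.IsHomLift Us ψ)
      (h₁ : ψ ≫ und π₁' = und π₁ ≫ σ) (h₂ : ψ ≫ und π₂' = und π₂ ≫ φ') :
      BCFR s r w₁ w₂ z₁ z₂ φ ψ

end Classes

section Elementary

variable [HasFiniteProducts B] [p.IsFibered] [HasFibredProducts p]

/-- The canonical arrow `L (f^* D ∧ A) ⟶ D ∧ L A` for `L` left adjoint to reindexing along `f`. -/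
noncomputable def frobenius {X Y : B} {f : X ⟶ Y} {L : p.Fiber X ⥤ p.Fiber Y}
    (adj : L ⊣ reindex p f) (D : p.Fiber Y) (A : p.Fiber X) :
    L.obj ((reindex p f).obj D ⨯ A) ⟶ D ⨯ L.obj A :=
  prod.lift (L.map prod.fst ≫ adj.counit.app D) (L.map prod.snd)

/-- The canonical arrow `L c^* A ⟶ b^* L' A` for a commutative square `a ≫ b = c ≫ d` in the base,
with `L` left adjoint to `a^*` and `L'` left adjoint to `d^*`. -/
noncomputable def beckChevalley {W X Y Z : B} {a : W ⟶ X} {b : X ⟶ Z} {c : W ⟶ Y} {d : Y ⟶ Z}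
    (w : a ≫ b = c ≫ d) {L : p.Fiber W ⥤ p.Fiber X} {L' : p.Fiber Y ⥤ p.Fiber Z}
    (adj : L ⊣ reindex p a) (adj' : L' ⊣ reindex p d) (A : p.Fiber Y) :
    L.obj ((reindex p c).obj A) ⟶ (reindex p b).obj (L'.obj A) :=
  (adj.homEquiv _ _).symm ((reindex p c).map (adj'.unit.app A) ≫ reindexSq p w (L'.obj A))

lemma pdia_square {Y Z : B} (f : Y ⟶ Z) (X : B) :
    pdia Y X ≫ prod.map (prod.map f (𝟙 X)) (𝟙 X) = prod.map f (𝟙 X) ≫ pdia Z X := by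
  ext <;> simp [pdia]

/-- Elementary fibrations: reindexing along the parametrised diagonals has left adjoints that
satisfy Frobenius reciprocity and the Beck–Chevalley condition. -/
def IsElementary : Prop :=
  ∃ (L : ∀ Y X : B, p.Fiber (Y ⨯ X) ⥤ p.Fiber ((Y ⨯ X) ⨯ X))
    (adj : ∀ Y X : B, L Y X ⊣ reindex p (pdia Y X)),
    (∀ (Y X : B) (A : p.Fiber (Y ⨯ X)) (D : p.Fiber ((Y ⨯ X) ⨯ X)),
      IsIso (frobenius p (adj Y X) D A)) ∧
    (∀ (Y Z X : B) (f : Y ⟶ Z) (A : p.Fiber (Z ⨯ X)),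
      IsIso (beckChevalley p (pdia_square f X) (adj Y X) (adj Z X) A))

end Elementary

section Transporters

variable [HasFiniteProducts B] [p.IsFibered] [HasFibredProducts p]

/-- A loop on `X`: an object `Eq_X` over `X × X` and an arrow `⊤_X ⟶ Eq_X` over the diagonal. -/
structure Loop (X : B) where
  obj : p.Fiber (X ⨯ X)
  arr : tot (⊤_ (p.Fiber X)) ⟶ tot obj
  arr_isHomLift : p.IsHomLift (dia X) arr

attribute [instance] Loop.arr_isHomLift

variable {p}

/-- The object `pr₁^* A ∧ Eq_X` over `X × X`. -/
noncomputable def Loop.act {X : B} (l : Loop p X) (A : p.Fiber X) : p.Fiber (X ⨯ X) :=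
  (reindex p prod.fst).obj A ⨯ l.obj

/-- The cartesian arrow `A ⟶ pr₁^* A` over the diagonal: the section of `pr₁^* A ⟶ A`. -/
noncomputable def diaLift {X : B} (A : p.Fiber X) :
    tot A ⟶ tot ((reindex p (prod.fst : X ⨯ X ⟶ X)).obj A) :=
  cartLift p (g := dia X) (h := 𝟙 X) (prod.lift_fst _ _).symm A (𝟙 (tot A))

instance diaLift_isHomLift {X : B} (A : p.Fiber X) : p.IsHomLift (dia X) (diaLift A) := by
  unfold diaLift; exact cartLift_isHomLift p _ _ _

/-- The arrow `A ⟶ ⊤_X ⟶ Eq_X`. -/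
noncomputable def Loop.reflAt {X : B} (l : Loop p X) (A : p.Fiber X) : tot A ⟶ tot l.obj :=
  und (terminal.from A) ≫ l.arr

instance Loop.reflAt_isHomLift {X : B} (l : Loop p X) (A : p.Fiber X) :
    p.IsHomLift (dia X) (l.reflAt A) := by
  have h : p.IsHomLift (𝟙 X ≫ dia X) (l.reflAt A) := by unfold Loop.reflAt; infer_instance
  rwa [Category.id_comp] at h

/-- The arrow `δ_A : A ⟶ pr₁^* A ∧ Eq_X` over the diagonal. -/
noncomputable def Loop.point {X : B} (l : Loop p X) (A : p.Fiber X) : tot A ⟶ tot (l.act A) :=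
  pair p (dia X) (diaLift A) (l.reflAt A)

/-- The class of arrows obtained from the loop `⊤_X ⟶ Eq_X` by parametrised reindexing along some
`U ⟶ 1` (where `X` is viewed as `1 × X` and `X × X` as `1 × (X × X)`) and split pairing with respect
to the retraction pair `pr₁ : X × X ⟶ X`, `⟨1,1⟩ : X ⟶ X × X`. -/
def Loop.BCFRClass {X : B} (l : Loop p X) : MorphismProperty E := fun _ _ ψ =>
  BCFR p (V := ⊤_ B) (dia X) prod.fst (terminal.from X) (𝟙 X) (terminal.from (X ⨯ X)) (𝟙 (X ⨯ X))
    l.arr ψ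

variable (p)

/-- A strict transporter on `X`: a loop with, for every `A` over `X`, a strict carrier
`pr₁^* A ∧ Eq_X ⟶ A` over `pr₂`. -/
structure StrictTransporter (X : B) extends Loop p X where
  carrier : ∀ A : p.Fiber X, tot (toLoop.act A) ⟶ tot A
  carrier_isHomLift : ∀ A : p.Fiber X, p.IsHomLift (prod.snd : X ⨯ X ⟶ X) (carrier A)
  strict : ∀ A : p.Fiber X, toLoop.point A ≫ carrier A = 𝟙 (tot A)

variable {p}

/-- The object `Eq_X ⊠ Eq_Y = ⟨1,3⟩^* Eq_X ∧ ⟨2,4⟩^* Eq_Y` over `(X × Y) × (X × Y)`. -/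
noncomputable def Loop.box {X Y : B} (l : Loop p X) (m : Loop p Y) :
    p.Fiber ((X ⨯ Y) ⨯ (X ⨯ Y)) :=
  (reindex p (pr13 X Y)).obj l.obj ⨯ (reindex p (pr24 X Y)).obj m.obj

/-- The arrow `⊤_{X × Y} ⟶ ⟨1,3⟩^* Eq_X` over the diagonal induced by `⊤_{X × Y} ⟶ ⊤_X ⟶ Eq_X`. -/
noncomputable def Loop.boxFst {X : B} (l : Loop p X) (Y : B) :
    tot (⊤_ (p.Fiber (X ⨯ Y))) ⟶ tot ((reindex p (pr13 X Y)).obj l.obj) :=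
  cartLift p (g := dia (X ⨯ Y)) (f := pr13 X Y) (h := prod.fst ≫ dia X)
    (by ext <;> simp [dia, pr13]) l.obj (toTop p prod.fst (⊤_ (p.Fiber (X ⨯ Y))) ≫ l.arr)

/-- The arrow `⊤_{X × Y} ⟶ ⟨2,4⟩^* Eq_Y` over the diagonal induced by `⊤_{X × Y} ⟶ ⊤_Y ⟶ Eq_Y`. -/
noncomputable def Loop.boxSnd (X : B) {Y : B} (m : Loop p Y) :
    tot (⊤_ (p.Fiber (X ⨯ Y))) ⟶ tot ((reindex p (pr24 X Y)).obj m.obj) :=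
  cartLift p (g := dia (X ⨯ Y)) (f := pr24 X Y) (h := prod.snd ≫ dia Y)
    (by ext <;> simp [dia, pr24]) m.obj (toTop p prod.snd (⊤_ (p.Fiber (X ⨯ Y))) ≫ m.arr)

instance Loop.boxFst_isHomLift {X : B} (l : Loop p X) (Y : B) :
    p.IsHomLift (dia (X ⨯ Y)) (l.boxFst Y) := by
  unfold Loop.boxFst; exact cartLift_isHomLift p _ _ _

instance Loop.boxSnd_isHomLift (X : B) {Y : B} (m : Loop p Y) :
    p.IsHomLift (dia (X ⨯ Y)) (Loop.boxSnd X m) := by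
  unfold Loop.boxSnd; exact cartLift_isHomLift p _ _ _

/-- The arrow `δ_X ⊠ δ_Y : ⊤_{X × Y} ⟶ Eq_X ⊠ Eq_Y` over the diagonal of `X × Y`. -/
noncomputable def Loop.boxArr {X Y : B} (l : Loop p X) (m : Loop p Y) :
    tot (⊤_ (p.Fiber (X ⨯ Y))) ⟶ tot (l.box m) :=
  pair p (dia (X ⨯ Y)) (l.boxFst Y) (Loop.boxSnd X m)

/-- A family of loops is strictly productive when there are vertical arrows
`Eq_X ⊠ Eq_Y ⟶ Eq_{X × Y}` compatible with the loops. -/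
def StrictlyProductive (l : ∀ X : B, Loop p X) : Prop :=
  ∀ X Y : B, ∃ χ : (l X).box (l Y) ⟶ (l (X ⨯ Y)).obj,
    (l X).boxArr (l Y) ≫ und χ = (l (X ⨯ Y)).arr

/-- The functor `A ↦ ⟨1,2⟩^* A ∧ ⟨2,3⟩^* Q` from the fibre over `Y × X` to the fibre over
`Y × X × X`, for `Q` over `X × X`. -/
noncomputable def eqFunctor (Y : B) {X : B} (Q : p.Fiber (X ⨯ X)) :
    p.Fiber (Y ⨯ X) ⥤ p.Fiber ((Y ⨯ X) ⨯ X) :=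
  reindex p (pr12 Y X) ⋙ prod.functor.flip.obj ((reindex p (pr23 Y X)).obj Q)

end Transporters

end ElemFib

open CategoryTheory CategoryTheory.Limits CategoryTheory.Functor

namespace ElemFib

universe v₁ v₂ u₁ u₂

attribute [local simp] prod.lift_fst prod.lift_fst_assoc prod.lift_snd prod.lift_snd_assoc

/-! ### Unchosen binary products in a category -/

section BinProd

variable {C : Type u₁} [Category.{v₁} C]

/-! Everything passes through one notion, `Loop.Univ`: for every product `W` of a parameter `U` with
`X` and every `A` over `W`, the arrow `⟨1, refl⟩ : A ⟶ A ∧ Eq_X` over the parametrised diagonal is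
cocartesian. Up to a vertical isomorphism of the domain, these arrows are exactly the BCFR arrows
(`Loop.bcfr_induction`, `Loop.bcfrClass_of`), because a reindexed `⊤_X` is terminal and drops out of
the product. So "BCFR arrows are cocartesian" means "the loops are universal", and every other
condition is compared with that. Below, objects over the base are often described by elements: an
element of `Eq_X` over `(x, x')` is a path from `x` to `x'`.

Left adjoints: in an elementary fibration `Eq_X` is the left adjoint applied to a terminal object.
Beck–Chevalley adds the parameter `U`, and Frobenius reciprocity adds `A`
(`IsElementary.exists_univ`). Conversely, a universal loop makes `A ↦ A ∧ Eq_X` the left adjoint;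
its Frobenius and Beck–Chevalley maps compare cocartesian arrows with the same source, by
pairability and product-stability (`isElementary_of_univ`).

Stability: a cocartesian arrow over a parametrised diagonal is isomorphic to some `⟨1, refl⟩`.
Product-stability holds because the universal property of `A ∧ Eq_X` is preserved by reindexing.
Pairability needs more: the universal property yields transport along paths with an inverse
(`Loop.Univ.exists_transport`), and transporting `C` back along the path identifies `D ∧ C` with `(A
∧ C') ∧ Eq_X`. Conversely, product-stability and pairability build all BCFR arrows from a
cocartesian `δ_X`.

Transporters: they supply the existence half of the cocartesian property
(`exists_desc_of_transporter`); fibred-epicness is the uniqueness half.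

Bare adjunctions: if `A ↦ A ∧ Q` is merely some left adjoint, its unit need not have the form `⟨1, r
!⟩`, and it may depend on the parameter object. The first defect is an automorphism of the identity
functor (`exists_univAt`). The second is harmless since points of `Q` over the diagonal act
invertibly, so that one point is as good as another (`UnivAt.of_point`). -/

lemma isBinProd_of {P A A' : C} {a : P ⟶ A} {b : P ⟶ A'}
    (ex : ∀ {T : C} (f : T ⟶ A) (g : T ⟶ A'), ∃ h : T ⟶ P, h ≫ a = f ∧ h ≫ b = g)
    (uniq : ∀ {T : C} (h h' : T ⟶ P), h ≫ a = h' ≫ a → h ≫ b = h' ≫ b → h = h') :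
    IsBinProd a b := by
  choose l hl using @ex
  exact ⟨BinaryFan.IsLimit.mk _ (fun f g => l f g) (fun f g => (hl f g).1) (fun f g => (hl f g).2)
    (fun f g m h₁ h₂ => uniq _ _ (h₁.trans (hl f g).1.symm) (h₂.trans (hl f g).2.symm))⟩

namespace IsBinProd

variable {P A A' : C} {b : P ⟶ A'} {a : P ⟶ A}

/-- The arrow into a binary product induced by its components. -/
noncomputable def lift (h : IsBinProd a b) {T : C} (f : T ⟶ A) (g : T ⟶ A') : T ⟶ P :=
  BinaryFan.IsLimit.lift' h.some f g |>.1

@[simp]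
lemma lift_fst (h : IsBinProd a b) {T : C} (f : T ⟶ A) (g : T ⟶ A') : h.lift f g ≫ a = f :=
  (BinaryFan.IsLimit.lift' h.some f g).2.1

@[simp]
lemma lift_fst_assoc (h : IsBinProd a b) {T S : C} (f : T ⟶ A) (g : T ⟶ A') (k : A ⟶ S) :
    h.lift f g ≫ a ≫ k = f ≫ k := by
  simp only [← Category.assoc, lift_fst]

@[simp]
lemma lift_snd (h : IsBinProd a b) {T : C} (f : T ⟶ A) (g : T ⟶ A') : h.lift f g ≫ b = g :=
  (BinaryFan.IsLimit.lift' h.some f g).2.2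

@[simp]
lemma lift_snd_assoc (h : IsBinProd a b) {T S : C} (f : T ⟶ A) (g : T ⟶ A') (k : A' ⟶ S) :
    h.lift f g ≫ b ≫ k = g ≫ k := by
  simp only [← Category.assoc, lift_snd]

lemma hom_ext (h : IsBinProd a b) {T : C} {f g : T ⟶ P} (h₁ : f ≫ a = g ≫ a)
    (h₂ : f ≫ b = g ≫ b) : f = g :=
  BinaryFan.IsLimit.hom_ext h.some h₁ h₂

lemma symm (h : IsBinProd a b) : IsBinProd b a :=
  isBinProd_of (fun f g => ⟨h.lift g f, by simp, by simp⟩) fun _ _ h₁ h₂ => h.hom_ext h₂ h₁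

lemma of_prod [HasFiniteProducts C] (A A' : C) :
    IsBinProd (prod.fst : A ⨯ A' ⟶ A) (prod.snd : A ⨯ A' ⟶ A') :=
  ⟨prodIsProd A A'⟩

lemma of_terminal [HasFiniteProducts C] (A : C) : IsBinProd (terminal.from A) (𝟙 A) :=
  isBinProd_of (fun f g => ⟨g, Subsingleton.elim _ _, by simp⟩) fun _ _ _ h => by simpa using h

/-- `U × (X × X)` as `(U × X) × X`. -/
lemma assoc_right [HasFiniteProducts C] {U X W Z : C} {w₁ : W ⟶ U} {w₂ : W ⟶ X} {z₁ : Z ⟶ U}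
    {z₂ : Z ⟶ X ⨯ X} (hw : IsBinProd w₁ w₂) (hz : IsBinProd z₁ z₂) {e : Z ⟶ W}
    (h₁ : e ≫ w₁ = z₁) (h₂ : e ≫ w₂ = z₂ ≫ prod.fst) : IsBinProd e (z₂ ≫ prod.snd) := by
  refine isBinProd_of
    (fun f g => ⟨hz.lift (f ≫ w₁) (prod.lift (f ≫ w₂) g), hw.hom_ext ?_ ?_, ?_⟩) ?_
  · simp [h₁]
  · simp [h₂]
  · simp
  · intro T h h' e₁ e₂
    refine hz.hom_ext ?_ (Limits.prod.hom_ext ?_ ?_)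
    · rw [← h₁, reassoc_of% e₁]
    · rw [Category.assoc, Category.assoc, ← h₂, reassoc_of% e₁]
    · simpa using e₂

/-- `(U × X) × X` as `U × (X × X)`. -/
lemma assoc_left [HasFiniteProducts C] {U X W Z : C} {w₁ : W ⟶ U} {w₂ : W ⟶ X} {e : Z ⟶ W}
    {z : Z ⟶ X} (hw : IsBinProd w₁ w₂) (hz : IsBinProd e z) :
    IsBinProd (e ≫ w₁) (prod.lift (e ≫ w₂) z) := by
  refine isBinProd_of (fun f g => ⟨hz.lift (hw.lift f (g ≫ prod.fst)) (g ≫ prod.snd), ?_, ?_⟩) ?_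
  · simp
  · ext <;> simp
  · intro T h h' e₁ e₂
    have e₃ := congrArg (· ≫ prod.fst) e₂
    have e₄ := congrArg (· ≫ prod.snd) e₂
    simp only [Category.assoc, prod.lift_fst, prod.lift_snd] at e₃ e₄ e₁
    exact hz.hom_ext (hw.hom_ext (by simpa using e₁) (by simpa using e₃)) e₄

end IsBinProd

end BinProd

/-! ### Arrows over a fixed base arrow; cartesian and cocartesian arrows -/

variable {B : Type u₁} [Category.{v₁} B] {E : Type u₂} [Category.{v₂} E] {p : E ⥤ B}

/-- The arrows of the total category from `A` to `D` over `f`. -/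
@[ext]
structure DHom {X Y : B} (f : X ⟶ Y) (A : p.Fiber X) (D : p.Fiber Y) where
  /-- The underlying arrow of the total category. -/
  hom : tot A ⟶ tot D
  lift : p.IsHomLift f hom

attribute [instance] DHom.lift

namespace DHom

variable {X Y Z : B} {f g : X ⟶ Y} {A : p.Fiber X} {D : p.Fiber Y} {G : p.Fiber Z}

/-- Composition of arrows over composable arrows of the base. -/
def comp {g : Y ⟶ Z} (φ : DHom f A D) (ψ : DHom g D G) : DHom (f ≫ g) A G :=
  ⟨φ.hom ≫ ψ.hom, inferInstance⟩

@[simp]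
lemma comp_hom {g : Y ⟶ Z} (φ : DHom f A D) (ψ : DHom g D G) :
    (φ.comp ψ).hom = φ.hom ≫ ψ.hom := rfl

/-- The identity, as an arrow over the identity. -/
def id (A : p.Fiber X) : DHom (𝟙 X) A A := ⟨𝟙 _, inferInstance⟩

@[simp]
lemma id_hom (A : p.Fiber X) : (DHom.id A).hom = 𝟙 (tot A) := rfl

/-- Change of the arrow of the base along an equality. -/
def cast (φ : DHom f A D) (h : f = g) : DHom g A D := ⟨φ.hom, h ▸ φ.lift⟩

@[simp]
lemma cast_hom (φ : DHom f A D) (h : f = g) : (φ.cast h).hom = φ.hom := rfl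

/-- An arrow of the fibre, as an arrow over the identity. -/
def ofFib {A A' : p.Fiber X} (φ : A ⟶ A') : DHom (𝟙 X) A A' := ⟨und φ, inferInstance⟩

@[simp]
lemma ofFib_hom {A A' : p.Fiber X} (φ : A ⟶ A') : (ofFib φ).hom = und φ := rfl

/-- An arrow over the identity, as an arrow of the fibre. -/
def toFib {A A' : p.Fiber X} (φ : DHom (𝟙 X) A A') : A ⟶ A' := vert p φ.hom

@[simp]
lemma und_toFib {A A' : p.Fiber X} (φ : DHom (𝟙 X) A A') : und φ.toFib = φ.hom := rfl

/-- Cartesian arrows. -/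
def IsCart (φ : DHom f A D) : Prop := p.IsStronglyCartesian f φ.hom

/-- Cocartesian arrows. -/
def IsCoc (φ : DHom f A D) : Prop := p.IsStronglyCocartesian f φ.hom

lemma IsCart.exists_lift {φ : DHom f A D} (H : φ.IsCart) {h : Z ⟶ Y} (ψ : DHom h G D)
    (g : Z ⟶ X) (e : h = g ≫ f) : ∃ χ : DHom g G A, χ.hom ≫ φ.hom = ψ.hom := by
  have : p.IsStronglyCartesian f φ.hom := H
  exact ⟨⟨IsStronglyCartesian.map p f φ.hom e ψ.hom, inferInstance⟩, by simp⟩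

/-- The factorisation of an arrow through a cartesian arrow. -/
noncomputable def IsCart.lift {φ : DHom f A D} (H : φ.IsCart) {h : Z ⟶ Y} (ψ : DHom h G D)
    (g : Z ⟶ X) (e : h = g ≫ f) : DHom g G A := (H.exists_lift ψ g e).choose

@[simp]
lemma IsCart.fac {φ : DHom f A D} (H : φ.IsCart) {h : Z ⟶ Y} (ψ : DHom h G D)
    (g : Z ⟶ X) (e : h = g ≫ f) : (H.lift ψ g e).hom ≫ φ.hom = ψ.hom :=
  (H.exists_lift ψ g e).choose_spec

@[simp]
lemma IsCart.fac_assoc {φ : DHom f A D} (H : φ.IsCart) {h : Z ⟶ Y} (ψ : DHom h G D)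
    (g : Z ⟶ X) (e : h = g ≫ f) {c : E} (k : tot D ⟶ c) :
    (H.lift ψ g e).hom ≫ φ.hom ≫ k = ψ.hom ≫ k := by
  simp only [← Category.assoc, H.fac]

lemma IsCart.ext {φ : DHom f A D} (H : φ.IsCart) {g g' : Z ⟶ X} (χ : DHom g G A)
    (χ' : DHom g' G A) (e : g = g') (h : χ.hom ≫ φ.hom = χ'.hom ≫ φ.hom) : χ.hom = χ'.hom := by
  subst e
  have : p.IsStronglyCartesian f φ.hom := H
  exact IsStronglyCartesian.ext p f φ.hom g h

lemma IsCoc.exists_desc {φ : DHom f A D} (H : φ.IsCoc) {h : X ⟶ Z} (ψ : DHom h A G)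
    (g : Y ⟶ Z) (e : h = f ≫ g) : ∃ χ : DHom g D G, φ.hom ≫ χ.hom = ψ.hom := by
  have : p.IsStronglyCocartesian f φ.hom := H
  exact ⟨⟨IsStronglyCocartesian.map p f φ.hom e ψ.hom, inferInstance⟩, by simp⟩

/-- The factorisation of an arrow through a cocartesian arrow. -/
noncomputable def IsCoc.desc {φ : DHom f A D} (H : φ.IsCoc) {h : X ⟶ Z} (ψ : DHom h A G)
    (g : Y ⟶ Z) (e : h = f ≫ g) : DHom g D G := (H.exists_desc ψ g e).choose

@[simp]
lemma IsCoc.fac {φ : DHom f A D} (H : φ.IsCoc) {h : X ⟶ Z} (ψ : DHom h A G)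
    (g : Y ⟶ Z) (e : h = f ≫ g) : φ.hom ≫ (H.desc ψ g e).hom = ψ.hom :=
  (H.exists_desc ψ g e).choose_spec

@[simp]
lemma IsCoc.fac_assoc {φ : DHom f A D} (H : φ.IsCoc) {h : X ⟶ Z} (ψ : DHom h A G)
    (g : Y ⟶ Z) (e : h = f ≫ g) {c : E} (k : tot G ⟶ c) :
    φ.hom ≫ (H.desc ψ g e).hom ≫ k = ψ.hom ≫ k := by
  simp only [← Category.assoc, H.fac]

lemma IsCoc.ext {φ : DHom f A D} (H : φ.IsCoc) {g g' : Y ⟶ Z} (χ : DHom g D G)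
    (χ' : DHom g' D G) (e : g = g') (h : φ.hom ≫ χ.hom = φ.hom ≫ χ'.hom) : χ.hom = χ'.hom := by
  subst e
  have : p.IsStronglyCocartesian f φ.hom := H
  exact IsStronglyCocartesian.ext p f φ.hom g h

lemma IsCoc.comp {g : Y ⟶ Z} {φ : DHom f A D} (H : φ.IsCoc) {ψ : DHom g D G} (H' : ψ.IsCoc) :
    (φ.comp ψ).IsCoc := by
  have : p.IsStronglyCocartesian f φ.hom := H
  have : p.IsStronglyCocartesian g ψ.hom := H'
  exact IsStronglyCocartesian.comp p

lemma IsCart.comp {g : Y ⟶ Z} {φ : DHom f A D} (H : φ.IsCart) {ψ : DHom g D G} (H' : ψ.IsCart) :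
    (φ.comp ψ).IsCart := by
  have : p.IsStronglyCartesian f φ.hom := H
  have : p.IsStronglyCartesian g ψ.hom := H'
  exact IsStronglyCartesian.comp p

lemma IsCoc.congr {φ : DHom f A D} (H : φ.IsCoc) {ψ : DHom g A D} (e : f = g)
    (h : φ.hom = ψ.hom) : ψ.IsCoc := by
  subst e
  unfold IsCoc at H ⊢
  rwa [← h]

lemma IsCart.congr {φ : DHom f A D} (H : φ.IsCart) {ψ : DHom g A D} (e : f = g)
    (h : φ.hom = ψ.hom) : ψ.IsCart := by
  subst e
  unfold IsCart at H ⊢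
  rwa [← h]

lemma IsCart.of_comp {g : Y ⟶ Z} {φ : DHom f A D} {ψ : DHom g D G} (H : ψ.IsCart)
    (H' : (φ.comp ψ).IsCart) : φ.IsCart := by
  have : p.IsStronglyCartesian g ψ.hom := H
  have : p.IsStronglyCartesian (f ≫ g) (φ.hom ≫ ψ.hom) := H'
  exact IsStronglyCartesian.of_comp p (g := g) (ψ := ψ.hom)

lemma isCoc_of_inv {f' : Y ⟶ X} (φ : DHom f A D) (φ' : DHom f' D A)
    (h₁ : φ.hom ≫ φ'.hom = 𝟙 _) (h₂ : φ'.hom ≫ φ.hom = 𝟙 _) : φ.IsCoc := by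
  have : IsIso φ.hom := ⟨φ'.hom, h₁, h₂⟩
  exact IsStronglyCocartesian.of_isIso p f φ.hom

lemma isCart_of_inv {f' : Y ⟶ X} (φ : DHom f A D) (φ' : DHom f' D A)
    (h₁ : φ.hom ≫ φ'.hom = 𝟙 _) (h₂ : φ'.hom ≫ φ.hom = 𝟙 _) : φ.IsCart := by
  have : IsIso φ.hom := ⟨φ'.hom, h₁, h₂⟩
  exact IsStronglyCartesian.of_isIso p f φ.hom

lemma isCart_of_isIso (φ : DHom f A D) [IsIso φ.hom] : φ.IsCart :=
  IsStronglyCartesian.of_isIso p f φ.hom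

lemma isCoc_of_isIso (φ : DHom f A D) [IsIso φ.hom] : φ.IsCoc :=
  IsStronglyCocartesian.of_isIso p f φ.hom

/-- A section of a cartesian arrow is cartesian. -/
lemma IsCart.of_section {s : Y ⟶ X} {ρ : DHom f A D} (H : ρ.IsCart) {σ : DHom s D A}
    (e : s ≫ f = 𝟙 Y) (h : σ.hom ≫ ρ.hom = 𝟙 _) : σ.IsCart :=
  IsCart.of_comp H ((isCart_of_inv (DHom.id D) (DHom.id D) (by simp) (by simp)).congr e.symm
    (by simp [h]))

section

variable [p.IsFibered]

/-- The chosen cartesian lift. -/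
noncomputable def cart (f : X ⟶ Y) (D : p.Fiber Y) : DHom f ((reindex p f).obj D) D :=
  ⟨ElemFib.cart p f D, inferInstance⟩

lemma cart_isCart (f : X ⟶ Y) (D : p.Fiber Y) : (cart f D).IsCart :=
  cart_isStronglyCartesian p f D

/-- In a fibration, an arrow over `f ≫ g` is the same as an arrow over `f` into the domain of the
cartesian lift of `g`. Factorisations over an arbitrary `g` thus reduce to vertical ones. -/
lemma isCoc_of_vertical (φ : DHom f A D)
    (ex : ∀ (G : p.Fiber Y) (ψ : DHom f A G), ∃ χ : DHom (𝟙 Y) D G, φ.hom ≫ χ.hom = ψ.hom)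
    (uniq : ∀ (G : p.Fiber Y) (χ χ' : DHom (𝟙 Y) D G), φ.hom ≫ χ.hom = φ.hom ≫ χ'.hom →
      χ.hom = χ'.hom) : φ.IsCoc where
  universal_property' {b'} g ψ hψ := by
    let G : p.Fiber (p.obj b') := Fiber.mk rfl
    obtain ⟨χ, hχ⟩ := ex _ ((cart_isCart g G).lift (⟨ψ, hψ⟩ : DHom (f ≫ g) A G) f rfl)
    refine ⟨(χ.comp (cart g G)).hom, ⟨?_, ?_⟩, ?_⟩
    · exact ((χ.comp (cart g G)).cast (by simp) : DHom g D G).lift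
    · have h := congrArg (· ≫ (cart g G).hom) hχ
      simp only [Category.assoc, (cart_isCart g G).fac] at h
      exact h
    · rintro τ ⟨hτ, hτ'⟩
      let τ' := (cart_isCart g G).lift (⟨τ, hτ⟩ : DHom g D G) (𝟙 Y) (by simp)
      have hf : τ'.hom ≫ (cart g G).hom = τ := (cart_isCart g G).fac _ _ _
      have : τ'.hom = χ.hom := by
        refine uniq _ _ _ ?_
        refine (cart_isCart g G).ext ((φ.comp τ').cast (by simp) : DHom f A _)
          ((φ.comp χ).cast (by simp)) rfl ?_
        simp only [cast_hom, comp_hom, Category.assoc, hf]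
        have h := congrArg (· ≫ (cart g G).hom) hχ
        simp only [Category.assoc, (cart_isCart g G).fac] at h
        exact hτ'.trans h.symm
      rw [comp_hom, ← this, hf]

end

end DHom

/-! ### Jointly cartesian pairs -/

/-- The pair `k₁ : K ⟶ A` over `f`, `k₂ : K ⟶ D` over `g` is jointly cartesian: it exhibits `K` as
`f^* A ∧ g^* D`, with the universal property relative to all arrows of the base. -/
structure IsJC {Γ X Y : B} {f : Γ ⟶ X} {g : Γ ⟶ Y} {K : p.Fiber Γ} {A : p.Fiber X} {D : p.Fiber Y}
    (k₁ : DHom f K A) (k₂ : DHom g K D) : Prop where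
  exists_lift : ∀ {W : B} {C : p.Fiber W} (h : W ⟶ Γ) (φ₁ : DHom (h ≫ f) C A)
    (φ₂ : DHom (h ≫ g) C D), ∃ φ : DHom h C K, φ.hom ≫ k₁.hom = φ₁.hom ∧ φ.hom ≫ k₂.hom = φ₂.hom
  uniq : ∀ {W : B} {C : p.Fiber W} (h : W ⟶ Γ) (φ φ' : DHom h C K),
    φ.hom ≫ k₁.hom = φ'.hom ≫ k₁.hom → φ.hom ≫ k₂.hom = φ'.hom ≫ k₂.hom → φ.hom = φ'.hom

namespace IsJC

variable {Γ X Y W : B} {f : Γ ⟶ X} {g : Γ ⟶ Y} {K : p.Fiber Γ} {A : p.Fiber X} {D : p.Fiber Y}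
  {k₁ : DHom f K A} {k₂ : DHom g K D} {C : p.Fiber W}

/-- The arrow into a jointly cartesian pair induced by its components. -/
noncomputable def lift (H : IsJC k₁ k₂) (h : W ⟶ Γ) {f₁ : W ⟶ X} {f₂ : W ⟶ Y} (φ₁ : DHom f₁ C A)
    (φ₂ : DHom f₂ C D) (e₁ : f₁ = h ≫ f) (e₂ : f₂ = h ≫ g) : DHom h C K :=
  (H.exists_lift h (φ₁.cast e₁) (φ₂.cast e₂)).choose

@[simp]
lemma lift_fst (H : IsJC k₁ k₂) (h : W ⟶ Γ) {f₁ : W ⟶ X} {f₂ : W ⟶ Y} (φ₁ : DHom f₁ C A)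
    (φ₂ : DHom f₂ C D) (e₁ : f₁ = h ≫ f) (e₂ : f₂ = h ≫ g) :
    (H.lift h φ₁ φ₂ e₁ e₂).hom ≫ k₁.hom = φ₁.hom :=
  (H.exists_lift h (φ₁.cast e₁) (φ₂.cast e₂)).choose_spec.1

@[simp]
lemma lift_fst_assoc (H : IsJC k₁ k₂) (h : W ⟶ Γ) {f₁ : W ⟶ X} {f₂ : W ⟶ Y} (φ₁ : DHom f₁ C A)
    (φ₂ : DHom f₂ C D) (e₁ : f₁ = h ≫ f) (e₂ : f₂ = h ≫ g) {c : E} (k : tot A ⟶ c) :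
    (H.lift h φ₁ φ₂ e₁ e₂).hom ≫ k₁.hom ≫ k = φ₁.hom ≫ k := by
  simp only [← Category.assoc, lift_fst]

@[simp]
lemma lift_snd (H : IsJC k₁ k₂) (h : W ⟶ Γ) {f₁ : W ⟶ X} {f₂ : W ⟶ Y} (φ₁ : DHom f₁ C A)
    (φ₂ : DHom f₂ C D) (e₁ : f₁ = h ≫ f) (e₂ : f₂ = h ≫ g) :
    (H.lift h φ₁ φ₂ e₁ e₂).hom ≫ k₂.hom = φ₂.hom :=
  (H.exists_lift h (φ₁.cast e₁) (φ₂.cast e₂)).choose_spec.2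

@[simp]
lemma lift_snd_assoc (H : IsJC k₁ k₂) (h : W ⟶ Γ) {f₁ : W ⟶ X} {f₂ : W ⟶ Y} (φ₁ : DHom f₁ C A)
    (φ₂ : DHom f₂ C D) (e₁ : f₁ = h ≫ f) (e₂ : f₂ = h ≫ g) {c : E} (k : tot D ⟶ c) :
    (H.lift h φ₁ φ₂ e₁ e₂).hom ≫ k₂.hom ≫ k = φ₂.hom ≫ k := by
  simp only [← Category.assoc, lift_snd]

lemma ext (H : IsJC k₁ k₂) {h h' : W ⟶ Γ} (φ : DHom h C K) (φ' : DHom h' C K) (e : h = h')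
    (h₁ : φ.hom ≫ k₁.hom = φ'.hom ≫ k₁.hom) (h₂ : φ.hom ≫ k₂.hom = φ'.hom ≫ k₂.hom) :
    φ.hom = φ'.hom := by
  subst e
  exact H.uniq h _ _ h₁ h₂

/-- Jointly cartesian pairs may be composed with cartesian arrows. -/
lemma comp_cart (H : IsJC k₁ k₂) {X' Y' : B} {f' : X ⟶ X'} {g' : Y ⟶ Y'} {A' : p.Fiber X'}
    {D' : p.Fiber Y'} {ρ : DHom f' A A'} {β : DHom g' D D'} (hρ : ρ.IsCart) (hβ : β.IsCart)
    {l : Γ ⟶ X'} {m : Γ ⟶ Y'} {k₁' : DHom l K A'} {k₂' : DHom m K D'} (el : l = f ≫ f')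
    (em : m = g ≫ g') (h₁ : k₁'.hom = k₁.hom ≫ ρ.hom) (h₂ : k₂'.hom = k₂.hom ≫ β.hom) :
    IsJC k₁' k₂' where
  exists_lift h φ₁ φ₂ :=
    ⟨H.lift h (hρ.lift φ₁ (h ≫ f) (by simp [el])) (hβ.lift φ₂ (h ≫ g) (by simp [em])) rfl rfl,
      by simp [h₁], by simp [h₂]⟩
  uniq h φ φ' e₁ e₂ := by
    refine H.ext φ φ' rfl ?_ ?_
    · exact hρ.ext (φ.comp k₁) (φ'.comp k₁) rfl (by simpa [h₁] using e₁)
    · exact hβ.ext (φ.comp k₂) (φ'.comp k₂) rfl (by simpa [h₂] using e₂)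

/-- Jointly cartesian pairs are stable under reindexing. -/
lemma pullback (H : IsJC k₁ k₂) {Γ' X' : B} {u : Γ' ⟶ Γ} {v : X' ⟶ X} {K' : p.Fiber Γ'}
    {A' : p.Fiber X'} {β : DHom u K' K} {α : DHom v A' A} (hβ : β.IsCart) (hα : α.IsCart)
    {f' : Γ' ⟶ X'} {g' : Γ' ⟶ Y} {k₁' : DHom f' K' A'} {k₂' : DHom g' K' D}
    (ef : f' ≫ v = u ≫ f) (eg : g' = u ≫ g) (h₁ : k₁'.hom ≫ α.hom = β.hom ≫ k₁.hom)
    (h₂ : k₂'.hom = β.hom ≫ k₂.hom) : IsJC k₁' k₂' where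
  exists_lift h φ₁ φ₂ := by
    let φ := H.lift (h ≫ u) (φ₁.comp α) φ₂ (by simp [ef]) (by simp [eg])
    let φ' := hβ.lift φ h rfl
    refine ⟨φ', ?_, ?_⟩
    · refine hα.ext (φ'.comp k₁') φ₁ rfl ?_
      simp [h₁, φ', φ]
    · simp [h₂, φ', φ]
  uniq h φ φ' e₁ e₂ := by
    refine hβ.ext φ φ' rfl (H.ext (φ.comp β) (φ'.comp β) rfl ?_ ?_)
    · have := congrArg (· ≫ α.hom) e₁
      simpa [h₁] using this
    · simpa [h₂] using e₂

/-- The vertical components of a jointly cartesian pair form a product in the fibre. -/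
lemma isBinProd (H : IsJC k₁ k₂) {A' D' : p.Fiber Γ} {ρ : DHom f A' A} {β : DHom g D' D}
    (hρ : ρ.IsCart) (hβ : β.IsCart) {π₁ : K ⟶ A'} {π₂ : K ⟶ D'}
    (h₁ : und π₁ ≫ ρ.hom = k₁.hom) (h₂ : und π₂ ≫ β.hom = k₂.hom) : IsBinProd π₁ π₂ := by
  refine isBinProd_of (fun a b => ?_) (fun φ φ' e₁ e₂ => ?_)
  · let φ := H.lift (𝟙 Γ) ((DHom.ofFib a).comp ρ) ((DHom.ofFib b).comp β) rfl rfl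
    refine ⟨φ.toFib, ?_, ?_⟩ <;> apply und_ext
    · refine hρ.ext (DHom.ofFib (φ.toFib ≫ π₁)) (DHom.ofFib a) rfl ?_
      simp [h₁, φ]
    · refine hβ.ext (DHom.ofFib (φ.toFib ≫ π₂)) (DHom.ofFib b) rfl ?_
      simp [h₂, φ]
  · apply und_ext
    refine H.ext (DHom.ofFib φ) (DHom.ofFib φ') rfl ?_ ?_
    · have := congrArg (fun x => und x ≫ ρ.hom) e₁
      simpa [h₁] using this
    · have := congrArg (fun x => und x ≫ β.hom) e₂
      simpa [h₂] using this

end IsJC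

/-! ### Fibred products and terminal objects -/

section Fibred

variable [p.IsFibered] [HasFibredProducts p]

/-- The arrow to the terminal object of a fibre. -/
noncomputable def toTopD {X Y : B} (f : X ⟶ Y) (A : p.Fiber X) : DHom f A (⊤_ (p.Fiber Y)) :=
  ⟨toTop p f A, inferInstance⟩

lemma top_ext {X Y : B} {f g : X ⟶ Y} {A : p.Fiber X} (φ : DHom f A (⊤_ (p.Fiber Y)))
    (ψ : DHom g A (⊤_ (p.Fiber Y))) (e : f = g) : φ.hom = ψ.hom := by
  subst e
  have h : ∀ φ : DHom f A (⊤_ (p.Fiber Y)), φ.hom = und ((DHom.cart_isCart f _).lift φ (𝟙 X)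
      (by simp)).toFib ≫ (DHom.cart f _).hom := fun φ => by simp
  rw [h φ, h ψ]
  congr 2
  exact (terminalIsTerminal.isTerminalObj (reindex p f) _).hom_ext _ _

/-- Reindexing preserves terminal objects, so such an arrow is a chosen cartesian lift preceded by
an isomorphism. -/
lemma top_isCart {X Y : B} {f : X ⟶ Y} (φ : DHom f (⊤_ (p.Fiber X)) (⊤_ (p.Fiber Y))) :
    φ.IsCart := by
  refine DHom.IsCart.congr (φ := ((DHom.ofFib (PreservesTerminal.iso (reindex p f)).inv).comp
    (DHom.cart f (⊤_ (p.Fiber Y))))) (DHom.IsCart.comp ?_ (DHom.cart_isCart _ _)) (by simp)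
    (top_ext _ _ (by simp))
  have : IsIso (DHom.ofFib (PreservesTerminal.iso (reindex p f)).inv).hom :=
    inferInstanceAs (IsIso (Fiber.fiberInclusion.map _))
  exact DHom.isCart_of_isIso _

/-- Products in the fibres have the universal property relative to all arrows of the base. -/
lemma isJC_of_isBinProd {Γ : B} {P A D : p.Fiber Γ} {π₁ : P ⟶ A} {π₂ : P ⟶ D}
    (H : IsBinProd π₁ π₂) : IsJC (DHom.ofFib π₁) (DHom.ofFib π₂) := by
  have key : ∀ {W : B} (h : W ⟶ Γ), IsBinProd ((reindex p h).map π₁) ((reindex p h).map π₂) :=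
    fun h => ⟨mapIsLimitOfPreservesOfIsLimit (reindex p h) _ _ H.some⟩
  have nat : ∀ {W : B} (h : W ⟶ Γ) {A A' : p.Fiber Γ} (φ : A ⟶ A'),
      und ((reindex p h).map φ) ≫ (DHom.cart h A').hom = (DHom.cart h A).hom ≫ und φ :=
    fun h _ _ φ => (cart_und p h φ).symm
  constructor
  · intro W C h φ₁ φ₂
    let a := ((DHom.cart_isCart h A).lift φ₁ (𝟙 W) (by simp)).toFib
    let b := ((DHom.cart_isCart h D).lift φ₂ (𝟙 W) (by simp)).toFib
    have h₁ : und a ≫ (DHom.cart h A).hom = φ₁.hom := by simp [a]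
    have h₂ : und b ≫ (DHom.cart h D).hom = φ₂.hom := by simp [b]
    refine ⟨((DHom.ofFib ((key h).lift a b)).comp (DHom.cart h P)).cast (by simp), ?_, ?_⟩
    · simp only [DHom.cast_hom, DHom.comp_hom, DHom.ofFib_hom, Category.assoc]
      rw [← nat, ← Functor.map_comp_assoc, IsBinProd.lift_fst, h₁]
    · simp only [DHom.cast_hom, DHom.comp_hom, DHom.ofFib_hom, Category.assoc]
      rw [← nat, ← Functor.map_comp_assoc, IsBinProd.lift_snd, h₂]
  · intro W C h φ φ' e₁ e₂
    let c := ((DHom.cart_isCart h P).lift φ (𝟙 W) (by simp)).toFib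
    let c' := ((DHom.cart_isCart h P).lift φ' (𝟙 W) (by simp)).toFib
    have h₁ : und c ≫ (DHom.cart h P).hom = φ.hom := by simp [c]
    have h₂ : und c' ≫ (DHom.cart h P).hom = φ'.hom := by simp [c']
    have : c = c' := by
      apply (key h).hom_ext <;> apply und_ext
      · refine (DHom.cart_isCart h A).ext (DHom.ofFib (c ≫ (reindex p h).map π₁))
          (DHom.ofFib (c' ≫ (reindex p h).map π₁)) rfl ?_
        simp only [DHom.ofFib_hom, Functor.map_comp, Category.assoc, nat]
        rw [reassoc_of% h₁, reassoc_of% h₂]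
        exact e₁
      · refine (DHom.cart_isCart h D).ext (DHom.ofFib (c ≫ (reindex p h).map π₂))
          (DHom.ofFib (c' ≫ (reindex p h).map π₂)) rfl ?_
        simp only [DHom.ofFib_hom, Functor.map_comp, Category.assoc, nat]
        rw [reassoc_of% h₁, reassoc_of% h₂]
        exact e₂
    rw [← h₁, ← h₂, this]

/-- The object `f^* A ∧ g^* D`. -/
noncomputable def jcObj {Γ X Y : B} (f : Γ ⟶ X) (g : Γ ⟶ Y) (A : p.Fiber X) (D : p.Fiber Y) :
    p.Fiber Γ :=
  (reindex p f).obj A ⨯ (reindex p g).obj D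

/-- The arrow `f^* A ∧ g^* D ⟶ A` over `f`. -/
noncomputable def jcFst {Γ X Y : B} (f : Γ ⟶ X) (g : Γ ⟶ Y) (A : p.Fiber X) (D : p.Fiber Y) :
    DHom f (jcObj f g A D) A :=
  ((DHom.ofFib prod.fst).comp (DHom.cart f A)).cast (by simp)

/-- The arrow `f^* A ∧ g^* D ⟶ D` over `g`. -/
noncomputable def jcSnd {Γ X Y : B} (f : Γ ⟶ X) (g : Γ ⟶ Y) (A : p.Fiber X) (D : p.Fiber Y) :
    DHom g (jcObj f g A D) D :=
  ((DHom.ofFib prod.snd).comp (DHom.cart g D)).cast (by simp)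

lemma isJC_jc {Γ X Y : B} (f : Γ ⟶ X) (g : Γ ⟶ Y) (A : p.Fiber X) (D : p.Fiber Y) :
    IsJC (jcFst f g A D) (jcSnd f g A D) :=
  (isJC_of_isBinProd (IsBinProd.of_prod _ _)).comp_cart (DHom.cart_isCart f A)
    (DHom.cart_isCart g D) (by simp) (by simp) rfl rfl

/-- If the first component is a terminal object, the second arrow of a jointly cartesian pair is
cartesian. -/
lemma IsJC.isCart_snd {Γ X Y : B} {f : Γ ⟶ X} {g : Γ ⟶ Y} {K : p.Fiber Γ} {D : p.Fiber Y}
    {k₁ : DHom f K (⊤_ (p.Fiber X))} {k₂ : DHom g K D} (H : IsJC k₁ k₂) : k₂.IsCart where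
  universal_property' {a'} h φ hφ := by
    let C : p.Fiber (p.obj a') := Fiber.mk rfl
    let φ' := H.lift h (toTopD (h ≫ f) C) (⟨φ, hφ⟩ : DHom (h ≫ g) C D) rfl rfl
    refine ⟨φ'.hom, ⟨φ'.lift, ?_⟩, ?_⟩
    · exact H.lift_snd _ _ _ _ _
    · rintro τ ⟨hτ, hτ'⟩
      refine H.ext (⟨τ, hτ⟩ : DHom h C K) φ' rfl
        (top_ext ((⟨τ, hτ⟩ : DHom h C K).comp k₁) (φ'.comp k₁) rfl) ?_
      exact hτ'.trans (H.lift_snd h _ (⟨φ, hφ⟩ : DHom (h ≫ g) C D) rfl rfl).symm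

end Fibred

/-! ### Universal points over the diagonal -/

section Universal

variable [p.IsFibered] [HasFibredProducts p] [HasFiniteProducts B]

/-- Let `r : ⊤ ⟶ Q` be an arrow over `W ⟶ X ⟶ X × X`. For every `A` over `W`, the arrow
`⟨1, r !⟩ : A ⟶ A ∧ Q` over the graph of `w : W ⟶ X` is cocartesian. -/
def UnivAt {W X : B} (w : W ⟶ X) {Q : p.Fiber (X ⨯ X)} (r : DHom (w ≫ dia X) (⊤_ (p.Fiber W)) Q) :
    Prop :=
  ∀ ⦃Z : B⦄ ⦃e : Z ⟶ W⦄ ⦃z : Z ⟶ X⦄, IsBinProd e z → ∀ ⦃d : W ⟶ Z⦄, d ≫ e = 𝟙 W → d ≫ z = w →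
    ∀ ⦃A : p.Fiber W⦄ ⦃K : p.Fiber Z⦄ ⦃k₁ : DHom e K A⦄ ⦃k₂ : DHom (prod.lift (e ≫ w) z) K Q⦄,
    IsJC k₁ k₂ → ∀ j : DHom d A K, j.hom ≫ k₁.hom = 𝟙 _ →
    j.hom ≫ k₂.hom = (toTopD (𝟙 W) A).hom ≫ r.hom → j.IsCoc

variable {W X : B} (w : W ⟶ X) (Q : p.Fiber (X ⨯ X))

/-- The object `A ∧ Q` over `W × X`. -/
noncomputable def act (A : p.Fiber W) : p.Fiber (W ⨯ X) :=
  jcObj (prod.fst : W ⨯ X ⟶ W) (prod.lift (prod.fst ≫ w) prod.snd) A Q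

/-- The arrow `A ∧ Q ⟶ A`. -/
noncomputable def actFst (A : p.Fiber W) : DHom (prod.fst : W ⨯ X ⟶ W) (act w Q A) A :=
  jcFst _ _ A Q

/-- The arrow `A ∧ Q ⟶ Q`. -/
noncomputable def actSnd (A : p.Fiber W) :
    DHom (prod.lift (prod.fst ≫ w) prod.snd) (act w Q A) Q :=
  jcSnd _ _ A Q

lemma isJC_act (A : p.Fiber W) : IsJC (actFst w Q A) (actSnd w Q A) := isJC_jc _ _ A Q

/-- The graph of an arrow. -/
noncomputable def graph : W ⟶ W ⨯ X := prod.lift (𝟙 W) w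

@[simp]
lemma graph_fst : graph w ≫ prod.fst = 𝟙 W := prod.lift_fst _ _

@[simp]
lemma graph_fst_assoc {V : B} (k : W ⟶ V) :
    graph w ≫ prod.fst ≫ k = k := by
  simp only [← Category.assoc, graph_fst, Category.id_comp]

@[simp]
lemma graph_snd : graph w ≫ prod.snd = w := prod.lift_snd _ _

variable {w Q}

/-- The arrow `⟨1, r !⟩ : A ⟶ A ∧ Q`. -/
noncomputable def actPt (r : DHom (w ≫ dia X) (⊤_ (p.Fiber W)) Q) (A : p.Fiber W) :
    DHom (graph w) A (act w Q A) :=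
  (isJC_act w Q A).lift (graph w) (DHom.id A) ((toTopD (𝟙 W) A).comp r) (by simp)
    (by ext <;> simp [dia])

@[simp]
lemma actPt_fst (r : DHom (w ≫ dia X) (⊤_ (p.Fiber W)) Q) (A : p.Fiber W) :
    (actPt r A).hom ≫ (actFst w Q A).hom = 𝟙 _ :=
  (isJC_act w Q A).lift_fst _ _ _ _ _

@[simp]
lemma actPt_fst_assoc (r : DHom (w ≫ dia X) (⊤_ (p.Fiber W)) Q) (A : p.Fiber W) {c : E}
    (k : tot A ⟶ c) :
    (actPt r A).hom ≫ (actFst w Q A).hom ≫ k = k := by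
  simp only [← Category.assoc, actPt_fst, Category.id_comp]

@[simp]
lemma actPt_snd (r : DHom (w ≫ dia X) (⊤_ (p.Fiber W)) Q) (A : p.Fiber W) :
    (actPt r A).hom ≫ (actSnd w Q A).hom = (toTopD (𝟙 W) A).hom ≫ r.hom :=
  (isJC_act w Q A).lift_snd _ _ _ _ _

@[simp]
lemma actPt_snd_assoc (r : DHom (w ≫ dia X) (⊤_ (p.Fiber W)) Q) (A : p.Fiber W) {c : E}
    (k : tot Q ⟶ c) :
    (actPt r A).hom ≫ (actSnd w Q A).hom ≫ k = (toTopD (𝟙 W) A).hom ≫ r.hom ≫ k := by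
  simp only [← Category.assoc, actPt_snd]

lemma UnivAt.isCoc_actPt {r : DHom (w ≫ dia X) (⊤_ (p.Fiber W)) Q} (H : UnivAt w r)
    (A : p.Fiber W) : (actPt r A).IsCoc :=
  H (IsBinProd.of_prod W X) (by simp) (by simp) (isJC_act w Q A) _ (by simp) (by simp)

/-- It suffices to consider one product `Z` of `W` and `X` and one object `A ∧ Q` for each `A`. -/
lemma univAt_of {r : DHom (w ≫ dia X) (⊤_ (p.Fiber W)) Q} {Z : B} {e : Z ⟶ W} {z : Z ⟶ X}
    (hZ : IsBinProd e z) {d : W ⟶ Z} (hd₁ : d ≫ e = 𝟙 W) (hd₂ : d ≫ z = w)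
    (H : ∀ A : p.Fiber W, ∃ (K : p.Fiber Z) (k₁ : DHom e K A)
      (k₂ : DHom (prod.lift (e ≫ w) z) K Q) (j : DHom d A K), IsJC k₁ k₂ ∧ j.hom ≫ k₁.hom = 𝟙 _ ∧
      j.hom ≫ k₂.hom = (toTopD (𝟙 W) A).hom ≫ r.hom ∧ j.IsCoc) : UnivAt w r := by
  intro Z' e' z' hZ' d' hd₁' hd₂' A K' k₁' k₂' hK' j' hj₁' hj₂'
  obtain ⟨K, k₁, k₂, j, hK, hj₁, hj₂, hj⟩ := H A
  let ζ := hZ.lift e' z'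
  let ζ' := hZ'.lift e z
  let κ : DHom ζ K' K := hK.lift ζ k₁' k₂' (by simp [ζ]) (by ext <;> simp [ζ])
  let κ' : DHom ζ' K K' := hK'.lift ζ' k₁ k₂ (by simp [ζ']) (by ext <;> simp [ζ'])
  have hκ : κ.hom ≫ κ'.hom = 𝟙 _ := by
    refine hK'.ext (κ.comp κ') (DHom.id K') (hZ'.hom_ext ?_ ?_) ?_ ?_ <;> simp [κ, κ', ζ, ζ']
  have hκ' : κ'.hom ≫ κ.hom = 𝟙 _ := by
    refine hK.ext (κ'.comp κ) (DHom.id K) (hZ.hom_ext ?_ ?_) ?_ ?_ <;> simp [κ, κ', ζ, ζ']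
  have e₀ : d ≫ ζ' = d' := hZ'.hom_ext (by simp [ζ', *]) (by simp [ζ', *])
  refine (hj.comp (DHom.isCoc_of_inv κ' κ hκ' hκ)).congr e₀ ?_
  refine hK'.ext (j.comp κ') j' e₀ ?_ ?_
  · simp [κ', hj₁, hj₁']
  · simp [κ', hj₂, hj₂']

lemma univAt_of_actPt {r : DHom (w ≫ dia X) (⊤_ (p.Fiber W)) Q} (H : ∀ A, (actPt r A).IsCoc) :
    UnivAt w r :=
  univAt_of (IsBinProd.of_prod W X) (graph_fst w) (graph_snd w) fun A =>
    ⟨_, _, _, _, isJC_act w Q A, actPt_fst r A, actPt_snd r A, H A⟩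

/-- The universal property is stable under isomorphisms in the base. -/
lemma UnivAt.of_iso {r : DHom (w ≫ dia X) (⊤_ (p.Fiber W)) Q} (H : UnivAt w r) {W' : B}
    {ω : W' ⟶ W} {ω' : W ⟶ W'} (h₁ : ω ≫ ω' = 𝟙 _) (h₂ : ω' ≫ ω = 𝟙 _) {w' : W' ⟶ X}
    (hw' : w' = ω ≫ w) {r' : DHom (w' ≫ dia X) (⊤_ (p.Fiber W')) Q}
    (hr : r'.hom = (toTopD ω _).hom ≫ r.hom) : UnivAt w' r' := by
  subst hw'
  intro Z e z hZ d hd₁ hd₂ A K k₁ k₂ hK j hj₁ hj₂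
  let A₀ := (reindex p ω').obj A
  let a : DHom ω' A₀ A := DHom.cart ω' A
  have ha : a.IsCart := DHom.cart_isCart ω' A
  let a' : DHom ω A A₀ := ha.lift (DHom.id A) ω h₁.symm
  have e₁ : a'.hom ≫ a.hom = 𝟙 _ := by simp [a']
  have e₂ : a.hom ≫ a'.hom = 𝟙 _ :=
    ha.ext (a.comp a') (DHom.id A₀) h₂ (by simp [e₁])
  have hZ' : IsBinProd (e ≫ ω) z := by
    refine isBinProd_of (fun f g => ⟨hZ.lift (f ≫ ω') g, by simp [h₂], by simp⟩) ?_
    intro T f g ef eg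
    refine hZ.hom_ext ?_ eg
    simpa [h₁] using congrArg (· ≫ ω') ef
  have hb : prod.lift (e ≫ ω ≫ w) z = prod.lift ((e ≫ ω) ≫ w) z := by simp
  have hJ : IsJC (k₁.comp a') (k₂.cast hb) :=
    hK.comp_cart (DHom.isCart_of_inv a' a e₁ e₂)
      (DHom.isCart_of_inv (DHom.id Q) (DHom.id Q) (by simp) (by simp)) rfl (by simp) rfl (by simp)
  -- Up to the isomorphism `a`, the arrow `j` is the arrow `⟨1, r !⟩` for the object `A₀` over `W`.
  have hj : (a.comp j).IsCoc := by
    refine H hZ' (by simp [reassoc_of% hd₁, h₂]) (by rw [Category.assoc, hd₂, reassoc_of% h₂]) hJ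
      (a.comp j) (by simp [reassoc_of% hj₁, e₂]) ?_
    rw [DHom.comp_hom, DHom.cast_hom, Category.assoc, hj₂, hr, ← Category.assoc, ← Category.assoc]
    congr 1
    exact top_ext ((a.comp (toTopD (𝟙 W') A)).comp (toTopD ω _)) (toTopD (𝟙 W) A₀) (by simp [h₂])
  refine ((DHom.isCoc_of_inv a' a e₁ e₂).comp hj).congr (by simp [reassoc_of% h₁]) ?_
  simp [reassoc_of% e₁]

/-! ### Invertible action of points, and independence of the chosen point -/

section Swap

variable {U : B} {w₁ : W ⟶ U} (hw : IsBinProd w₁ w)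

/-- The arrow `⟨1,3,2⟩ : U × X × X ⟶ U × X × X`. -/
noncomputable def swapBase (hw : IsBinProd w₁ w) : W ⨯ X ⟶ W ⨯ X :=
  prod.lift (hw.lift (prod.fst ≫ w₁) prod.snd) (prod.fst ≫ w)

@[simp]
lemma swapBase_fst : swapBase hw ≫ prod.fst = hw.lift (prod.fst ≫ w₁) prod.snd := prod.lift_fst _ _

@[simp]
lemma swapBase_fst_assoc {V : B} (k : W ⟶ V) :
    swapBase hw ≫ prod.fst ≫ k = hw.lift (prod.fst ≫ w₁) prod.snd ≫ k := by
  simp only [← Category.assoc, swapBase_fst]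

@[simp]
lemma swapBase_snd : swapBase hw ≫ prod.snd = prod.fst ≫ w := prod.lift_snd _ _

@[simp]
lemma graph_swapBase : graph w ≫ swapBase hw = graph w := by
  refine Limits.prod.hom_ext (hw.hom_ext ?_ ?_) ?_ <;> simp

@[simp]
lemma swapBase_swapBase : swapBase hw ≫ swapBase hw = 𝟙 _ := by
  refine Limits.prod.hom_ext (hw.hom_ext ?_ ?_) ?_ <;> simp

variable {r : DHom (w ≫ dia X) (⊤_ (p.Fiber W)) Q} (H : UnivAt w r) (A : p.Fiber W)

/-- The involution `(a, e) ↦ (t(a, e), e⁻¹)` of `A ∧ Q`. -/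
noncomputable def actSwap (H : UnivAt w r) (A : p.Fiber W) :
    DHom (swapBase hw) (act w Q A) (act w Q A) :=
  (H.isCoc_actPt A).desc (actPt r A) (swapBase hw) (by simp)

@[simp]
lemma actPt_swap : (actPt r A).hom ≫ (actSwap hw H A).hom = (actPt r A).hom :=
  (H.isCoc_actPt A).fac _ _ _

@[simp]
lemma actPt_swap_assoc {c : E} (k : tot (act w Q A) ⟶ c) :
    (actPt r A).hom ≫ (actSwap hw H A).hom ≫ k = (actPt r A).hom ≫ k := by
  simp only [← Category.assoc, actPt_swap]

@[simp]
lemma actSwap_swap : (actSwap hw H A).hom ≫ (actSwap hw H A).hom = 𝟙 _ :=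
  (H.isCoc_actPt A).ext ((actSwap hw H A).comp (actSwap hw H A)) (DHom.id _) (by simp) (by simp)

@[simp]
lemma actSwap_swap_assoc {c : E} (k : tot (act w Q A) ⟶ c) :
    (actSwap hw H A).hom ≫ (actSwap hw H A).hom ≫ k = k := by
  simp only [← Category.assoc, actSwap_swap, Category.id_comp]

/-- The arrow `A ∧ Q ⟶ ⊤ ∧ Q`. -/
noncomputable def actBang (w : W ⟶ X) (Q : p.Fiber (X ⨯ X)) (A : p.Fiber W) :
    DHom (𝟙 _) (act w Q A) (act w Q (⊤_ (p.Fiber W))) :=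
  (isJC_act w Q _).lift (𝟙 _) (toTopD prod.fst (act w Q A)) (actSnd w Q A) (by simp) (by simp)

@[simp]
lemma actBang_snd : (actBang w Q A).hom ≫ (actSnd w Q _).hom = (actSnd w Q A).hom :=
  (isJC_act w Q _).lift_snd _ _ _ _ _

lemma actPt_bang (q : DHom (w ≫ dia X) (⊤_ (p.Fiber W)) Q) :
    (actPt q A).hom ≫ (actBang w Q A).hom = (toTopD (𝟙 W) A).hom ≫ (actPt q _).hom := by
  refine (isJC_act w Q _).ext ((actPt q A).comp (actBang w Q A))
    ((toTopD (𝟙 W) A).comp (actPt q _)) (by simp) ?_ ?_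
  · exact top_ext (((actPt q A).comp (actBang w Q A)).comp (actFst w Q _))
      (((toTopD (𝟙 W) A).comp (actPt q _)).comp (actFst w Q _)) (by simp)
  · simp only [DHom.comp_hom, Category.assoc, actBang_snd, actPt_snd]
    rw [← Category.assoc]
    congr 1
    exact top_ext (toTopD (𝟙 W) A) ((toTopD (𝟙 W) A).comp (toTopD (𝟙 W) _)) (by simp)

lemma actPt_bang_assoc (q : DHom (w ≫ dia X) (⊤_ (p.Fiber W)) Q) {c : E}
    (k : tot (act w Q (⊤_ (p.Fiber W))) ⟶ c) :
    (actPt q A).hom ≫ (actBang w Q A).hom ≫ k = (toTopD (𝟙 W) A).hom ≫ (actPt q _).hom ≫ k := by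
  simp only [← Category.assoc, actPt_bang]

lemma actSwap_bang : (actSwap hw H A).hom ≫ (actBang w Q A).hom =
    (actBang w Q A).hom ≫ (actSwap hw H _).hom := by
  refine (H.isCoc_actPt A).ext ((actSwap hw H A).comp (actBang w Q A))
    ((actBang w Q A).comp (actSwap hw H _)) (by simp) ?_
  simp [actPt_bang, actPt_bang_assoc]

lemma actSwap_bang_assoc {c : E} (k : tot (act w Q (⊤_ (p.Fiber W))) ⟶ c) :
    (actSwap hw H A).hom ≫ (actBang w Q A).hom ≫ k =
      (actBang w Q A).hom ≫ (actSwap hw H _).hom ≫ k := by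
  simp only [← Category.assoc, actSwap_bang]

/-- The action of a point `q` of `Q` over the diagonal on `A`. -/
noncomputable def twist (q : DHom (w ≫ dia X) (⊤_ (p.Fiber W)) Q) : DHom (𝟙 W) A A :=
  (((actPt q A).comp (actSwap hw H A)).comp (actFst w Q A)).cast (by simp)

/-- The inverse of a point of `Q` over the diagonal. -/
noncomputable def pointInv (q : DHom (w ≫ dia X) (⊤_ (p.Fiber W)) Q) :
    DHom (w ≫ dia X) (⊤_ (p.Fiber W)) Q :=
  (((actPt q _).comp (actSwap hw H _)).comp (actSnd w Q _)).cast (by ext <;> simp [dia])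

variable (q : DHom (w ≫ dia X) (⊤_ (p.Fiber W)) Q)

/-- In elements, `(a, q) ↦ (q a, q⁻¹)`. The point in the second component does not depend on `a`,
since the involution is natural along `A ⟶ ⊤`. -/
lemma actPt_actSwap : (actPt q A).hom ≫ (actSwap hw H A).hom =
    (twist hw H A q).hom ≫ (actPt (pointInv hw H q) A).hom := by
  refine (isJC_act w Q A).ext ((actPt q A).comp (actSwap hw H A))
    ((twist hw H A q).comp (actPt (pointInv hw H q) A)) (by simp) ?_ ?_
  · simp [twist]
  · simp only [DHom.comp_hom, Category.assoc, actPt_snd]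
    have h : (twist hw H A q).hom ≫ (toTopD (𝟙 W) A).hom = (toTopD (𝟙 W) A).hom :=
      top_ext ((twist hw H A q).comp (toTopD (𝟙 W) A)) (toTopD (𝟙 W) A) (by simp)
    rw [← actBang_snd, actSwap_bang_assoc, actPt_bang_assoc, reassoc_of% h]
    simp [pointInv]

lemma actPt_actSwap_assoc {c : E} (k : tot (act w Q A) ⟶ c) :
    (actPt q A).hom ≫ (actSwap hw H A).hom ≫ k =
      (twist hw H A q).hom ≫ (actPt (pointInv hw H q) A).hom ≫ k := by
  simp only [← Category.assoc, actPt_actSwap]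

/-- Swapping `(a, q)` twice gives it back; the first component of this reads `q⁻¹ (q a) = a`. The
second component is `pointInv_pointInv`. -/
lemma twist_pointInv : (twist hw H A q).hom ≫ (twist hw H A (pointInv hw H q)).hom = 𝟙 _ := by
  have h := actPt_actSwap_assoc hw H A q ((actSwap hw H A).hom ≫ (actFst w Q A).hom)
  simp only [actSwap_swap_assoc, actPt_fst] at h
  rw [h]
  simp [twist]

lemma pointInv_pointInv : (pointInv hw H (pointInv hw H q)).hom = q.hom := by
  have h := actPt_actSwap_assoc hw H (⊤_ (p.Fiber W)) q
    ((actSwap hw H _).hom ≫ (actSnd w Q _).hom)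
  have h₁ : (twist hw H (⊤_ (p.Fiber W)) q).hom = 𝟙 _ := top_ext _ (DHom.id _) rfl
  have h₂ : (toTopD (𝟙 W) (⊤_ (p.Fiber W))).hom = 𝟙 _ := top_ext _ (DHom.id _) rfl
  simp only [actSwap_swap_assoc, actPt_snd, h₁, h₂, Category.id_comp] at h
  rw [h]
  simp [pointInv]

lemma isIso_twist : IsIso (twist hw H A q).hom := by
  refine ⟨(twist hw H A (pointInv hw H q)).hom, twist_pointInv hw H A q, ?_⟩
  have h := twist_pointInv hw H A (pointInv hw H q)
  have e : pointInv hw H (pointInv hw H q) = q := DHom.ext (pointInv_pointInv hw H q)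
  rwa [e] at h

variable {r' : DHom ((prod.snd : W ⨯ X ⟶ X) ≫ dia X) (⊤_ (p.Fiber (W ⨯ X))) Q}

/-- The point `q`, with a dummy parameter in `X`. -/
noncomputable def weakenPoint : DHom ((prod.snd : W ⨯ X ⟶ X) ≫ dia X) (⊤_ (p.Fiber (W ⨯ X))) Q :=
  ((toTopD (hw.lift (prod.fst ≫ w₁) prod.snd) _).comp q).cast (by simp)

/-- The composition `e ↦ r e` of `Q`. -/
noncomputable def compLeft (r : DHom (w ≫ dia X) (⊤_ (p.Fiber W)) Q)
    (H' : UnivAt (prod.snd : W ⨯ X ⟶ X) r') :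
    DHom (𝟙 _) (act w Q (⊤_ (p.Fiber W))) (act w Q (⊤_ (p.Fiber W))) :=
  ((((isJC_act prod.snd Q (act w Q (⊤_ (p.Fiber W)))).lift (prod.lift (prod.fst ≫ graph w) prod.snd)
    ((actFst w Q _).comp (actPt r _)) (actSnd w Q _) (by simp) (by simp)).comp
    (actSwap (IsBinProd.of_prod W X) H' _)).comp (actFst _ _ _)).cast (by
      refine Limits.prod.hom_ext ?_ ?_ <;> simp)

/-- The endomorphism of `⊤ ∧ Q` that maps `r` to `q`. -/
noncomputable def mapPoint : DHom (𝟙 _) (act w Q (⊤_ (p.Fiber W))) (act w Q (⊤_ (p.Fiber W))) :=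
  (H.isCoc_actPt _).desc (actPt q _) (𝟙 _) (by simp)

@[simp]
lemma actPt_mapPoint : (actPt r _).hom ≫ (mapPoint H q).hom = (actPt q _).hom :=
  (H.isCoc_actPt _).fac _ _ _

@[simp]
lemma actPt_mapPoint_assoc {c : E} (k : tot (act w Q (⊤_ (p.Fiber W))) ⟶ c) :
    (actPt r _).hom ≫ (mapPoint H q).hom ≫ k = (actPt q _).hom ≫ k := by
  simp only [← Category.assoc, actPt_mapPoint]

/-- By universality of `r` it suffices to compare both sides at `r`. There `mapPoint` produces `q`,
and `compLeft` transports the endpoint of `r` along `q`, which is the action of the weakened point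
`q` on the object `⊤ ∧ Q`. The latter lives over `W ⨯ X`, hence the universal point `r'` with one
more parameter. -/
lemma mapPoint_compLeft (H' : UnivAt (prod.snd : W ⨯ X ⟶ X) r') :
    (mapPoint H q).hom ≫ (compLeft r H').hom =
      (twist (IsBinProd.of_prod W X) H' _ (weakenPoint hw q)).hom := by
  refine (H.isCoc_actPt _).ext ((mapPoint H q).comp (compLeft r H'))
    (twist (IsBinProd.of_prod W X) H' _ (weakenPoint hw q)) (by simp) ?_
  simp only [DHom.comp_hom, actPt_mapPoint_assoc, compLeft, twist, DHom.cast_hom]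
  simp only [← Category.assoc]
  congr 2
  refine (isJC_act _ _ _).ext
    ((actPt q _).comp ((isJC_act prod.snd Q (act w Q (⊤_ (p.Fiber W)))).lift
    (prod.lift (prod.fst ≫ graph w) prod.snd)
    ((actFst w Q _).comp (actPt r _)) (actSnd w Q _) (by simp) (by simp)))
    ((actPt r _).comp (actPt (weakenPoint hw q) _)) ?_ ?_ ?_
  · refine Limits.prod.hom_ext ?_ ?_ <;> simp
  · simp
  · simp only [DHom.comp_hom, Category.assoc, IsJC.lift_snd, actPt_snd, weakenPoint, DHom.cast_hom]
    simp only [← Category.assoc]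
    congr 1
    refine top_ext (toTopD (𝟙 W) _) (((actPt r _).comp (toTopD (𝟙 (W ⨯ X)) _)).comp
      (toTopD (hw.lift (prod.fst ≫ w₁) prod.snd) _)) ?_
    refine hw.hom_ext ?_ ?_ <;> simp

/-- Followed by `compLeft`, both `mapPoint H q` and `mapPoint H r = 𝟙` become twists, which are
invertible. The case of `r` shows that `compLeft` is invertible, and cancelling it settles the case
of `q`. -/
lemma isIso_mapPoint (hw : IsBinProd w₁ w) (H' : UnivAt (prod.snd : W ⨯ X ⟶ X) r') :
    IsIso (mapPoint H q).hom := by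
  have h : (mapPoint H r).hom = 𝟙 _ :=
    (H.isCoc_actPt _).ext (mapPoint H r) (DHom.id _) rfl (by simp)
  have h₁ := mapPoint_compLeft hw H r H'
  rw [h, Category.id_comp] at h₁
  let c := compLeft r H'
  have : IsIso c.hom := h₁ ▸ isIso_twist _ _ _ _
  have : IsIso ((mapPoint H q).hom ≫ c.hom) :=
    mapPoint_compLeft hw H q H' ▸ isIso_twist _ _ _ _
  exact IsIso.of_isIso_comp_right (mapPoint H q).hom c.hom

/-- If some point over the diagonal has the universal property, and also one with an additional
parameter in `X`, then every point over the diagonal has it. -/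
lemma UnivAt.of_point (hw : IsBinProd w₁ w) (H : UnivAt w r)
    (H' : UnivAt (prod.snd : W ⨯ X ⟶ X) r') (q : DHom (w ≫ dia X) (⊤_ (p.Fiber W)) Q) :
    UnivAt w q := by
  have := isIso_mapPoint H q hw H'
  refine univAt_of (IsBinProd.of_prod W X) (graph_fst w) (graph_snd w) fun A => ?_
  let m := mapPoint H q
  let m' : DHom (𝟙 _) _ _ := ⟨inv m.hom, inferInstance⟩
  refine ⟨act w Q A, actFst w Q A, actSnd w Q A, actPt q A, isJC_act w Q A, by simp, by simp, ?_⟩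
  -- `n` is `A ∧ m`, with inverse `n' = A ∧ m'`. It carries `⟨1, r !⟩` to `⟨1, q !⟩`, so the latter
  -- is cocartesian too.
  let n : DHom (𝟙 _) (act w Q A) (act w Q A) := (isJC_act w Q A).lift (𝟙 _) (actFst w Q A)
    (((actBang w Q A).comp m).comp (actSnd w Q _)) (by simp) (by simp)
  let n' : DHom (𝟙 _) (act w Q A) (act w Q A) := (isJC_act w Q A).lift (𝟙 _) (actFst w Q A)
    (((actBang w Q A).comp m').comp (actSnd w Q _)) (by simp) (by simp)
  have hn : n.hom ≫ (actBang w Q A).hom = (actBang w Q A).hom ≫ m.hom :=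
    (isJC_act w Q _).isCart_snd.ext (n.comp (actBang w Q A)) ((actBang w Q A).comp m) rfl
      (by simp [n])
  have hn' : n'.hom ≫ (actBang w Q A).hom = (actBang w Q A).hom ≫ m'.hom :=
    (isJC_act w Q _).isCart_snd.ext (n'.comp (actBang w Q A)) ((actBang w Q A).comp m') rfl
      (by simp [n'])
  have h₁ : n.hom ≫ n'.hom = 𝟙 _ := by
    refine (isJC_act w Q A).ext (n.comp n') (DHom.id _) (by simp) (by simp [n, n']) ?_
    simp only [DHom.comp_hom, DHom.id_hom, Category.assoc, Category.id_comp, n', IsJC.lift_snd]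
    simp [reassoc_of% hn, m']
  have h₂ : n'.hom ≫ n.hom = 𝟙 _ := by
    refine (isJC_act w Q A).ext (n'.comp n) (DHom.id _) (by simp) (by simp [n, n']) ?_
    simp only [DHom.comp_hom, DHom.id_hom, Category.assoc, Category.id_comp, n, IsJC.lift_snd]
    have h : m'.hom ≫ m.hom = 𝟙 _ := IsIso.inv_hom_id m.hom
    simp [reassoc_of% hn', reassoc_of% h]
  refine ((H.isCoc_actPt A).comp (DHom.isCoc_of_inv n n' h₁ h₂)).congr (by simp) ?_
  refine (isJC_act w Q A).ext ((actPt r A).comp n) (actPt q A) (by simp) (by simp [n]) ?_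
  simp [n, actPt_bang_assoc, m]
  rw [← Category.assoc]
  congr 1
  exact top_ext ((toTopD (𝟙 W) A).comp (toTopD (𝟙 W) _)) (toTopD (𝟙 W) A) (by simp)

end Swap

end Universal

/-! ### Left adjoints to reindexing as families of cocartesian arrows -/

section Adjunctions

lemma und_comp {X : B} {A A' A'' : p.Fiber X} (φ : A ⟶ A') (ψ : A' ⟶ A'') :
    und (φ ≫ ψ) = und φ ≫ und ψ := rfl

lemma und_id {X : B} (A : p.Fiber X) : und (𝟙 A) = 𝟙 (tot A) := rfl

variable [p.IsFibered]

/-- The arrow `A ⟶ L A` over `f` given by the unit of an adjunction `L ⊣ f^*`. -/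
noncomputable def unitArr {X Y : B} {f : X ⟶ Y} {L : p.Fiber X ⥤ p.Fiber Y}
    (adj : L ⊣ reindex p f) (A : p.Fiber X) : DHom f A (L.obj A) :=
  ((DHom.ofFib (adj.unit.app A)).comp (DHom.cart f _)).cast (by simp)

lemma reindex_map_cart {X Y : B} (f : X ⟶ Y) {A A' : p.Fiber Y} (φ : A ⟶ A') :
    und ((reindex p f).map φ) ≫ (DHom.cart f A').hom = (DHom.cart f A).hom ≫ und φ :=
  (cart_und p f φ).symm

lemma unitArr_comp {X Y : B} {f : X ⟶ Y} {L : p.Fiber X ⥤ p.Fiber Y}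
    (adj : L ⊣ reindex p f) {A : p.Fiber X} {D : p.Fiber Y} (χ : L.obj A ⟶ D) :
    (unitArr adj A).hom ≫ und χ = und (adj.homEquiv A D χ) ≫ (DHom.cart f D).hom := by
  rw [Adjunction.homEquiv_unit, und_comp, Category.assoc, reindex_map_cart]
  simp [unitArr]

/-- The hom-bijection of the adjunction is precisely the vertical factorisation property, and
`DHom.isCoc_of_vertical` extends it to all factorisations in the base. -/
lemma unitArr_isCoc {X Y : B} {f : X ⟶ Y} {L : p.Fiber X ⥤ p.Fiber Y}
    (adj : L ⊣ reindex p f) (A : p.Fiber X) : (unitArr adj A).IsCoc := by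
  refine DHom.isCoc_of_vertical _ (fun G ψ => ?_) (fun G χ χ' h => ?_)
  · let a := ((DHom.cart_isCart f G).lift ψ (𝟙 X) (by simp)).toFib
    refine ⟨DHom.ofFib ((adj.homEquiv A G).symm a), ?_⟩
    rw [DHom.ofFib_hom, unitArr_comp, Equiv.apply_symm_apply]
    simp [a]
  · have : χ.toFib = χ'.toFib := by
      apply (adj.homEquiv A G).injective
      apply und_ext
      refine (DHom.cart_isCart f G).ext (DHom.ofFib (adj.homEquiv A G χ.toFib))
        (DHom.ofFib (adj.homEquiv A G χ'.toFib)) rfl ?_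
      rw [DHom.ofFib_hom, DHom.ofFib_hom, ← unitArr_comp, ← unitArr_comp]
      exact h
    exact congrArg (fun x => und x) this

lemma unitArr_naturality {X Y : B} {f : X ⟶ Y} {L : p.Fiber X ⥤ p.Fiber Y}
    (adj : L ⊣ reindex p f) {A A' : p.Fiber X} (φ : A ⟶ A') :
    (unitArr adj A).hom ≫ und (L.map φ) = und φ ≫ (unitArr adj A').hom := by
  rw [unitArr_comp, Adjunction.homEquiv_unit, adj.unit_naturality, und_comp]
  simp [unitArr]

/-- A functor with natural cocartesian arrows `A ⟶ F A` over `f` is left adjoint to `f^*`. -/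
lemma exists_adjunction {X Y : B} {f : X ⟶ Y} (F : p.Fiber X ⥤ p.Fiber Y)
    (u : ∀ A, DHom f A (F.obj A)) (hu : ∀ A, (u A).IsCoc)
    (nat : ∀ {A A' : p.Fiber X} (φ : A ⟶ A'), (u A).hom ≫ und (F.map φ) = und φ ≫ (u A').hom) :
    ∃ adj : F ⊣ reindex p f, ∀ A, (unitArr adj A).hom = (u A).hom := by
  let toR : ∀ A D, (F.obj A ⟶ D) → (A ⟶ (reindex p f).obj D) := fun A D χ =>
    ((DHom.cart_isCart f D).lift ((u A).comp (DHom.ofFib χ)) (𝟙 X) (by simp)).toFib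
  have toR_cart : ∀ A D (χ : F.obj A ⟶ D),
      und (toR A D χ) ≫ (DHom.cart f D).hom = (u A).hom ≫ und χ := fun A D χ => by simp [toR]
  let toL : ∀ A D, (A ⟶ (reindex p f).obj D) → (F.obj A ⟶ D) := fun A D a =>
    ((hu A).desc ((DHom.ofFib a).comp (DHom.cart f D)) (𝟙 Y) (by simp)).toFib
  have toL_u : ∀ A D (a : A ⟶ (reindex p f).obj D),
      (u A).hom ≫ und (toL A D a) = und a ≫ (DHom.cart f D).hom := fun A D a => by simp [toL]
  have cart_inj : ∀ A D (a b : A ⟶ (reindex p f).obj D),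
      und a ≫ (DHom.cart f D).hom = und b ≫ (DHom.cart f D).hom → a = b := fun A D a b h =>
    und_ext ((DHom.cart_isCart f D).ext (DHom.ofFib a) (DHom.ofFib b) rfl h)
  have u_inj : ∀ A D (a b : F.obj A ⟶ D),
      (u A).hom ≫ und a = (u A).hom ≫ und b → a = b := fun A D a b h =>
    und_ext ((hu A).ext (DHom.ofFib a) (DHom.ofFib b) rfl h)
  let adj : F ⊣ reindex p f := Adjunction.mkOfHomEquiv
    { homEquiv := fun A D =>
        { toFun := toR A D
          invFun := toL A D
          left_inv := fun χ => u_inj _ _ _ _ (by rw [toL_u, toR_cart])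
          right_inv := fun a => cart_inj _ _ _ _ (by rw [toR_cart, toL_u]) }
      homEquiv_naturality_left_symm := fun {A A' D} φ a => by
        refine u_inj _ _ _ _ ?_
        change _ ≫ und (toL A D _) = _ ≫ und (F.map φ ≫ toL A' D a)
        rw [toL_u, und_comp, und_comp, ← Category.assoc (u A).hom, nat,
          Category.assoc, Category.assoc, toL_u]
      homEquiv_naturality_right := fun {A D D'} χ ξ => by
        refine cart_inj _ _ _ _ ?_
        change und (toR A D' _) ≫ _ = und (toR A D χ ≫ _) ≫ _
        rw [toR_cart, und_comp, und_comp, Category.assoc, reindex_map_cart,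
          ← Category.assoc, ← Category.assoc, toR_cart] }
  refine ⟨adj, fun A => ?_⟩
  have h := unitArr_comp adj (𝟙 (F.obj A))
  rw [und_id, Category.comp_id] at h
  rw [h]
  have : adj.homEquiv A (F.obj A) (𝟙 _) = toR A (F.obj A) (𝟙 _) := by
    rw [Adjunction.homEquiv_unit, CategoryTheory.Functor.map_id]
    exact Category.comp_id _
  rw [this, toR_cart]
  simp

end Adjunctions

/-! ### Extracting a universal point from a bare adjunction -/

section EqFunctor

variable [p.IsFibered] [HasFibredProducts p] [HasFiniteProducts B]

variable {X : B} {Q : p.Fiber (X ⨯ X)} (Y : B)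

/-- The action of `A ↦ A ∧ Q` on arrows. -/
noncomputable def actMap {A A' : p.Fiber (Y ⨯ X)} (φ : A ⟶ A') :
    DHom (𝟙 _) (act (prod.snd : Y ⨯ X ⟶ X) Q A) (act (prod.snd : Y ⨯ X ⟶ X) Q A') :=
  DHom.ofFib ((eqFunctor Y Q).map φ)

lemma actMap_fst {A A' : p.Fiber (Y ⨯ X)} (φ : A ⟶ A') :
    (actMap (Q := Q) Y φ).hom ≫ (actFst _ Q A').hom = (actFst _ Q A).hom ≫ und φ := by
  change und (prod.map ((reindex p (pr12 Y X)).map φ) (𝟙 _)) ≫ und prod.fst ≫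
    (DHom.cart (pr12 Y X) A').hom = (und prod.fst ≫ (DHom.cart (pr12 Y X) A).hom) ≫ und φ
  rw [← Category.assoc, ← und_comp, prod.map_fst, und_comp, Category.assoc,
    reindex_map_cart, Category.assoc]

lemma actMap_snd {A A' : p.Fiber (Y ⨯ X)} (φ : A ⟶ A') :
    (actMap (Q := Q) Y φ).hom ≫ (actSnd _ Q A').hom = (actSnd _ Q A).hom := by
  change und (prod.map ((reindex p (pr12 Y X)).map φ) (𝟙 _)) ≫ und prod.snd ≫
    (DHom.cart (pr23 Y X) Q).hom = und prod.snd ≫ (DHom.cart (pr23 Y X) Q).hom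
  rw [← Category.assoc, ← und_comp, prod.map_snd, Category.comp_id]

lemma actPt_naturality {r : DHom ((prod.snd : Y ⨯ X ⟶ X) ≫ dia X) (⊤_ (p.Fiber (Y ⨯ X))) Q}
    {A A' : p.Fiber (Y ⨯ X)} (φ : A ⟶ A') :
    (actPt r A).hom ≫ (actMap Y φ).hom = und φ ≫ (actPt r A').hom := by
  refine (isJC_act _ Q A').ext ((actPt r A).comp (actMap Y φ))
    ((DHom.ofFib φ).comp (actPt r A')) (by simp) ?_ ?_
  · simp [actMap_fst]
  · simp only [DHom.comp_hom, DHom.ofFib_hom, Category.assoc, actMap_snd, actPt_snd]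
    rw [← Category.assoc (und φ)]
    congr 1
    exact top_ext (toTopD (𝟙 _) A) ((DHom.ofFib φ).comp (toTopD (𝟙 _) A')) (by simp)

/-- If `A ↦ A ∧ Q` is left adjoint to reindexing along the parametrised diagonal, then, up to an
automorphism of the identity functor, the unit is of the form `⟨1, r !⟩`. -/
lemma exists_univAt (adj : eqFunctor Y Q ⊣ reindex p (pdia Y X)) :
    ∃ r : DHom ((prod.snd : Y ⨯ X ⟶ X) ≫ dia X) (⊤_ (p.Fiber (Y ⨯ X))) Q,
      UnivAt (prod.snd : Y ⨯ X ⟶ X) r := by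
  let u : ∀ A, DHom (graph (prod.snd : Y ⨯ X ⟶ X)) A (act prod.snd Q A) := fun A => unitArr adj A
  have hu : ∀ A, (u A).IsCoc := fun A => unitArr_isCoc adj A
  have nat : ∀ {A A' : p.Fiber (Y ⨯ X)} (φ : A ⟶ A'),
      (u A).hom ≫ (actMap Y φ).hom = und φ ≫ (u A').hom := unitArr_naturality adj
  -- The second component of the unit at `⊤`. By naturality along `A ⟶ ⊤` it determines the second
  -- component of every unit arrow, which leaves only the first component `θ`.
  let r : DHom ((prod.snd : Y ⨯ X ⟶ X) ≫ dia X) (⊤_ (p.Fiber (Y ⨯ X))) Q :=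
    ((u _).comp (actSnd _ Q _)).cast (by ext <;> simp [dia])
  let θ : ∀ A, DHom (𝟙 _) A A := fun A => ((u A).comp (actFst _ Q A)).cast (by simp)
  have θ_nat : ∀ {A A' : p.Fiber (Y ⨯ X)} (φ : A ⟶ A'), (θ A).hom ≫ und φ = und φ ≫ (θ A').hom := by
    intro A A' φ
    have := congrArg (· ≫ (actFst (prod.snd : Y ⨯ X ⟶ X) Q A').hom) (nat φ)
    simp only [Category.assoc, actMap_fst] at this
    simpa [θ] using this
  have hθ : ∀ A, (θ A).hom ≫ (actPt r A).hom = (u A).hom := by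
    intro A
    refine (isJC_act _ Q A).ext ((θ A).comp (actPt r A)) (u A) (by simp) (by simp [θ]) ?_
    have := congrArg (· ≫ (actSnd (prod.snd : Y ⨯ X ⟶ X) Q _).hom) (nat (terminal.from A))
    simp only [Category.assoc, actMap_snd] at this
    rw [this, DHom.comp_hom, Category.assoc, actPt_snd, ← Category.assoc]
    change _ = und (terminal.from A) ≫ r.hom
    congr 1
    exact top_ext ((θ A).comp (toTopD (𝟙 _) A)) (DHom.ofFib (terminal.from A)) (by simp)
  refine ⟨r, univAt_of_actPt fun A => ?_⟩
  -- Descending the identity along the unit shows that `θ` at `A` is a split monomorphism, with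
  -- retraction `m`. As `m` is itself an endomorphism of `A`, naturality of `θ` makes the two
  -- commute, so `m` is a two-sided inverse.
  obtain ⟨k, hk⟩ := (hu A).exists_desc (DHom.id A) prod.fst (by simp)
  let m : DHom (𝟙 _) A A := ((actPt r A).comp k).cast (by simp)
  have h₁ : (θ A).hom ≫ m.hom = 𝟙 _ := by
    simp only [m, DHom.cast_hom, DHom.comp_hom]
    rw [← Category.assoc, hθ, hk, DHom.id_hom]
  have h₂ : m.hom ≫ (θ A).hom = 𝟙 _ := (θ_nat m.toFib).symm.trans h₁
  refine ((DHom.isCoc_of_inv m (θ A) h₂ h₁).comp (hu A)).congr (by simp) ?_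
  rw [DHom.comp_hom, ← hθ, ← Category.assoc, h₂, Category.id_comp]

end EqFunctor

lemma cocartOver_iff_of_isHomLift {Θ : MorphismProperty B} {X Y : B} (f : X ⟶ Y) {a b : E}
    (φ : a ⟶ b) [p.IsHomLift f φ] :
    cocartOver p Θ φ ↔ p.IsStronglyCocartesian f φ ∧ Θ f := by
  subst_hom_lift p f φ
  rfl

lemma DHom.cocartOver_iff {Θ : MorphismProperty B} {X Y : B} {f : X ⟶ Y} {A : p.Fiber X}
    {D : p.Fiber Y} (φ : DHom f A D) : cocartOver p Θ φ.hom ↔ φ.IsCoc ∧ Θ f :=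
  cocartOver_iff_of_isHomLift f φ.hom

lemma map_eq_map_of_isHomLift {X Y : B} (f : X ⟶ Y) {a b : E} (φ ψ : a ⟶ b)
    [p.IsHomLift f φ] [h : p.IsHomLift f ψ] : p.map φ = p.map ψ := by
  rw [IsHomLift.fac' p f φ, IsHomLift.fac' p f ψ]

lemma cocartOver.fibEpic {Θ : MorphismProperty B} {a b : E} {φ : a ⟶ b} (h : cocartOver p Θ φ) :
    fibEpic p φ := by
  intro b' ψ ψ' e e'
  have := h.1
  have : p.IsHomLift (p.map ψ) ψ' := e ▸ inferInstance
  exact IsStronglyCocartesian.ext p (p.map φ) φ (p.map ψ) e'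

/-! ### Universal loops and the class BCFR -/

section Loops

variable [p.IsFibered] [HasFibredProducts p] [HasFiniteProducts B]

namespace Loop

variable {X : B} (l : Loop p X)

/-- The arrow of a loop, as an arrow over the diagonal. -/
def arrD : DHom (dia X) (⊤_ (p.Fiber X)) l.obj := ⟨l.arr, inferInstance⟩

@[simp]
lemma arrD_hom : l.arrD.hom = l.arr := rfl

/-- The arrow `A ⟶ ⊤ ⟶ Eq_X` over `w ≫ ⟨1,1⟩`. -/
noncomputable def refl {W : B} (w : W ⟶ X) (A : p.Fiber W) : DHom (w ≫ dia X) A l.obj :=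
  (toTopD w A).comp l.arrD

lemma comp_refl {V W : B} {f : V ⟶ W} {w : W ⟶ X} {v : V ⟶ X} {C : p.Fiber V} {A : p.Fiber W}
    (φ : DHom f C A) (e : v = f ≫ w) : φ.hom ≫ (l.refl w A).hom = (l.refl v C).hom := by
  rw [refl, DHom.comp_hom, ← Category.assoc]
  congr 1
  exact top_ext (φ.comp (toTopD w A)) (toTopD v C) e.symm

/-- The loop is universal with respect to all parameters. -/
def Univ : Prop :=
  ∀ ⦃U W : B⦄ ⦃w₁ : W ⟶ U⦄ ⦃w : W ⟶ X⦄, IsBinProd w₁ w → UnivAt w (l.refl w (⊤_ (p.Fiber W)))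

variable {l}

lemma Univ.isCoc (H : l.Univ) {U W Z : B} {w₁ : W ⟶ U} {w : W ⟶ X} (hw : IsBinProd w₁ w)
    {e : Z ⟶ W} {z : Z ⟶ X} (hZ : IsBinProd e z) {d : W ⟶ Z} (hd₁ : d ≫ e = 𝟙 W) (hd₂ : d ≫ z = w)
    {A : p.Fiber W} {K : p.Fiber Z} {k₁ : DHom e K A} {f : Z ⟶ X ⨯ X} {k₂ : DHom f K l.obj}
    (hf : f = prod.lift (e ≫ w) z) (hK : IsJC k₁ k₂) (j : DHom d A K) (hj₁ : j.hom ≫ k₁.hom = 𝟙 _)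
    (hj₂ : j.hom ≫ k₂.hom = (l.refl w A).hom) : j.IsCoc := by
  subst hf
  exact H hw hZ hd₁ hd₂ hK j hj₁ (by
    rw [hj₂, l.comp_refl (toTopD (𝟙 W) A) (v := w) (by simp)])

/-- The arrows in the class `BCFR` of a loop are, up to isomorphisms, of the form
`⟨1, refl⟩ : A ⟶ A ∧ Eq_X`. -/
lemma bcfr_induction {motive : ∀ {a b : E}, (a ⟶ b) → Prop}
    (H : ∀ {U W Z : B} {w₁ : W ⟶ U} {w : W ⟶ X} {e : Z ⟶ W} {z : Z ⟶ X} {d : W ⟶ Z},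
      IsBinProd w₁ w → IsBinProd e z → d ≫ e = 𝟙 W → d ≫ z = w →
      ∀ {P A : p.Fiber W} {K : p.Fiber Z} {k₁ : DHom e K A}
        {k₂ : DHom (prod.lift (e ≫ w) z) K l.obj} (j : DHom d A K) (ψ : DHom d P K)
        (i : DHom (𝟙 W) P A) (i' : DHom (𝟙 W) A P), IsJC k₁ k₂ → j.hom ≫ k₁.hom = 𝟙 _ →
        j.hom ≫ k₂.hom = (l.refl w A).hom → i.hom ≫ i'.hom = 𝟙 _ → i'.hom ≫ i.hom = 𝟙 _ →
        i.hom ≫ j.hom = ψ.hom → motive ψ.hom)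
    {a b : E} {ψ : a ⟶ b} (h : l.BCFRClass ψ) : motive ψ := by
  obtain @⟨U, UX, UY, g, x₁, x₂, y₁, y₂, hx, hy, gX, gY, Us, Ur, hgX, hgY, hUs, hUr, A', C, P, D',
    C', Q, α, β, φ', hα, hβ, hφ', comm, σ, ρ, hσ, hρ, split, π₁, π₂, π₁', π₂', hP, hQ, ψ, hψ, h₁,
    h₂⟩ := h
  obtain rfl : gX = x₂ := by simpa using hgX.2
  obtain rfl : gY = y₂ := by simpa using hgY.2
  have e₁ : Us ≫ y₁ = x₁ := by simpa using hUs.1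
  have e₂ : Us ≫ gY = gX ≫ dia X := hUs.2
  have e₃ : Ur ≫ x₁ = y₁ := by simpa using hUr.1
  have e₄ : Ur ≫ gX = gY ≫ prod.fst := hUr.2
  let αD : DHom gX A' (⊤_ (p.Fiber X)) := ⟨α, inferInstance⟩
  have hαD : αD.IsCart := hα
  let βD : DHom gY D' l.obj := ⟨β, inferInstance⟩
  let ρD : DHom Ur C' C := ⟨ρ, inferInstance⟩
  let ψD : DHom Us P Q := ⟨ψ, hψ⟩
  have e₅ : gY = prod.lift (Ur ≫ gX) (gY ≫ prod.snd) := by ext <;> simp [e₄]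
  let k₁ : DHom Ur Q C := ((DHom.ofFib π₁').comp ρD).cast (by simp)
  let k₂ : DHom (prod.lift (Ur ≫ gX) (gY ≫ prod.snd)) Q l.obj :=
    ((DHom.ofFib π₂').comp βD).cast (by simpa using e₅)
  have hK : IsJC k₁ k₂ := (isJC_of_isBinProd hQ).comp_cart (ρ := ρD) (β := βD) hρ hβ (by simp)
    (by simpa using e₅.symm) rfl rfl
  -- `A'` is a reindexing of `⊤_X`, hence terminal in its fibre, so the projection `P ⟶ C` is
  -- invertible.
  let t : C ⟶ A' := (hαD.lift (toTopD gX C) (𝟙 UX) (by simp)).toFib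
  let i' : C ⟶ P := hP.lift (𝟙 C) t
  have hi₁ : i' ≫ π₁ = 𝟙 _ := hP.lift_fst _ _
  have hi₂ : π₁ ≫ i' = 𝟙 _ := by
    refine hP.hom_ext (by simp [hi₁]) (und_ext ?_)
    refine hαD.ext (DHom.ofFib ((π₁ ≫ i') ≫ π₂)) (DHom.ofFib (𝟙 P ≫ π₂)) rfl ?_
    exact top_ext ((DHom.ofFib ((π₁ ≫ i') ≫ π₂)).comp αD) ((DHom.ofFib (𝟙 P ≫ π₂)).comp αD) rfl
  have hi₁' : und i' ≫ und π₁ = 𝟙 _ := congrArg (fun x => und x) hi₁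
  have hi₂' : und π₁ ≫ und i' = 𝟙 _ := congrArg (fun x => und x) hi₂
  let j : DHom Us C Q := ((DHom.ofFib i').comp ψD).cast (by simp)
  refine H (w := gX) (z := gY ≫ prod.snd) (k₁ := k₁) (k₂ := k₂) hx (hx.assoc_right hy e₃ e₄) ?_ ?_
    j ψD (DHom.ofFib π₁) (DHom.ofFib i') hK ?_ ?_ hi₂' hi₁' ?_
  · refine hx.hom_ext ?_ ?_
    · simp [e₃, e₁]
    · simp [e₄, reassoc_of% e₂, dia]
  · simp [reassoc_of% e₂, dia]
  · change (und i' ≫ ψ) ≫ und π₁' ≫ ρ = _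
    rw [Category.assoc, reassoc_of% h₁, split, Category.comp_id, hi₁']
  · change (und i' ≫ ψ) ≫ und π₂' ≫ β = _
    rw [Category.assoc, reassoc_of% h₂, ← comm, ← Category.assoc, ← Category.assoc]
    change ((((DHom.ofFib i').comp (DHom.ofFib π₂)).comp αD).hom) ≫ _ = _
    rw [top_ext (((DHom.ofFib i').comp (DHom.ofFib π₂)).comp αD) (toTopD gX C) (by simp)]
    rfl
  · change und π₁ ≫ und i' ≫ ψ = ψ
    rw [reassoc_of% hi₂']

/-- Converse to `bcfr_induction`: reindex `δ_X` along `U ⟶ 1` with domain the chosen terminal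
object, and pair with the cartesian section of `e^* A ⟶ A`. Since `A` itself is a product of `A` and
the terminal object, no isomorphism intervenes. -/
lemma bcfrClass_of {U W Z : B} {w₁ : W ⟶ U} {w : W ⟶ X} {e : Z ⟶ W} {z : Z ⟶ X} {d : W ⟶ Z}
    (hw : IsBinProd w₁ w) (hZ : IsBinProd e z) (hd₁ : d ≫ e = 𝟙 W) (hd₂ : d ≫ z = w)
    {A : p.Fiber W} {K : p.Fiber Z} {k₁ : DHom e K A} {k₂ : DHom (prod.lift (e ≫ w) z) K l.obj}
    (j : DHom d A K) (hK : IsJC k₁ k₂) (hj₁ : j.hom ≫ k₁.hom = 𝟙 _)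
    (hj₂ : j.hom ≫ k₂.hom = (l.refl w A).hom) : l.BCFRClass j.hom := by
  let f := prod.lift (e ≫ w) z
  have hd : d ≫ f = w ≫ dia X := by ext <;> simp [f, dia, reassoc_of% hd₁, hd₂]
  let ρ : DHom e ((reindex p e).obj A) A := DHom.cart e A
  have hρ : ρ.IsCart := DHom.cart_isCart e A
  let σ : DHom d A ((reindex p e).obj A) := hρ.lift (DHom.id A) d hd₁.symm
  have hσρ : σ.hom ≫ ρ.hom = 𝟙 _ := hρ.fac _ _ _
  let β : DHom f ((reindex p f).obj l.obj) l.obj := DHom.cart f l.obj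
  have hβ : β.IsCart := DHom.cart_isCart f l.obj
  let α : DHom w (⊤_ (p.Fiber W)) (⊤_ (p.Fiber X)) := toTopD w _
  let φ' : DHom d (⊤_ (p.Fiber W)) ((reindex p f).obj l.obj) := hβ.lift (l.refl w _) d hd.symm
  have hφ' : φ'.hom ≫ β.hom = (l.refl w _).hom := hβ.fac _ _ _
  let π₁' : K ⟶ (reindex p e).obj A := (hρ.lift k₁ (𝟙 Z) (by simp)).toFib
  let π₂' : K ⟶ (reindex p f).obj l.obj := (hβ.lift k₂ (𝟙 Z) (by simp [f])).toFib
  have h₁ : und π₁' ≫ ρ.hom = k₁.hom := hρ.fac _ _ _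
  have h₂ : und π₂' ≫ β.hom = k₂.hom := hβ.fac _ _ _
  refine BCFR.mk (terminal.from U) w₁ w (e ≫ w₁) f hw (hw.assoc_left hZ) w f d e
    ⟨Subsingleton.elim _ _, rfl⟩ ⟨Subsingleton.elim _ _, rfl⟩ ⟨by simp [reassoc_of% hd₁], hd⟩
    ⟨by simp, by simp [f]⟩ α.hom β.hom φ'.hom (top_isCart α) hβ φ'.lift hφ'.symm σ.hom ρ.hom
    (hρ.of_section hd₁ hσρ) hρ hσρ (𝟙 A) (terminal.from A) π₁' π₂' ?_ (hK.isBinProd hρ hβ h₁ h₂)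
    j.hom j.lift ?_ ?_
  · exact isBinProd_of (fun f g => ⟨f, by simp, Subsingleton.elim _ _⟩)
      (fun f g h _ => by simpa using h)
  · rw [und_id, Category.id_comp]
    refine hρ.ext (j.comp (DHom.ofFib π₁')) σ (by simp) ?_
    rw [hσρ, DHom.comp_hom, Category.assoc, DHom.ofFib_hom, h₁, hj₁]
  · refine hβ.ext (j.comp (DHom.ofFib π₂')) ((DHom.ofFib (terminal.from A)).comp φ') (by simp) ?_
    rw [DHom.comp_hom, DHom.comp_hom, Category.assoc, Category.assoc, DHom.ofFib_hom, h₂, hφ', hj₂,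
      l.comp_refl (DHom.ofFib (terminal.from A)) (v := w) (by simp)]

lemma univ_of_bcfr {Θ : MorphismProperty B}
    (H : ∀ {a b : E} (ψ : a ⟶ b), l.BCFRClass ψ → cocartOver p Θ ψ) :
    l.Univ := by
  intro U W w₁ w hw Z e z hZ d hd₁ hd₂ A K k₁ k₂ hK j hj₁ hj₂
  rw [l.comp_refl (toTopD (𝟙 W) A) (v := w) (by simp)] at hj₂
  exact (j.cocartOver_iff.1 (H _ (bcfrClass_of hw hZ hd₁ hd₂ j hK hj₁ hj₂))).1

lemma Univ.bcfr (H : l.Univ) {a b : E} (ψ : a ⟶ b) (h : l.BCFRClass ψ) :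
    cocartOver p ParamDiag ψ := by
  refine bcfr_induction (motive := fun ψ => cocartOver p ParamDiag ψ) ?_ h
  intro U W Z w₁ w e z d hw hZ hd₁ hd₂ P A K k₁ k₂ j ψ i i' hK hj₁ hj₂ hi hi' hψ
  refine ψ.cocartOver_iff.2 ⟨?_, U, X, w₁, w, e, z, hw, hZ, hd₁, hd₂⟩
  exact ((DHom.isCoc_of_inv i i' hi hi').comp (H.isCoc hw hZ hd₁ hd₂ rfl hK j hj₁ hj₂)).congr
    (by simp) hψ

/-- It suffices to consider the chosen products. -/
lemma univ_of_prod (H : ∀ U : B, UnivAt (prod.snd : U ⨯ X ⟶ X) (l.refl prod.snd _)) : l.Univ := by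
  intro U W w₁ w hw
  refine (H U).of_iso (ω := prod.lift w₁ w) (ω' := hw.lift prod.fst prod.snd)
    (hw.hom_ext (by simp) (by simp)) (by ext <;> simp) (by simp) ?_
  exact (l.comp_refl (toTopD (prod.lift w₁ w) _) (by simp)).symm

end Loop

end Loops

/-! ### Universal loops from stability conditions and from adjunctions -/

section

variable [p.IsFibered] [HasFibredProducts p] [HasFiniteProducts B]

lemma paramDiag_dia (X : B) : ParamDiag (dia X) :=
  ⟨⊤_ B, X, terminal.from X, 𝟙 X, prod.fst, prod.snd, IsBinProd.of_terminal X,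
    IsBinProd.of_prod X X, prod.lift_fst _ _, prod.lift_snd _ _⟩

lemma paramDiag_pdia (Y X : B) : ParamDiag (pdia Y X) :=
  ⟨Y, X, prod.fst, prod.snd, prod.fst, prod.snd, IsBinProd.of_prod Y X, IsBinProd.of_prod _ X,
    prod.lift_fst _ _, prod.lift_snd _ _⟩

/-- A BCFR arrow arises from `δ_X` by a parametrised reindexing, covered by product-stability,
followed by a pairing with a cartesian arrow, covered by pairability. -/
lemma bcfr_of_productStable_of_pairable
    (h₁ : ProductStable p ParamDiag (cocartOver p ParamDiag))
    (h₂ : Pairable p (cocartOver p ParamDiag)) {X : B} {l : Loop p X}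
    (hl : p.IsStronglyCocartesian (dia X) l.arr) {a b : E} (ψ : a ⟶ b) (h : l.BCFRClass ψ) :
    cocartOver p ParamDiag ψ := by
  obtain @⟨U, UX, UY, g, x₁, x₂, y₁, y₂, hx, hy, gX, gY, Us, Ur, hgX, hgY, hUs, hUr, A', C, P, D',
    C', Q, α, β, φ', hα, hβ, hφ', comm, σ, ρ, hσ, hρ, split, π₁, π₂, π₁', π₂', hP, hQ, ψ, hψ, e₁,
    e₂⟩ := h
  have hφ : cocartOver p ParamDiag φ' := by
    refine h₁ g (dia X) (paramDiag_dia X) x₁ x₂ (terminal.from X) (𝟙 X) y₁ y₂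
      (terminal.from (X ⨯ X)) (𝟙 (X ⨯ X)) hx (IsBinProd.of_terminal X) hy
      (IsBinProd.of_terminal _) gX gY Us (dia X) hgX hgY hUs
      ⟨Subsingleton.elim _ _, by simp⟩ φ' l.arr α β hφ' inferInstance hα hβ comm ?_
    exact l.arrD.cocartOver_iff.2 ⟨hl, paramDiag_dia X⟩
  exact h₂ Us φ' σ π₂ π₁ π₂' π₁' ψ hφ' hσ hP.symm hQ.symm hψ e₂ e₁ hφ

/-- If the functors `A ↦ A ∧ Q` are left adjoint to reindexing along parametrised diagonals, every
loop on `Q` is universal. -/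
lemma univ_of_adjunction {X : B} {l : Loop p X}
    (H : ∀ Y : B, Nonempty (eqFunctor Y l.obj ⊣ reindex p (pdia Y X))) : l.Univ := by
  refine Loop.univ_of_prod fun U => ?_
  -- The adjunctions for different parameters are unrelated: `r` and `r'` need not come from the
  -- loop or from one another. `UnivAt.of_point` replaces `r` by the reflexivity of the loop.
  obtain ⟨r, hr⟩ := exists_univAt U (H U).some
  obtain ⟨r', hr'⟩ := exists_univAt (U ⨯ X) (H (U ⨯ X)).some
  exact hr.of_point (IsBinProd.of_prod U X) hr' _

lemma exists_loop_of_adjunction {X : B} {Q : p.Fiber (X ⨯ X)}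
    (H : ∀ Y : B, Nonempty (eqFunctor Y Q ⊣ reindex p (pdia Y X))) :
    ∃ l : Loop p X, l.obj = Q := by
  obtain ⟨r, -⟩ := exists_univAt X (H X).some
  -- The parameter object was taken to be `X`, so that restricting along the diagonal eliminates it.
  let δ : DHom (dia X) (⊤_ (p.Fiber X)) Q :=
    ((toTopD (dia X) (⊤_ (p.Fiber X))).comp r).cast (by ext <;> simp [dia])
  exact ⟨⟨Q, δ.hom, δ.lift⟩, rfl⟩

/-- The unit arrow `⟨1, refl⟩ : A ⟶ A ∧ Eq_X` over the parametrised diagonal. -/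
noncomputable def Loop.unit {X : B} (l : Loop p X) (Y : B) (A : p.Fiber (Y ⨯ X)) :
    DHom (pdia Y X) A ((eqFunctor Y l.obj).obj A) :=
  actPt (l.refl (prod.snd : Y ⨯ X ⟶ X) _) A

lemma Loop.Univ.isCoc_unit {X : B} {l : Loop p X} (H : l.Univ) (Y : B) (A : p.Fiber (Y ⨯ X)) :
    (l.unit Y A).IsCoc :=
  (H (IsBinProd.of_prod Y X)).isCoc_actPt A

lemma Loop.Univ.exists_adjunction {X : B} {l : Loop p X} (H : l.Univ) (Y : B) :
    ∃ adj : eqFunctor Y l.obj ⊣ reindex p (pdia Y X),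
      ∀ A, (unitArr adj A).hom = (l.unit Y A).hom :=
  ElemFib.exists_adjunction (eqFunctor Y l.obj) (l.unit Y) (H.isCoc_unit Y)
    (fun φ => actPt_naturality Y φ)

/-! ### Transporters -/

namespace Loop

variable {X : B} (l : Loop p X)

/-- The projection `pr₁^* A ∧ Eq_X ⟶ A`. -/
noncomputable def actFst (A : p.Fiber X) : DHom (prod.fst : X ⨯ X ⟶ X) (l.act A) A :=
  ((DHom.ofFib prod.fst).comp (DHom.cart _ A)).cast (by simp)

/-- The projection `pr₁^* A ∧ Eq_X ⟶ Eq_X`. -/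
noncomputable def actSnd (A : p.Fiber X) : DHom (𝟙 _) (l.act A) l.obj :=
  DHom.ofFib prod.snd

lemma isJC_act (A : p.Fiber X) : IsJC (l.actFst A) (l.actSnd A) :=
  (isJC_of_isBinProd (IsBinProd.of_prod _ _)).comp_cart (DHom.cart_isCart _ A)
    (DHom.isCart_of_inv (DHom.id _) (DHom.id _) (by simp) (by simp)) (by simp) (by simp) rfl
    (by simp only [DHom.id_hom, Category.comp_id]; rfl)

/-- The arrow `δ_A`, over the diagonal. -/
noncomputable def pointD (A : p.Fiber X) : DHom (dia X) A (l.act A) :=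
  ⟨l.point A, by unfold point; exact pair_isHomLift _ _ _ _⟩

@[simp]
lemma pointD_fst (A : p.Fiber X) : (l.pointD A).hom ≫ (l.actFst A).hom = 𝟙 _ := by
  change pair p (dia X) (diaLift A) (l.reflAt A) ≫ und prod.fst ≫ ElemFib.cart p prod.fst A = _
  rw [← Category.assoc, pair_fst]
  exact cartLift_cart p _ _ _

@[simp]
lemma pointD_snd (A : p.Fiber X) : (l.pointD A).hom ≫ (l.actSnd A).hom = (l.refl (𝟙 X) A).hom := by
  change pair p (dia X) (diaLift A) (l.reflAt A) ≫ und prod.snd = _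
  rw [pair_snd]
  change (DHom.ofFib (terminal.from A)).hom ≫ l.arr = (toTopD (𝟙 X) A).hom ≫ l.arr
  rw [top_ext (DHom.ofFib (terminal.from A)) (toTopD (𝟙 X) A) rfl]

variable {l}

lemma Univ.isCoc_pointD (H : l.Univ) (A : p.Fiber X) : (l.pointD A).IsCoc :=
  H.isCoc (IsBinProd.of_terminal X) (IsBinProd.of_prod X X) (prod.lift_fst _ _) (prod.lift_snd _ _)
    (by ext <;> simp) (l.isJC_act A) _ (l.pointD_fst A) (l.pointD_snd A)

variable (l) {Y : B} (m : Loop p Y)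

/-- The projection `Eq_X ⊠ Eq_Y ⟶ Eq_X`. -/
noncomputable def boxProjFst : DHom (pr13 X Y) (l.box m) l.obj :=
  jcFst (pr13 X Y) (pr24 X Y) l.obj m.obj

/-- The projection `Eq_X ⊠ Eq_Y ⟶ Eq_Y`. -/
noncomputable def boxProjSnd : DHom (pr24 X Y) (l.box m) m.obj :=
  jcSnd (pr13 X Y) (pr24 X Y) l.obj m.obj

lemma isJC_box : IsJC (l.boxProjFst m) (l.boxProjSnd m) := isJC_jc _ _ _ _

/-- The arrow `δ_X ⊠ δ_Y`, over the diagonal. -/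
noncomputable def boxArrD : DHom (dia (X ⨯ Y)) (⊤_ (p.Fiber (X ⨯ Y))) (l.box m) :=
  ⟨l.boxArr m, by unfold boxArr; exact pair_isHomLift _ _ _ _⟩

@[simp]
lemma boxArrD_fst : (l.boxArrD m).hom ≫ (l.boxProjFst m).hom = (l.refl prod.fst _).hom := by
  change pair p (dia (X ⨯ Y)) (l.boxFst Y) (Loop.boxSnd X m) ≫ und prod.fst ≫
    ElemFib.cart p (pr13 X Y) l.obj = _
  rw [← Category.assoc, pair_fst]
  exact cartLift_cart p _ _ _

@[simp]
lemma boxArrD_snd : (l.boxArrD m).hom ≫ (l.boxProjSnd m).hom = (m.refl prod.snd _).hom := by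
  change pair p (dia (X ⨯ Y)) (l.boxFst Y) (Loop.boxSnd X m) ≫ und prod.snd ≫
    ElemFib.cart p (pr24 X Y) m.obj = _
  rw [← Category.assoc, pair_snd]
  exact cartLift_cart p _ _ _

variable {l m}

/-- A path in a product is built one coordinate at a time. First `⊤ ⟶ ⊤ ∧ Eq_X` over `(x, y) ↦ (x,
y, x)` with parameter `y`, then the universal arrow of `Eq_Y` over `(x, y, x') ↦ (x, y, x', y)` with
parameter `(x, x')`. Both are cocartesian and their composite is `δ_X ⊠ δ_Y`. -/
lemma Univ.isCoc_boxArrD (hl : l.Univ) (hm : m.Univ) : (l.boxArrD m).IsCoc := by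
  let w : X ⨯ Y ⟶ X := prod.fst
  let j₁ := actPt (l.refl w (⊤_ (p.Fiber (X ⨯ Y)))) (⊤_ _)
  have hj₁ : j₁.IsCoc := (hl (IsBinProd.of_prod X Y).symm).isCoc_actPt _
  let K := ElemFib.act w l.obj (⊤_ (p.Fiber (X ⨯ Y)))
  let e : (X ⨯ Y) ⨯ (X ⨯ Y) ⟶ (X ⨯ Y) ⨯ X := prod.lift prod.fst (prod.snd ≫ prod.fst)
  let z : (X ⨯ Y) ⨯ (X ⨯ Y) ⟶ Y := prod.snd ≫ prod.snd
  let y : (X ⨯ Y) ⨯ X ⟶ Y := prod.fst ≫ prod.snd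
  let d : (X ⨯ Y) ⨯ X ⟶ (X ⨯ Y) ⨯ (X ⨯ Y) := prod.lift prod.fst (prod.lift prod.snd y)
  have hy : IsBinProd (prod.lift (prod.fst ≫ prod.fst) prod.snd : (X ⨯ Y) ⨯ X ⟶ X ⨯ X) y := by
    refine isBinProd_of (fun f g => ⟨prod.lift (prod.lift (f ≫ prod.fst) g) (f ≫ prod.snd), ?_, ?_⟩)
      (fun f g e₁ e₂ => ?_)
    · ext <;> simp
    · simp [y]
    · have e₃ := congrArg (· ≫ prod.fst) e₁
      have e₄ := congrArg (· ≫ prod.snd) e₁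
      ext
      · simpa using e₃
      · simpa [y] using e₂
      · simpa using e₄
  have hz : IsBinProd e z := by
    refine isBinProd_of (fun f g => ⟨prod.lift (f ≫ prod.fst) (prod.lift (f ≫ prod.snd) g), ?_, ?_⟩)
      (fun f g e₁ e₂ => ?_)
    · ext <;> simp [e]
    · simp [z]
    · have e₃ := congrArg (· ≫ prod.fst) e₁
      have e₄ := congrArg (· ≫ prod.snd) e₁
      ext
      · simpa [e] using congrArg (· ≫ prod.fst) e₃
      · simpa [e] using congrArg (· ≫ prod.snd) e₃
      · simpa [e] using e₄
      · simpa [z] using e₂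
  -- As its first component is terminal, `K` is just a reindexing of `Eq_X`; hence `Eq_X ⊠ Eq_Y` is
  -- jointly cartesian over `K` and `Eq_Y`.
  have hcart := (ElemFib.isJC_act w l.obj (⊤_ (p.Fiber (X ⨯ Y)))).isCart_snd
  have e13 : pr13 X Y = e ≫ prod.lift (prod.fst ≫ w) prod.snd := by ext <;> simp [pr13, e, w]
  have e24 : pr24 X Y = prod.lift (e ≫ y) z := by ext <;> simp [pr24, e, y, z]
  let k₁ : DHom e (l.box m) K := hcart.lift (l.boxProjFst m) e e13
  have hk₁ : k₁.hom ≫ (ElemFib.actSnd w l.obj _).hom = (l.boxProjFst m).hom := hcart.fac _ _ _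
  have hJC : IsJC k₁ (l.boxProjSnd m) := by
    constructor
    · intro W C h φ₁ φ₂
      let φ := (l.isJC_box m).lift h (φ₁.comp (ElemFib.actSnd w l.obj _)) φ₂ (by simp [e13]) rfl
      refine ⟨φ, hcart.ext (φ.comp k₁) φ₁ rfl ?_, by simp [φ]⟩
      simp [hk₁, φ]
    · intro W C h φ φ' e₁ e₂
      refine (l.isJC_box m).ext φ φ' rfl ?_ e₂
      rw [← hk₁, reassoc_of% e₁]
  have hd₁ : d ≫ e = 𝟙 _ := by ext <;> simp [d, e]
  have hd₂ : d ≫ z = y := by simp [d, z]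
  let j₂ : DHom d K (l.box m) := hJC.lift d (DHom.id K) (m.refl y K) hd₁.symm (by
    rw [e24]; ext <;> simp [dia, reassoc_of% hd₁, hd₂])
  have hj₂ : j₂.IsCoc := hm.isCoc hy hz hd₁ hd₂ e24 hJC j₂ (by simp [j₂]) (by simp [j₂])
  have eb : graph w ≫ d = dia (X ⨯ Y) := by
    refine Limits.prod.hom_ext (Limits.prod.hom_ext ?_ ?_) (Limits.prod.hom_ext ?_ ?_) <;>
      simp [d, dia, y, w]
  refine (hj₁.comp hj₂).congr eb ?_
  refine hJC.ext (j₁.comp j₂) (l.boxArrD m) eb ?_ ?_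
  · refine hcart.ext ((j₁.comp j₂).comp k₁) ((l.boxArrD m).comp k₁) (by rw [eb]) ?_
    simp only [DHom.comp_hom, Category.assoc, hk₁, boxArrD_fst]
    have hjk : j₂.hom ≫ k₁.hom = 𝟙 _ := hJC.lift_fst _ _ _ _ _
    rw [← hk₁, reassoc_of% hjk]
    exact (actPt_snd _ _).trans (l.comp_refl (toTopD (𝟙 _) _) (by simp [w]))
  · simp only [DHom.comp_hom, Category.assoc, boxArrD_snd, j₂, IsJC.lift_snd]
    exact m.comp_refl j₁ (by simp [y])

end Loop

/-- The point `δ_A` is cocartesian over the diagonal, of which `pr₂` is a retraction; the carrier is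
the identity of `A` descended along `δ_A`. -/
lemma exists_strictTransporter {l : ∀ X : B, Loop p X} (H : ∀ X, (l X).Univ) :
    ∃ T : ∀ X : B, StrictTransporter p X, ∀ X, (T X).toLoop = l X := by
  have h : ∀ X (A : p.Fiber X), ∃ t : DHom (prod.snd : X ⨯ X ⟶ X) ((l X).act A) A,
      ((l X).pointD A).hom ≫ t.hom = 𝟙 _ := fun X A =>
    ((H X).isCoc_pointD A).exists_desc (DHom.id A) prod.snd (prod.lift_snd _ _).symm
  choose t ht using h
  exact ⟨fun X => { l X with
    carrier := fun A => (t X A).hom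
    carrier_isHomLift := fun A => (t X A).lift
    strict := ht X }, fun X => rfl⟩

lemma strictlyProductive_of_univ {l : ∀ X : B, Loop p X} (H : ∀ X, (l X).Univ) :
    StrictlyProductive l := by
  intro X Y
  obtain ⟨χ, hχ⟩ := ((H X).isCoc_boxArrD (H Y)).exists_desc (l (X ⨯ Y)).arrD (𝟙 _) (by simp)
  exact ⟨χ.toFib, hχ⟩

/-- Strict productive transporters provide factorisations through `⟨1, refl⟩ : A ⟶ A ∧ Eq_X`. -/
lemma exists_desc_of_transporter (T : ∀ X : B, StrictTransporter p X)
    (hT : StrictlyProductive (fun X => (T X).toLoop)) {X U W Z : B} {w₁ : W ⟶ U} {w : W ⟶ X}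
    {e : Z ⟶ W} {z : Z ⟶ X} {d : W ⟶ Z} (hw : IsBinProd w₁ w) (hZ : IsBinProd e z)
    (hd₁ : d ≫ e = 𝟙 W) (hd₂ : d ≫ z = w) {A : p.Fiber W} {K : p.Fiber Z} {k₁ : DHom e K A}
    {k₂ : DHom (prod.lift (e ≫ w) z) K (T X).toLoop.obj} (j : DHom d A K)
    (hj₁ : j.hom ≫ k₁.hom = 𝟙 _) (hj₂ : j.hom ≫ k₂.hom = ((T X).toLoop.refl w A).hom)
    {G : p.Fiber Z} (ψ : DHom d A G) : ∃ χ : DHom (𝟙 Z) K G, j.hom ≫ χ.hom = ψ.hom := by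
  let l : ∀ X, Loop p X := fun X => (T X).toLoop
  -- Transporters are given for chosen products only, so `W` and `Z` are replaced by `V` and `V ⨯
  -- X`, and `G` by its reindexing `G₀`.
  let V := U ⨯ X
  let v : W ⟶ V := prod.lift w₁ w
  let v' : V ⟶ W := hw.lift prod.fst prod.snd
  have hv : v ≫ v' = 𝟙 _ := hw.hom_ext (by simp [v, v']) (by simp [v, v'])
  let ζ : Z ⟶ V ⨯ X := prod.lift (e ≫ v) z
  let ζ' : V ⨯ X ⟶ Z := hZ.lift (prod.fst ≫ v') prod.snd
  have hζ : ζ ≫ ζ' = 𝟙 _ := hZ.hom_ext (by simp [ζ, ζ', hv]) (by simp [ζ, ζ'])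
  let G₀ := (reindex p ζ').obj G
  have hc := DHom.cart_isCart ζ' G
  let ψ₀ : DHom (d ≫ ζ) A G₀ := hc.lift ψ (d ≫ ζ) (by simp [hζ])
  have hψ₀ : ψ₀.hom ≫ (DHom.cart ζ' G).hom = ψ.hom := hc.fac _ _ _
  obtain ⟨χ, hχ⟩ := hT V X
  have hχ' : ((l V).boxArrD (l X)).hom ≫ und χ = (l (V ⨯ X)).arr := hχ
  -- In elements, a path from `x` to `x'` is to be turned into a path from `(u, x, x)` to `(u, x,
  -- x')`: pair reflexivity at `(u, x)` with the given path and apply `χ`. The carrier of `G₀` then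
  -- moves `ψ₀ a` along it. At reflexivity, compatibility of `χ` with the loops and strictness of
  -- the carrier give back `ψ₀`.
  let f : Z ⟶ (V ⨯ X) ⨯ (V ⨯ X) := prod.lift (e ≫ d ≫ ζ) ζ
  let b : DHom f K ((l V).box (l X)) := ((l V).isJC_box (l X)).lift f
    ((l V).refl (e ≫ v) K) k₂
    (by ext <;> simp [f, pr13, dia, ζ, reassoc_of% hd₁])
    (by ext <;> simp [f, pr24, ζ, hd₂])
  let c : DHom f K ((l (V ⨯ X)).act G₀) := ((l (V ⨯ X)).isJC_act G₀).lift f (k₁.comp ψ₀)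
    (b.comp (DHom.ofFib χ)) (by simp [f]) (by simp)
  let t : DHom prod.snd ((l (V ⨯ X)).act G₀) G₀ :=
    ⟨(T (V ⨯ X)).carrier G₀, (T (V ⨯ X)).carrier_isHomLift G₀⟩
  have ht : ((l (V ⨯ X)).pointD G₀).hom ≫ t.hom = 𝟙 _ := (T (V ⨯ X)).strict G₀
  have hjb : j.hom ≫ b.hom =
      (toTopD (d ≫ ζ) A).hom ≫ ((l V).boxArrD (l X)).hom := by
    refine ((l V).isJC_box (l X)).ext (j.comp b) ((toTopD (d ≫ ζ) A).comp ((l V).boxArrD (l X)))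
      ?_ ?_ ?_
    · ext <;> simp [f, ζ, dia, reassoc_of% hd₁, hd₂]
    · simp only [DHom.comp_hom, Category.assoc, b, IsJC.lift_fst, Loop.boxArrD_fst]
      rw [(l V).comp_refl j (v := v) (by simp [reassoc_of% hd₁]),
        (l V).comp_refl (toTopD (d ≫ ζ) A) (v := v) (by simp [ζ, reassoc_of% hd₁])]
    · simp only [DHom.comp_hom, Category.assoc, b, IsJC.lift_snd, Loop.boxArrD_snd]
      rw [hj₂, (l X).comp_refl (toTopD (d ≫ ζ) A) (v := w) (by simp [ζ, hd₂])]
  have hjc : j.hom ≫ c.hom = ψ₀.hom ≫ ((l (V ⨯ X)).pointD G₀).hom := by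
    refine ((l (V ⨯ X)).isJC_act G₀).ext (j.comp c) (ψ₀.comp ((l (V ⨯ X)).pointD G₀)) ?_ ?_ ?_
    · refine Limits.prod.hom_ext ?_ ?_ <;> simp [f, dia, reassoc_of% hd₁]
    · simp [c, reassoc_of% hj₁]
    · simp only [DHom.comp_hom, Category.assoc, c, IsJC.lift_snd, Loop.pointD_snd, DHom.ofFib_hom]
      rw [reassoc_of% hjb, hχ', (l (V ⨯ X)).comp_refl ψ₀ (v := d ≫ ζ) (by simp)]
      rfl
  refine ⟨((c.comp t).comp (DHom.cart ζ' G)).cast (by simp [f, hζ]), ?_⟩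
  simp only [DHom.cast_hom, DHom.comp_hom, Category.assoc]
  rw [reassoc_of% hjc, reassoc_of% ht, hψ₀]

/-- The transporters give existence of vertical factorisations and fibred-epicness gives their
uniqueness. -/
lemma cocartOver_of_transporter (T : ∀ X : B, StrictTransporter p X)
    (hT : StrictlyProductive (fun X => (T X).toLoop)) {X : B}
    (H : ∀ {a b : E} (ψ : a ⟶ b), (T X).toLoop.BCFRClass ψ → fibEpic p ψ ∧ ParamDiag (p.map ψ))
    {a b : E} (ψ : a ⟶ b) (h : (T X).toLoop.BCFRClass ψ) : cocartOver p ParamDiag ψ := by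
  have hψ := H ψ h
  revert hψ
  refine Loop.bcfr_induction (motive := fun ψ => fibEpic p ψ ∧ ParamDiag (p.map ψ) →
    cocartOver p ParamDiag ψ) ?_ h
  intro U W Z w₁ w e z d hw hZ hd₁ hd₂ P A K k₁ k₂ j ψ i i' hK hj₁ hj₂ hi hi' hij hepi
  refine ψ.cocartOver_iff.2 ⟨DHom.isCoc_of_vertical ψ (fun G ξ => ?_) (fun G χ χ' hχ => ?_), U, X,
    w₁, w, e, z, hw, hZ, hd₁, hd₂⟩
  · obtain ⟨χ, hχ⟩ := exists_desc_of_transporter T hT hw hZ hd₁ hd₂ j hj₁ hj₂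
      ((i'.comp ξ).cast (by simp))
    refine ⟨χ, ?_⟩
    rw [← hij, Category.assoc, hχ, DHom.cast_hom, DHom.comp_hom, reassoc_of% hi]
  · exact hepi.1 _ _ (map_eq_map_of_isHomLift (𝟙 Z) _ _) hχ

end

/-! ### Lifts, product-stability and pairability from universal loops -/

/-- `V × (W × X)` as `(V × W) × X`. -/
lemma IsBinProd.prod_lift {V X W Z VW VZ : B} {z₁ : Z ⟶ W} {z₂ : Z ⟶ X} {b₁ : VW ⟶ V}
    {b₂ : VW ⟶ W} {d₁ : VZ ⟶ V} {d₂ : VZ ⟶ Z} (hz : IsBinProd z₁ z₂) (hb : IsBinProd b₁ b₂)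
    (hd : IsBinProd d₁ d₂) : IsBinProd (hb.lift d₁ (d₂ ≫ z₁)) (d₂ ≫ z₂) := by
  refine isBinProd_of (fun f g => ⟨hd.lift (f ≫ b₁) (hz.lift (f ≫ b₂) g), ?_, ?_⟩)
    (fun f g e₁ e₂ => ?_)
  · refine hb.hom_ext ?_ ?_ <;> simp
  · simp
  · have e₃ := congrArg (· ≫ b₁) e₁
    have e₄ := congrArg (· ≫ b₂) e₁
    exact hd.hom_ext (by simpa using e₃) (hz.hom_ext (by simpa using e₄) (by simpa using e₂))

section

variable [HasFiniteProducts B]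

/-- `V × (Y × X)` as `(V × Y) × X`. -/
lemma IsBinProd.prod_left {V Y X W VW : B} {w₁ : W ⟶ Y} {w₂ : W ⟶ X} {b₁ : VW ⟶ V} {b₂ : VW ⟶ W}
    (hw : IsBinProd w₁ w₂) (hb : IsBinProd b₁ b₂) :
    IsBinProd (prod.lift b₁ (b₂ ≫ w₁)) (b₂ ≫ w₂) := by
  refine isBinProd_of (fun f g => ⟨hb.lift (f ≫ prod.fst) (hw.lift (f ≫ prod.snd) g), ?_, ?_⟩)
    (fun f g e₁ e₂ => ?_)
  · ext <;> simp
  · simp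
  · have e₃ := congrArg (· ≫ prod.fst) e₁
    have e₄ := congrArg (· ≫ prod.snd) e₁
    exact hb.hom_ext (by simpa using e₃) (hw.hom_ext (by simpa using e₄) (by simpa using e₂))

variable [p.IsFibered] [HasFibredProducts p]

lemma hasCocartLifts_of_univ {l : ∀ X : B, Loop p X} (H : ∀ X, (l X).Univ) :
    HasCocartLifts p (ParamDiag (C := B)) := by
  rintro W Z d ⟨Y, X, w₁, w, e, z, hw, hZ, hd₁, hd₂⟩ A
  have hK := isJC_jc e (prod.lift (e ≫ w) z) A (l X).obj
  let j := hK.lift d (DHom.id A) ((l X).refl w A) hd₁.symm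
    (by ext <;> simp [dia, reassoc_of% hd₁, hd₂])
  exact ⟨_, j.hom, (H X).isCoc hw hZ hd₁ hd₂ rfl hK j (by simp [j]) (by simp [j])⟩

/-- The codomain of a cocartesian arrow `A ⟶ D` over a parametrised diagonal is `A ∧ Eq_X`. -/
lemma Loop.Univ.exists_isJC {X : B} {l : Loop p X} (H : l.Univ) {U W Z : B} {w₁ : W ⟶ U} {w : W ⟶ X}
    (hw : IsBinProd w₁ w) {e : Z ⟶ W} {z : Z ⟶ X} (hZ : IsBinProd e z) {d : W ⟶ Z}
    (hd₁ : d ≫ e = 𝟙 W) (hd₂ : d ≫ z = w) {A : p.Fiber W} {D : p.Fiber Z} {φ : DHom d A D}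
    (hφ : φ.IsCoc) : ∃ (k₁ : DHom e D A) (k₂ : DHom (prod.lift (e ≫ w) z) D l.obj), IsJC k₁ k₂ ∧
      φ.hom ≫ k₁.hom = 𝟙 _ ∧ φ.hom ≫ k₂.hom = (l.refl w A).hom := by
  have hd : w ≫ dia X = d ≫ prod.lift (e ≫ w) z := by ext <;> simp [dia, reassoc_of% hd₁, hd₂]
  have hK := isJC_jc e (prod.lift (e ≫ w) z) A l.obj
  let j := hK.lift d (DHom.id A) (l.refl w A) hd₁.symm hd
  have hj : j.IsCoc := H.isCoc hw hZ hd₁ hd₂ rfl hK j (by simp [j]) (by simp [j])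
  -- `φ` and `⟨1, refl⟩` are cocartesian over the same arrow with the same source, so their
  -- codomains are isomorphic; the projections are carried over to `D`.
  let κ := hφ.desc j (𝟙 Z) (by simp)
  let κ' := hj.desc φ (𝟙 Z) (by simp)
  have h₁ : κ.hom ≫ κ'.hom = 𝟙 _ := hφ.ext (κ.comp κ') (DHom.id D) (by simp) (by simp [κ, κ'])
  have h₂ : κ'.hom ≫ κ.hom = 𝟙 _ := hj.ext (κ'.comp κ) (DHom.id _) (by simp) (by simp [κ, κ'])
  refine ⟨(κ.comp (jcFst _ _ A l.obj)).cast (by simp), (κ.comp (jcSnd _ _ A l.obj)).cast (by simp),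
    ?_, ?_, ?_⟩
  · exact hK.pullback (β := κ) (α := DHom.id A) (DHom.isCart_of_inv κ κ' h₁ h₂)
      (DHom.isCart_of_inv (DHom.id A) (DHom.id A) (by simp) (by simp)) (by simp) (by simp)
      (by simp) (by simp)
  · simp [κ, j]
  · simp [κ, j]

/-- The codomain `D` is jointly cartesian over `A` and `Eq_S`. This passes to the reindexing `D'`,
with `A'` in place of `A`, and `φ'` has components identity and reflexivity, so universality applies
to it. -/
lemma productStable_of_univ {l : ∀ X : B, Loop p X} (H : ∀ X, (l X).Univ) :
    ProductStable p ParamDiag (cocartOver p ParamDiag) := by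
  intro U V Y X g f hf UY VY UX VX a₁ a₂ b₁ b₂ c₁ c₂ d₁ d₂ ha hb hc hd gY gX Uf Vf hgY hgX hUf hVf
    A' A D' D φ' φ α β hφ' hφ hα hβ comm hΦ
  obtain ⟨T, S, y₁, y₂, x₁, x₂, hy, hx, hf₁, hf₂⟩ := hf
  -- If `f` is the diagonal of `S` with parameter `T`, then `V × f` is the diagonal of `S` with
  -- parameter `V × T`; `eV` and `eU` are the corresponding projections `⟨1,2⟩`.
  let eV := hb.lift d₁ (d₂ ≫ x₁)
  let eU := ha.lift c₁ (c₂ ≫ x₁)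
  have hwV := hy.prod_left hb
  have hwU := hy.prod_left ha
  have hzV : IsBinProd eV (d₂ ≫ x₂) := hx.prod_lift hb hd
  have hzU : IsBinProd eU (c₂ ≫ x₂) := hx.prod_lift ha hc
  obtain ⟨hgY₁, hgY₂⟩ := hgY
  obtain ⟨hgX₁, hgX₂⟩ := hgX
  obtain ⟨hUf₁, hUf₂⟩ := hUf
  obtain ⟨hVf₁, hVf₂⟩ := hVf
  rw [Category.comp_id] at hgY₂ hgX₂ hUf₁ hVf₁
  have hdV₁ : Vf ≫ eV = 𝟙 _ := hb.hom_ext (by simp [eV, hVf₁])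
    (by simp [eV, reassoc_of% hVf₂, hf₁])
  have hdV₂ : Vf ≫ d₂ ≫ x₂ = b₂ ≫ y₂ := by rw [reassoc_of% hVf₂, hf₂]
  have hdU₁ : Uf ≫ eU = 𝟙 _ := ha.hom_ext (by simp [eU, hUf₁])
    (by simp [eU, reassoc_of% hUf₂, hf₁])
  have hdU₂ : Uf ≫ c₂ ≫ x₂ = a₂ ≫ y₂ := by rw [reassoc_of% hUf₂, hf₂]
  have hsq : eU ≫ gY = gX ≫ eV := hb.hom_ext (by simp [eU, eV, hgY₁, hgX₁])
    (by simp [eU, eV, hgY₂, reassoc_of% hgX₂])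
  let A'F : p.Fiber UY := Fiber.mk (IsHomLift.domain_eq p Uf φ')
  let D'F : p.Fiber UX := Fiber.mk (IsHomLift.codomain_eq p Uf φ')
  let AF : p.Fiber VY := Fiber.mk (IsHomLift.domain_eq p Vf φ)
  let DF : p.Fiber VX := Fiber.mk (IsHomLift.codomain_eq p Vf φ)
  let φD : DHom Vf AF DF := ⟨φ, hφ⟩
  let φD' : DHom Uf A'F D'F := ⟨φ', hφ'⟩
  let αD : DHom gY A'F AF := ⟨α, hα.toIsHomLift⟩
  let βD : DHom gX D'F DF := ⟨β, hβ.toIsHomLift⟩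
  have hαD : αD.IsCart := hα
  have hβD : βD.IsCart := hβ
  have hcomm : αD.hom ≫ φD.hom = φD'.hom ≫ βD.hom := comm
  obtain ⟨k₁, k₂, hK, hk₁, hk₂⟩ := (H S).exists_isJC hwV hzV hdV₁ hdV₂ (φD.cocartOver_iff.1 hΦ).1
  let k₁' : DHom eU D'F A'F := hαD.lift (βD.comp k₁) eU hsq.symm
  have hk₁' : k₁'.hom ≫ αD.hom = βD.hom ≫ k₁.hom := hαD.fac _ _ _
  have hb' : gX ≫ prod.lift (eV ≫ b₂ ≫ y₂) (d₂ ≫ x₂) =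
      prod.lift (eU ≫ a₂ ≫ y₂) (c₂ ≫ x₂) := by
    ext <;> simp [reassoc_of% hgX₂, ← reassoc_of% hsq, reassoc_of% hgY₂]
  have hJ : IsJC k₁' ((βD.comp k₂).cast hb') :=
    hK.pullback hβD hαD hsq hb'.symm hk₁' rfl
  refine φD'.cocartOver_iff.2 ⟨?_, _, S, _, a₂ ≫ y₂, eU, c₂ ≫ x₂, hwU, hzU, hdU₁, hdU₂⟩
  refine (H S).isCoc hwU hzU hdU₁ hdU₂ rfl hJ φD' ?_ ?_
  · refine hαD.ext (φD'.comp k₁') (DHom.id _) hdU₁ ?_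
    rw [DHom.comp_hom, Category.assoc, hk₁', ← reassoc_of% hcomm, hk₁]
    simp
  · rw [DHom.cast_hom, DHom.comp_hom, ← reassoc_of% hcomm, hk₂]
    exact (l S).comp_refl αD (by simp [reassoc_of% hgY₂])

namespace Loop

variable {X : B} {l : Loop p X}

lemma Univ.isCoc_arrD (H : l.Univ) : l.arrD.IsCoc := by
  -- `Eq_X` itself serves as `⊤_X ∧ Eq_X`, which makes `δ_X` the instance of `⟨1, refl⟩` with
  -- trivial parameter and `A = ⊤_X`.
  have hJ : IsJC (toTopD (prod.fst : X ⨯ X ⟶ X) l.obj) (DHom.id l.obj) := by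
    constructor
    · intro W C h φ₁ φ₂
      exact ⟨φ₂.cast (by simp), top_ext ((φ₂.cast (by simp)).comp (toTopD _ _)) φ₁ rfl, by simp⟩
    · intro W C h φ φ' _ e
      simpa using e
  refine H.isCoc (IsBinProd.of_terminal X) (IsBinProd.of_prod X X) (prod.lift_fst _ _)
    (prod.lift_snd _ _) (by ext <;> simp) hJ l.arrD
    (top_ext (l.arrD.comp (toTopD (prod.fst : X ⨯ X ⟶ X) l.obj)) (DHom.id _)
      (prod.lift_fst _ _)) ?_
  rw [DHom.id_hom, Category.comp_id, refl, DHom.comp_hom, top_ext (toTopD (𝟙 X) _) (DHom.id _) rfl,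
    DHom.id_hom, Category.id_comp]

/-- The symmetry `Eq_X ⟶ Eq_X`. -/
noncomputable def Univ.symm (H : l.Univ) : DHom (prod.lift prod.snd prod.fst) l.obj l.obj :=
  H.isCoc_arrD.desc l.arrD _ (by ext <;> simp [dia])

lemma Univ.arr_symm (H : l.Univ) : l.arr ≫ H.symm.hom = l.arr :=
  H.isCoc_arrD.fac _ _ _

@[simp]
lemma Univ.symm_symm (H : l.Univ) : H.symm.hom ≫ H.symm.hom = 𝟙 _ :=
  H.isCoc_arrD.ext (H.symm.comp H.symm) (DHom.id _) (by ext <;> simp)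
    (by simp [H.arr_symm, reassoc_of% H.arr_symm])

lemma Univ.refl_symm (H : l.Univ) {W : B} (w : W ⟶ X) (A : p.Fiber W) :
    (l.refl w A).hom ≫ H.symm.hom = (l.refl w A).hom := by
  simp [refl, H.arr_symm]

/-- Transport along `Eq_X`: from an element of `A` at `f` and an element of `Eq_X` between the
values of `f` and `f'` in `X`, one gets an element of `A` at `f'`. -/
lemma Univ.exists_transport (H : l.Univ) {U W : B} {w₁ : W ⟶ U} {w : W ⟶ X} (hw : IsBinProd w₁ w)
    (A : p.Fiber W) :
    ∃ tr : ∀ {V : B} {C : p.Fiber V} (f f' : V ⟶ W) {h : V ⟶ X ⨯ X}, DHom f C A →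
        DHom h C l.obj → f ≫ w₁ = f' ≫ w₁ → h = prod.lift (f ≫ w) (f' ≫ w) → DHom f' C A,
      (∀ {V : B} {C : p.Fiber V} (f f' : V ⟶ W) {h : V ⟶ X ⨯ X} (a : DHom f C A)
        (q : DHom h C l.obj) (e₁ : f ≫ w₁ = f' ≫ w₁) (e₂ : h = prod.lift (f ≫ w) (f' ≫ w)),
        f = f' → q.hom = (l.refl (f ≫ w) C).hom → (tr f f' a q e₁ e₂).hom = a.hom) ∧
      (∀ {V V' : B} {C : p.Fiber V} {C' : p.Fiber V'} (f f' : V ⟶ W) (g g' : V' ⟶ W)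
        {h : V ⟶ X ⨯ X} {k : V' ⟶ X ⨯ X} {v : V' ⟶ V} (c : DHom v C' C) (a : DHom f C A)
        (q : DHom h C l.obj) (a' : DHom g C' A) (q' : DHom k C' l.obj)
        (e₁ : f ≫ w₁ = f' ≫ w₁) (e₂ : h = prod.lift (f ≫ w) (f' ≫ w))
        (e₁' : g ≫ w₁ = g' ≫ w₁) (e₂' : k = prod.lift (g ≫ w) (g' ≫ w)),
        g = v ≫ f → g' = v ≫ f' → a'.hom = c.hom ≫ a.hom → q'.hom = c.hom ≫ q.hom →
        (tr g g' a' q' e₁' e₂').hom = c.hom ≫ (tr f f' a q e₁ e₂).hom) ∧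
      (∀ {V : B} {C : p.Fiber V} (f f' : V ⟶ W) {h k : V ⟶ X ⨯ X} (a : DHom f C A)
        (q : DHom h C l.obj) (q' : DHom k C l.obj) (e₁ : f ≫ w₁ = f' ≫ w₁)
        (e₂ : h = prod.lift (f ≫ w) (f' ≫ w)) (e₁' : f' ≫ w₁ = f ≫ w₁)
        (e₂' : k = prod.lift (f' ≫ w) (f ≫ w)), q'.hom = q.hom ≫ H.symm.hom →
        (tr f' f (tr f f' a q e₁ e₂) q' e₁' e₂').hom = a.hom) := by
  -- Transport is the first component of the involution `(a, e) ↦ (t(a, e), e⁻¹)`. The second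
  -- component agrees with the symmetry of `Eq_X`, so transport along a path and then along its
  -- inverse is the involution applied twice.
  let r := l.refl w (⊤_ (p.Fiber W))
  have hr : UnivAt w r := H hw
  have hJ := ElemFib.isJC_act w l.obj A
  let s := actSwap hw hr A
  have hs : s.hom ≫ (ElemFib.actSnd w l.obj A).hom =
      (ElemFib.actSnd w l.obj A).hom ≫ H.symm.hom := by
    refine (hr.isCoc_actPt A).ext (s.comp (ElemFib.actSnd w l.obj A))
      ((ElemFib.actSnd w l.obj A).comp H.symm) (by ext <;> simp) ?_
    have h : (toTopD (𝟙 W) A).hom ≫ r.hom = (l.refl w A).hom :=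
      l.comp_refl (toTopD (𝟙 W) A) (by simp)
    simp [s, reassoc_of% h, h, H.refl_symm]
  have hss : s.hom ≫ s.hom = 𝟙 _ := actSwap_swap hw hr A
  let elt : ∀ {V : B} {C : p.Fiber V} (f f' : V ⟶ W) {h : V ⟶ X ⨯ X} (a : DHom f C A)
      (q : DHom h C l.obj), h = prod.lift (f ≫ w) (f' ≫ w) →
      DHom (prod.lift f (f' ≫ w)) C (ElemFib.act w l.obj A) := fun f f' _ a q e₂ =>
    hJ.lift (prod.lift f (f' ≫ w)) a q (by simp) (by simp [e₂])
  refine ⟨fun f f' _ a q e₁ e₂ => (((elt f f' a q e₂).comp s).comp (ElemFib.actFst w l.obj A)).cast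
    (hw.hom_ext (by simp [e₁]) (by simp)), ?_, ?_, ?_⟩
  · intro V C f f' h a q e₁ e₂ e₃ hq
    subst e₃
    have : (elt f f a q e₂).hom = a.hom ≫ (actPt r A).hom := by
      refine hJ.ext (elt f f a q e₂) (a.comp (actPt r A)) (by ext <;> simp) (by simp [elt]) ?_
      have h : (toTopD (𝟙 W) A).hom ≫ r.hom = (l.refl w A).hom :=
        l.comp_refl (toTopD (𝟙 W) A) (by simp)
      simp only [elt, IsJC.lift_snd, hq, DHom.comp_hom, Category.assoc, actPt_snd, h]
      exact (l.comp_refl a rfl).symm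
    simp [this, s]
  · intro V V' C C' f f' g g' h k v c a q a' q' e₁ e₂ e₁' e₂' hg hg' ha hq
    have : (elt g g' a' q' e₂').hom = c.hom ≫ (elt f f' a q e₂).hom := by
      refine hJ.ext (elt g g' a' q' e₂') (c.comp (elt f f' a q e₂)) ?_ ?_ ?_
      · ext <;> simp [hg, hg']
      · simp [elt, ha]
      · simp [elt, hq]
    simp [this]
  · intro V C f f' h k a q q' e₁ e₂ e₁' e₂' hq
    have : (elt f' f (((((elt f f' a q e₂).comp s).comp (ElemFib.actFst w l.obj A)).cast
        (hw.hom_ext (by simp [e₁]) (by simp)) : DHom f' C A)) q' e₂').hom =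
        (elt f f' a q e₂).hom ≫ s.hom := by
      refine hJ.ext (elt f' f _ q' e₂') ((elt f f' a q e₂).comp s) ?_ (by simp [elt]) ?_
      · refine Limits.prod.hom_ext (hw.hom_ext ?_ ?_) ?_ <;> simp [e₁]
      · simp [elt, hs, hq]
    simp only [DHom.cast_hom, DHom.comp_hom, this, Category.assoc, reassoc_of% hss]
    simp [elt]

end Loop

/-- With `D` identified with `A ∧ Eq_X`, an element of `Q` is `((a, e), c)`, with `c` at the far end
of the path `e`. Transport along `e⁻¹` brings `c` to the diagonal, where an element of `C` is an
element of `C'` because `ψ` is cartesian. This gives `Q ≅ P ∧ Eq_X`, an isomorphism that carries `χ`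
to `⟨1, refl⟩`. -/
lemma pairable_of_univ {l : ∀ X : B, Loop p X} (H : ∀ X, (l X).Univ) :
    Pairable p (cocartOver p ParamDiag) := by
  intro W Z d A C' P D C Q φ ψ π₁ π₂ π₁' π₂' χ hφ hψ hP hQ hχ h₁ h₂ hΦ
  let φD : DHom d A D := ⟨φ, hφ⟩
  let ψD : DHom d C' C := ⟨ψ, inferInstance⟩
  have hψD : ψD.IsCart := hψ
  let χD : DHom d P Q := ⟨χ, hχ⟩
  have hχ₁ : χD.hom ≫ und π₁' = und π₁ ≫ φD.hom := h₁
  have hχ₂ : χD.hom ≫ und π₂' = und π₂ ≫ ψD.hom := h₂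
  obtain ⟨hφc, hd⟩ := φD.cocartOver_iff.1 hΦ
  refine χD.cocartOver_iff.2 ⟨?_, hd⟩
  obtain ⟨Y, X, w₁, w, e, z, hw, hZ, hd₁, hd₂⟩ := hd
  obtain ⟨k₁, k₂, hK, hk₁, hk₂⟩ := (H X).exists_isJC hw hZ hd₁ hd₂ hφc
  obtain ⟨tr, tr_refl, tr_nat, tr_symm⟩ := (H X).exists_transport hZ C
  have hrefl : ((l X).refl w P).hom = ((l X).refl (d ≫ z) P).hom := by
    simpa using (l X).comp_refl (w := w) (DHom.id P) (v := d ≫ z) (by simp [hd₂])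
  have hPJ := isJC_of_isBinProd hP
  have hQJ := isJC_of_isBinProd hQ
  have hL := isJC_jc e (prod.lift (e ≫ w) z) P (l X).obj
  let l₁ := jcFst e (prod.lift (e ≫ w) z) P (l X).obj
  let l₂ := jcSnd e (prod.lift (e ≫ w) z) P (l X).obj
  let j := hL.lift d (DHom.id P) ((l X).refl w P) hd₁.symm
    (by ext <;> simp [dia, reassoc_of% hd₁, hd₂])
  have hj₁ : j.hom ≫ l₁.hom = 𝟙 _ := hL.lift_fst _ _ _ _ _
  have hj₂ : j.hom ≫ l₂.hom = ((l X).refl w P).hom := hL.lift_snd _ _ _ _ _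
  have hj : j.IsCoc := (H X).isCoc hw hZ hd₁ hd₂ rfl hL j hj₁ hj₂
  let q := ((DHom.ofFib π₁').comp k₂)
  let q' := q.comp (H X).symm
  have hχq : χD.hom ≫ q.hom = ((l X).refl w P).hom := by
    simp only [q, DHom.comp_hom, DHom.ofFib_hom, reassoc_of% hχ₁, hk₂]
    exact (l X).comp_refl (DHom.ofFib π₁) (by simp)
  -- `c` transported along the inverse path `q'`, from `(y, x, x')` back to `(y, x, x)`.
  let v : DHom (e ≫ d) Q C := tr (𝟙 Z) (e ≫ d) (DHom.ofFib π₂') q' (by simp [hd₁])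
    (by ext <;> simp [hd₂])
  have hχv : χD.hom ≫ v.hom = und π₂ ≫ ψD.hom := by
    rw [← hχ₂]
    have := tr_nat (𝟙 Z) (e ≫ d) d d χD (DHom.ofFib π₂') q'
      ((χD.comp (DHom.ofFib π₂')).cast (by simp)) (((l X).refl w P).cast rfl) (by simp [hd₁])
      (by ext <;> simp [hd₂]) rfl (by ext <;> simp [dia, hd₂]) (by simp) (by simp [reassoc_of% hd₁])
      (by simp) (by simp [q', reassoc_of% hχq, (H X).refl_symm])
    exact this.symm.trans (tr_refl _ _ _ _ _ _ rfl hrefl)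
  let ρ : DHom (𝟙 Z) Q (jcObj e (prod.lift (e ≫ w) z) P (l X).obj) := hL.lift (𝟙 Z)
    (hPJ.lift e ((DHom.ofFib π₁').comp k₁) (hψD.lift v e rfl) (by simp) (by simp)) q
    (by simp) (by simp)
  have hρ₁ : ρ.hom ≫ l₁.hom ≫ und π₁ = und π₁' ≫ k₁.hom := by
    rw [hL.lift_fst_assoc]; exact hPJ.lift_fst _ _ _ _ _
  have hρ₂ : ρ.hom ≫ l₁.hom ≫ und π₂ ≫ ψD.hom = v.hom := by
    rw [hL.lift_fst_assoc]
    exact (hPJ.lift_snd_assoc _ _ _ _ _ _).trans (hψD.fac _ _ _)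
  have hρ₃ : ρ.hom ≫ l₂.hom = q.hom := hL.lift_snd _ _ _ _ _
  have hχρ : χD.hom ≫ ρ.hom = j.hom := by
    refine hL.ext (χD.comp ρ) j (by simp) ?_ ?_
    · refine hPJ.ext ((χD.comp ρ).comp l₁) (j.comp l₁) (by simp) ?_ ?_
      · simp only [DHom.comp_hom, Category.assoc, DHom.ofFib_hom, hρ₁, reassoc_of% hχ₁, hk₁,
          reassoc_of% hj₁, Category.comp_id]
      · refine hψD.ext (((χD.comp ρ).comp l₁).comp (DHom.ofFib π₂))
          ((j.comp l₁).comp (DHom.ofFib π₂)) (by simp) ?_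
        simp only [DHom.comp_hom, Category.assoc, DHom.ofFib_hom, hρ₂, hχv, reassoc_of% hj₁]
    · exact ((Category.assoc _ _ _).trans (by rw [hρ₃, hχq])).trans hj₂.symm
  let φr := hj.desc χD (𝟙 Z) (by simp)
  have hφr : j.hom ≫ φr.hom = χD.hom := hj.fac _ _ _
  have hr₁ : φr.hom ≫ und π₁' ≫ k₁.hom = l₁.hom ≫ und π₁ := by
    refine hj.ext (φr.comp ((DHom.ofFib π₁').comp k₁)) (l₁.comp (DHom.ofFib π₁)) (by simp) ?_
    simp only [DHom.comp_hom, DHom.ofFib_hom, reassoc_of% hφr, reassoc_of% hχ₁, hk₁,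
      reassoc_of% hj₁, Category.comp_id]
  have hr₂ : φr.hom ≫ und π₁' ≫ k₂.hom = l₂.hom := by
    refine hj.ext (φr.comp ((DHom.ofFib π₁').comp k₂)) l₂ (by simp) ?_
    rw [hj₂, ← hχq]
    simp only [DHom.comp_hom, DHom.ofFib_hom, reassoc_of% hφr, q]
  let b : DHom (e ≫ d) (jcObj e (prod.lift (e ≫ w) z) P (l X).obj) C :=
    (l₁.comp ((DHom.ofFib π₂).comp ψD)).cast (by simp)
  have eb₁ : (e ≫ d) ≫ e = 𝟙 Z ≫ e := by simp [hd₁]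
  have eb₂ : prod.lift (e ≫ w) z = prod.lift ((e ≫ d) ≫ z) (𝟙 Z ≫ z) := by simp [hd₂]
  -- The inverse `φr` transports the element of `C` forward along the path: both sides agree at
  -- reflexivity, and `j` is cocartesian.
  have hr₃ : φr.hom ≫ und π₂' = (tr (e ≫ d) (𝟙 Z) b l₂ eb₁ eb₂).hom := by
    refine hj.ext (φr.comp (DHom.ofFib π₂')) (tr (e ≫ d) (𝟙 Z) b l₂ eb₁ eb₂) (by simp) ?_
    rw [← tr_nat (e ≫ d) (𝟙 Z) d d j b l₂ (((DHom.ofFib π₂).comp ψD).cast (by simp))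
      ((l X).refl w P) eb₁ eb₂ rfl (by ext <;> simp [dia, hd₂]) (by simp [reassoc_of% hd₁])
      (by simp) (by simp [b, reassoc_of% hj₁]) hj₂.symm,
      tr_refl _ _ _ _ _ _ rfl hrefl]
    simp only [DHom.comp_hom, DHom.ofFib_hom, reassoc_of% hφr, hχ₂, DHom.cast_hom]
  have hρφ : ρ.hom ≫ φr.hom = 𝟙 _ := by
    refine hQJ.ext (ρ.comp φr) (DHom.id Q) (by simp) ?_ ?_
    · refine hK.ext ((ρ.comp φr).comp (DHom.ofFib π₁')) ((DHom.id Q).comp (DHom.ofFib π₁'))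
        (by simp) ?_ ?_
      · simp only [DHom.comp_hom, DHom.ofFib_hom, Category.assoc, hr₁, hρ₁, DHom.id_hom,
          Category.id_comp]
      · simp only [DHom.comp_hom, DHom.ofFib_hom, Category.assoc, hr₂, hρ₃, DHom.id_hom,
          Category.id_comp, q]
    · simp only [DHom.comp_hom, DHom.ofFib_hom, Category.assoc, hr₃, DHom.id_hom, Category.id_comp]
      have hq : q.hom = q'.hom ≫ (H X).symm.hom := by simp [q']
      rw [← tr_nat (e ≫ d) (𝟙 Z) (e ≫ d) (𝟙 Z) ρ b l₂ v q eb₁ eb₂ eb₁ (by simp [hd₂])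
        (Category.id_comp _).symm (Category.id_comp _).symm
        (by simp only [b, DHom.cast_hom, DHom.comp_hom, DHom.ofFib_hom, hρ₂]) hρ₃.symm]
      -- Back along `q'` and forth along its symmetric `q` is the identity.
      exact tr_symm (𝟙 Z) (e ≫ d) (DHom.ofFib π₂') q' q _ _ _ _ hq
  have hφρ : φr.hom ≫ ρ.hom = 𝟙 _ :=
    hj.ext (φr.comp ρ) (DHom.id _) (by simp) (by simp [reassoc_of% hφr, hχρ])
  exact (hj.comp (DHom.isCoc_of_inv φr ρ hφρ hρφ)).congr (by simp) hφr

end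

/-! ### Frobenius reciprocity and the Beck–Chevalley condition -/

/-- The comparison between two cocartesian arrows is invertible. -/
lemma DHom.IsCoc.isIso_of_comp {X Y : B} {f : X ⟶ Y} {A : p.Fiber X} {D D' : p.Fiber Y}
    {φ : DHom f A D} {ψ : DHom f A D'} (hφ : φ.IsCoc) (hψ : ψ.IsCoc) {χ : D ⟶ D'}
    (h : φ.hom ≫ und χ = ψ.hom) : IsIso χ := by
  let κ := hψ.desc φ (𝟙 Y) (by simp)
  have hκ : ψ.hom ≫ κ.hom = φ.hom := hψ.fac _ _ _
  refine ⟨κ.toFib, und_ext ?_, und_ext ?_⟩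
  · exact hφ.ext ((DHom.ofFib χ).comp κ) (DHom.id D) (by simp) (by simp [reassoc_of% h, hκ])
  · exact hψ.ext (κ.comp (DHom.ofFib χ)) (DHom.id D') (by simp) (by simp [reassoc_of% hκ, h])

section

variable [p.IsFibered]

lemma reindexSq_cart {W X Y Z : B} {a : W ⟶ X} {b : X ⟶ Z} {c : W ⟶ Y} {d : Y ⟶ Z}
    (w : a ≫ b = c ≫ d) (D : p.Fiber Z) :
    und (reindexSq p w D) ≫ (DHom.cart a _).hom ≫ (DHom.cart b D).hom =
      (DHom.cart c _).hom ≫ (DHom.cart d D).hom := by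
  have h : und (reindexSq p w D) ≫ (DHom.cart a _).hom =
      cartLift p (g := a) (f := b) (h := c ≫ d) w.symm D (cart p c _ ≫ cart p d D) :=
    cartLift_cart p (g := 𝟙 W) (f := a) (h := a) (by simp) _ _
  rw [reassoc_of% h]
  exact cartLift_cart p _ _ _

/-- Exhibits the unit followed by the Beck–Chevalley map as a reindexing of the other unit, in the
form required by product-stability. -/
lemma unitArr_beckChevalley {W X Y Z : B} {a : W ⟶ X} {b : X ⟶ Z} {c : W ⟶ Y} {d : Y ⟶ Z}
    (w : a ≫ b = c ≫ d) {L : p.Fiber W ⥤ p.Fiber X} {L' : p.Fiber Y ⥤ p.Fiber Z}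
    (adj : L ⊣ reindex p a) (adj' : L' ⊣ reindex p d) (A : p.Fiber Y) :
    ((unitArr adj ((reindex p c).obj A)).hom ≫ und (beckChevalley p w adj adj' A)) ≫
      (DHom.cart b _).hom = (DHom.cart c A).hom ≫ (unitArr adj' A).hom := by
  rw [beckChevalley, unitArr_comp, Equiv.apply_symm_apply, und_comp, Category.assoc,
    Category.assoc, reindexSq_cart, ← Category.assoc]
  exact (congrArg (· ≫ (DHom.cart d _).hom) (reindex_map_cart c (adj'.unit.app A))).trans
    (Category.assoc _ _ _)

variable [HasFibredProducts p]

/-- Together with `unitArr_frobenius_snd`, exhibits the unit followed by the Frobenius map as the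
pairing of a unit with a cartesian lift, in the form required by pairability. -/
lemma unitArr_frobenius_fst {X Y : B} {f : X ⟶ Y} {L : p.Fiber X ⥤ p.Fiber Y}
    (adj : L ⊣ reindex p f) (D : p.Fiber Y) (A : p.Fiber X) :
    ((unitArr adj ((reindex p f).obj D ⨯ A)).hom ≫ und (frobenius p adj D A)) ≫ und prod.fst =
      und prod.fst ≫ (DHom.cart f D).hom := by
  rw [Category.assoc, ← und_comp, frobenius, prod.lift_fst, ← Adjunction.homEquiv_counit,
    unitArr_comp, Equiv.apply_symm_apply]

lemma unitArr_frobenius_snd {X Y : B} {f : X ⟶ Y} {L : p.Fiber X ⥤ p.Fiber Y}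
    (adj : L ⊣ reindex p f) (D : p.Fiber Y) (A : p.Fiber X) :
    ((unitArr adj ((reindex p f).obj D ⨯ A)).hom ≫ und (frobenius p adj D A)) ≫ und prod.snd =
      und prod.snd ≫ (unitArr adj A).hom := by
  rw [Category.assoc, ← und_comp, frobenius, prod.lift_snd, unitArr_naturality]

variable [HasFiniteProducts B]

/-- A vertical arrow is invertible as soon as it carries one cocartesian arrow to another over the
same base arrow. The units are cocartesian, and their composites with the two canonical maps are so
by pairability and product-stability. -/
lemma isElementary_of_univ {l : ∀ X : B, Loop p X} (H : ∀ X, (l X).Univ) : IsElementary p := by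
  have h : ∀ Y X : B, ∃ adj : eqFunctor Y (l X).obj ⊣ reindex p (pdia Y X), True := fun Y X =>
    ((H X).exists_adjunction Y).imp fun _ _ => trivial
  choose adj _ using h
  refine ⟨_, adj, fun Y X A D => ?_, fun Y Z X f A => ?_⟩
  · let n : DHom (pdia Y X) _ _ := ((unitArr (adj Y X) ((reindex p (pdia Y X)).obj D ⨯ A)).comp
      (DHom.ofFib (frobenius p (adj Y X) D A))).cast (by simp)
    refine (unitArr_isCoc (adj Y X) _).isIso_of_comp (ψ := n) ?_ rfl
    refine (n.cocartOver_iff (Θ := ParamDiag).1 ?_).1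
    exact pairable_of_univ H (pdia Y X) (unitArr (adj Y X) A).hom (DHom.cart (pdia Y X) D).hom
      prod.snd prod.fst prod.snd prod.fst n.hom (unitArr (adj Y X) A).lift (DHom.cart_isCart _ D)
      (IsBinProd.of_prod _ _).symm (IsBinProd.of_prod _ _).symm n.lift
      (unitArr_frobenius_snd (adj Y X) D A) (unitArr_frobenius_fst (adj Y X) D A)
      ((unitArr (adj Y X) A).cocartOver_iff.2 ⟨unitArr_isCoc _ A, paramDiag_pdia Y X⟩)
  · let n : DHom (pdia Y X) _ _ := ((unitArr (adj Y X) ((reindex p (prod.map f (𝟙 X))).obj A)).comp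
      (DHom.ofFib (beckChevalley p (pdia_square f X) (adj Y X) (adj Z X) A))).cast (by simp)
    refine (unitArr_isCoc (adj Y X) _).isIso_of_comp (ψ := n) ?_ rfl
    refine (n.cocartOver_iff (Θ := ParamDiag).1 ?_).1
    -- The unparametrised diagonal of `X` suffices, with `f` as the change of parameter: `(Y ⨯ X) ⨯
    -- X` is regarded as a product of `Y` and `X ⨯ X`.
    refine productStable_of_univ H f (dia X) (paramDiag_dia X) prod.fst prod.snd prod.fst prod.snd
      (prod.fst ≫ prod.fst) (prod.lift (prod.fst ≫ prod.snd) prod.snd)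
      (prod.fst ≫ prod.fst) (prod.lift (prod.fst ≫ prod.snd) prod.snd)
      (IsBinProd.of_prod _ _) (IsBinProd.of_prod _ _)
      ((IsBinProd.of_prod _ _).assoc_left (IsBinProd.of_prod _ _))
      ((IsBinProd.of_prod _ _).assoc_left (IsBinProd.of_prod _ _))
      (prod.map f (𝟙 X)) (prod.map (prod.map f (𝟙 X)) (𝟙 X)) (pdia Y X) (pdia Z X)
      ?_ ?_ ?_ ?_ n.hom (unitArr (adj Z X) A).hom
      (DHom.cart _ A).hom (DHom.cart _ _).hom n.lift (unitArr (adj Z X) A).lift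
      (DHom.cart_isCart _ A) (DHom.cart_isCart _ _)
      (unitArr_beckChevalley (pdia_square f X) (adj Y X) (adj Z X) A).symm
      ((unitArr (adj Z X) A).cocartOver_iff.2 ⟨unitArr_isCoc _ A, paramDiag_pdia Z X⟩)
    · constructor <;> simp
    · constructor
      · simp
      · ext <;> simp
    · constructor
      · simp [pdia]
      · ext <;> simp [pdia, dia]
    · constructor
      · simp [pdia]
      · ext <;> simp [pdia, dia]

/-- Left adjoints satisfying Frobenius reciprocity and the Beck–Chevalley condition are given by
universal loops: `Eq_X` is the left adjoint applied to a terminal object. -/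
lemma IsElementary.exists_univ (h : IsElementary p) (X : B) : ∃ l : Loop p X, l.Univ := by
  obtain ⟨L, adj, frob, bc⟩ := h
  let u₀ := unitArr (adj (⊤_ B) X) (⊤_ (p.Fiber ((⊤_ B) ⨯ X)))
  let s : X ⟶ (⊤_ B) ⨯ X := prod.lift (terminal.from X) (𝟙 X)
  -- The left adjoint at parameter `1` lives over `(1 × X) × X`; reindexing along `h` brings it over
  -- `X × X`.
  let h : X ⨯ X ⟶ ((⊤_ B) ⨯ X) ⨯ X := prod.lift (prod.fst ≫ s) prod.snd
  have hs : s ≫ pdia (⊤_ B) X = dia X ≫ h := by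
    refine Limits.prod.hom_ext ?_ ?_ <;> simp [s, h, pdia, dia]
  have hh := DHom.cart_isCart h ((L (⊤_ B) X).obj (⊤_ _))
  let δ := hh.lift ((toTopD s (⊤_ (p.Fiber X))).comp u₀) (dia X) hs
  have hδ : δ.hom ≫ (DHom.cart h _).hom = (toTopD s (⊤_ (p.Fiber X))).hom ≫ u₀.hom := hh.fac _ _ _
  let l : Loop p X := ⟨_, δ.hom, δ.lift⟩
  refine ⟨l, Loop.univ_of_prod fun U => ?_⟩
  let c : U ⨯ X ⟶ (⊤_ B) ⨯ X := prod.map (terminal.from U) (𝟙 X)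
  let b : (U ⨯ X) ⨯ X ⟶ ((⊤_ B) ⨯ X) ⨯ X := prod.map c (𝟙 X)
  have hb : b = pr23 U X ≫ h := by
    refine Limits.prod.hom_ext (Limits.prod.hom_ext (Subsingleton.elim _ _) ?_) ?_ <;>
      simp [b, c, h, s, pr23]
  let T := (reindex p c).obj (⊤_ (p.Fiber ((⊤_ B) ⨯ X)))
  have hc := DHom.cart_isCart c (⊤_ (p.Fiber ((⊤_ B) ⨯ X)))
  let u₁ := unitArr (adj U X) T
  let β := beckChevalley p (pdia_square (terminal.from U) X) (adj U X) (adj (⊤_ B) X)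
    (⊤_ (p.Fiber ((⊤_ B) ⨯ X)))
  have : IsIso β := bc _ _ _ _ _
  have : IsIso (DHom.ofFib β).hom := inferInstanceAs (IsIso (Fiber.fiberInclusion.map β))
  let β' : DHom b ((L U X).obj T) ((L (⊤_ B) X).obj (⊤_ _)) :=
    ((DHom.ofFib β).comp (DHom.cart b _)).cast (by simp)
  have hβ' : β'.IsCart := ((DHom.isCart_of_isIso (DHom.ofFib β)).comp
    (DHom.cart_isCart b _)).congr (by simp) rfl
  have hu₁ : u₁.hom ≫ β'.hom = (DHom.cart c _).hom ≫ u₀.hom := by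
    have := unitArr_beckChevalley (pdia_square (terminal.from U) X) (adj U X) (adj (⊤_ B) X)
      (⊤_ (p.Fiber ((⊤_ B) ⨯ X)))
    rw [Category.assoc] at this
    exact this
  let ν : DHom (pr23 U X) ((L U X).obj T) l.obj := hh.lift β' (pr23 U X) hb
  have hν : ν.hom ≫ (DHom.cart h _).hom = β'.hom := hh.fac _ _ _
  -- Beck–Chevalley along `U ⟶ 1`: the left adjoint applied to the terminal object `T` over `U × X`
  -- is `⟨2,3⟩^* Eq_X`.
  have hνc : ν.IsCart := DHom.IsCart.of_comp hh (hβ'.congr hb hν.symm)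
  have hu₁ν : u₁.hom ≫ ν.hom = (l.refl prod.snd T).hom := by
    refine hh.ext (u₁.comp ν) (l.refl prod.snd T) (by ext <;> simp [pdia, pr23, dia]) ?_
    have e : (l.refl prod.snd T).hom ≫ (DHom.cart h _).hom =
        ((toTopD (prod.snd : U ⨯ X ⟶ X) T).comp (toTopD s (⊤_ (p.Fiber X)))).hom ≫ u₀.hom := by
      rw [Loop.refl, DHom.comp_hom, DHom.comp_hom, Category.assoc, Category.assoc]
      exact congrArg _ hδ
    rw [e, DHom.comp_hom, Category.assoc, hν, hu₁]
    congr 1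
    refine top_ext (DHom.cart c _) ((toTopD prod.snd T).comp (toTopD s _)) ?_
    exact Limits.prod.hom_ext (Subsingleton.elim _ _) (by simp [c, s])
  refine univAt_of (IsBinProd.of_prod (U ⨯ X) X) (d := pdia U X) (prod.lift_fst _ _)
    (prod.lift_snd _ _) fun A => ?_
  -- Frobenius reciprocity is applied to `⟨1,2⟩^* A`. Its restriction to the diagonal is `A` again,
  -- and the product with `T` changes nothing, so the left adjoint of `A` becomes `⟨1,2⟩^* A ∧
  -- ⟨2,3⟩^* Eq_X`.
  let D := (reindex p (pr12 U X)).obj A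
  have hD := DHom.cart_isCart (pr12 U X) A
  have hD' := DHom.cart_isCart (pdia U X) D
  have hd : pdia U X ≫ pr12 U X = 𝟙 _ := prod.lift_fst _ _
  let F := frobenius p (adj U X) D T
  have : IsIso F := frob _ _ _ _
  have : IsIso (DHom.ofFib F).hom := inferInstanceAs (IsIso (Fiber.fiberInclusion.map F))
  let n : DHom (pdia U X) ((reindex p (pdia U X)).obj D ⨯ T) (D ⨯ (L U X).obj T) :=
    ((unitArr (adj U X) _).comp (DHom.ofFib F)).cast (by simp)
  have hn : n.IsCoc :=
    ((unitArr_isCoc (adj U X) _).comp (DHom.isCoc_of_isIso (DHom.ofFib F))).congr (by simp) rfl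
  have hn₁ : n.hom ≫ und prod.fst = und prod.fst ≫ (DHom.cart (pdia U X) D).hom :=
    unitArr_frobenius_fst (adj U X) D T
  have hn₂ : n.hom ≫ und prod.snd = und prod.snd ≫ u₁.hom := unitArr_frobenius_snd (adj U X) D T
  let σ : DHom (𝟙 (U ⨯ X)) A ((reindex p (pdia U X)).obj D) :=
    hD'.lift (hD.lift (DHom.id A) (pdia U X) hd.symm) (𝟙 _) (by simp)
  have hσ : σ.hom ≫ (DHom.cart (pdia U X) D).hom ≫ (DHom.cart (pr12 U X) A).hom = 𝟙 _ := by
    rw [hD'.fac_assoc]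
    exact hD.fac _ _ _
  let t : DHom (𝟙 (U ⨯ X)) A T := hc.lift (toTopD c A) (𝟙 _) (by simp)
  have hP := isJC_of_isBinProd (IsBinProd.of_prod ((reindex p (pdia U X)).obj D) T)
  let i := hP.lift (𝟙 (U ⨯ X)) σ t (by simp) (by simp)
  have hi₁ : i.hom ≫ und prod.fst = σ.hom := hP.lift_fst _ _ _ _ _
  let i' : DHom (𝟙 (U ⨯ X)) ((reindex p (pdia U X)).obj D ⨯ T) A :=
    (((DHom.ofFib prod.fst).comp (DHom.cart (pdia U X) D)).comp (DHom.cart (pr12 U X) A)).cast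
      (by simp [hd])
  have hii' : i.hom ≫ i'.hom = 𝟙 _ := by
    simp only [i', DHom.cast_hom, DHom.comp_hom, DHom.ofFib_hom, Category.assoc, reassoc_of% hi₁,
      hσ]
  have hi'i : i'.hom ≫ i.hom = 𝟙 _ := by
    -- The first components agree after two cartesian arrows; the second ones lie in `T`, a
    -- reindexing of a terminal object.
    refine hP.ext (i'.comp i) (DHom.id _) (by simp) ?_ ?_
    · refine hD'.ext ((i'.comp i).comp (DHom.ofFib prod.fst))
        ((DHom.id _).comp (DHom.ofFib prod.fst)) (by simp) ?_
      refine hD.ext (((i'.comp i).comp (DHom.ofFib prod.fst)).comp (DHom.cart (pdia U X) D))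
        (((DHom.id _).comp (DHom.ofFib prod.fst)).comp (DHom.cart (pdia U X) D)) (by simp) ?_
      simp only [DHom.comp_hom, DHom.ofFib_hom, Category.assoc, reassoc_of% hi₁, hσ, DHom.id_hom,
        Category.id_comp, Category.comp_id]
      simp [i']
    · exact hc.ext ((i'.comp i).comp (DHom.ofFib prod.snd))
        ((DHom.id _).comp (DHom.ofFib prod.snd)) (by simp) (top_ext
          (((i'.comp i).comp (DHom.ofFib prod.snd)).comp (DHom.cart c _))
          (((DHom.id _).comp (DHom.ofFib prod.snd)).comp (DHom.cart c _)) (by simp))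
  refine ⟨D ⨯ (L U X).obj T,
    ((DHom.ofFib prod.fst).comp (DHom.cart (pr12 U X) A)).cast (by simp; rfl),
    ((DHom.ofFib prod.snd).comp ν).cast (by simp; rfl), (i.comp n).cast (by simp), ?_, ?_, ?_, ?_⟩
  · exact (isJC_of_isBinProd (IsBinProd.of_prod _ _)).comp_cart hD hνc (by simp; rfl) (by simp; rfl)
      rfl rfl
  · have e : (i.hom ≫ n.hom) ≫ und prod.fst ≫ (DHom.cart (pr12 U X) A).hom = 𝟙 _ := by
      rw [Category.assoc, reassoc_of% hn₁, reassoc_of% hi₁, hσ]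
    exact e
  · simp only [DHom.cast_hom, DHom.comp_hom, DHom.ofFib_hom, Category.assoc, reassoc_of% hn₂, hu₁ν]
    rw [l.comp_refl (toTopD (𝟙 _) A) (v := prod.snd) (by simp), ← Category.assoc]
    exact l.comp_refl (i.comp (DHom.ofFib prod.snd)) (by simp)
  · exact ((DHom.isCoc_of_inv i i' hii' hi'i).comp hn).congr (by simp) rfl

end

end ElemFib

/-! ### The equivalence, centred on cocartesianness of the BCFR arrows -/

open CategoryTheory CategoryTheory.Limits CategoryTheory.Functor ElemFib

theorem theorem4p7 {B : Type*} [Category* B] {E : Type*} [Category* E] (p : E ⥤ B)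
    [p.IsFibered] [HasFiniteProducts B] [HasFibredProducts p] :
    List.TFAE [
      IsElementary p,
      HasCocartLifts p (ParamDiag (C := B)) ∧
        (ProductStable p ParamDiag (cocartOver p ParamDiag) ∧
          Pairable p (cocartOver p ParamDiag)),
      (∀ X : B, ∃ (Q : p.Fiber (X ⨯ X)) (d : tot (⊤_ (p.Fiber X)) ⟶ tot Q),
          p.IsStronglyCocartesian (dia X) d) ∧
        (ProductStable p ParamDiag (cocartOver p ParamDiag) ∧
          Pairable p (cocartOver p ParamDiag)),
      ∃ T : ∀ X : B, StrictTransporter p X,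
        StrictlyProductive (fun X => (T X).toLoop) ∧
        ∀ (X : B) {a b : E} (ψ : a ⟶ b), (T X).toLoop.BCFRClass ψ →
          fibEpic p ψ ∧ ParamDiag (p.map ψ),
      ∃ l : ∀ X : B, Loop p X,
        ∀ (X : B) {a b : E} (ψ : a ⟶ b), (l X).BCFRClass ψ → cocartOver p ParamDiag ψ,
      ∃ Q : ∀ X : B, p.Fiber (X ⨯ X),
        ∀ Y X : B, Nonempty (eqFunctor Y (Q X) ⊣ reindex p (pdia Y X))] := by
  tfae_have 1 → 5 := fun h => by
    choose l hl using fun X => h.exists_univ X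
    exact ⟨l, fun X _ _ ψ hψ => (hl X).bcfr ψ hψ⟩
  tfae_have 5 → 1 := fun ⟨l, h⟩ => isElementary_of_univ fun X => Loop.univ_of_bcfr (h X)
  tfae_have 5 → 2 := fun ⟨l, h⟩ =>
    have H : ∀ X, (l X).Univ := fun X => Loop.univ_of_bcfr (h X)
    ⟨hasCocartLifts_of_univ H, productStable_of_univ H, pairable_of_univ H⟩
  tfae_have 2 → 3 := fun ⟨h, h'⟩ => ⟨fun X => h (dia X) (paramDiag_dia X) _, h'⟩
  tfae_have 3 → 5 := fun ⟨h, h₁, h₂⟩ => by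
    choose Q d hd using h
    exact ⟨fun X => ⟨Q X, d X, (hd X).toIsHomLift⟩, fun X _ _ ψ hψ =>
      bcfr_of_productStable_of_pairable h₁ h₂ (hd X) ψ hψ⟩
  tfae_have 5 → 4 := fun ⟨l, h⟩ => by
    have H : ∀ X, (l X).Univ := fun X => Loop.univ_of_bcfr (h X)
    obtain ⟨T, hT⟩ := exists_strictTransporter H
    obtain rfl : (fun X => (T X).toLoop) = l := funext hT
    exact ⟨T, strictlyProductive_of_univ H, fun X _ _ ψ hψ =>
      ⟨(h X ψ hψ).fibEpic, (h X ψ hψ).2⟩⟩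
  tfae_have 4 → 5 := fun ⟨T, hT, h⟩ =>
    ⟨fun X => (T X).toLoop, fun X _ _ ψ hψ => cocartOver_of_transporter T hT (h X) ψ hψ⟩
  tfae_have 5 → 6 := fun ⟨l, h⟩ => ⟨fun X => (l X).obj, fun Y X =>
    ⟨((Loop.univ_of_bcfr (h X)).exists_adjunction Y).choose⟩⟩
  tfae_have 6 → 5 := fun ⟨Q, h⟩ => by
    choose l hl using fun X => exists_loop_of_adjunction (fun Y => h Y X)
    obtain rfl : (fun X => (l X).obj) = Q := funext hl
    exact ⟨l, fun X _ _ ψ hψ => (univ_of_adjunction fun Y => h Y X).bcfr ψ hψ⟩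
  tfae_finish
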